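/- **Setting.** Let $k\ge 0$ and let $(W,\omega)$ be a compact symplectic manifold of dimension $2k+4$ with boundary $M$ that is a weak symplectic filling of the cooriented contact manifold $(M,\xi=\ker\alpha)$, where $\alpha$ is a positive contact form: with respect to the boundary orientation, $\alpha\wedge d\alpha^{k+1}>0$ and $\alpha\wedge(T\,d\alpha+\omega|_{TM})^{k+1}>0$ for all $T\ge 0$. Let $N\subset M$ be a compact $(k+2)$-dimensional submanifold with an open book (a relative open book if $\partial N\neq\emptyset$) $(B,\vartheta)$: the binding $B$ is a nonempty closed codimension-$2$ submanifold of the interior of $N$ with a tubular neighborhood $B\times\mathbb D^2$, and $\vartheta\colon N\setminus B\to S^1$ is a fibration whose fibers are transverse to $\partial N$ and which is the angular coordinate near $B$. Assume that $N$ is a Legendrian open book (Lob: $\partial N=\emptyset$) or a bordered Legendrian open book (bLob: $\partial N\ne\emptyset$), i.e. the singular set $\{x\in N: T_xN\subset\xi_x\}$ is $B\cup\partial N$, and at all other points $\xi\cap TN=\ker d\vartheta$. Assume moreover that $\omega|_{TN}=d\alpha|_{TN}$. Let $J$ be an almost complex structure on $W$ that is tamed by $\omega$, whose bundle of complex tangencies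 along $M$ is $\xi$, that makes $M$ $J$-convex, and that has the following normal forms. Throughout, for a closed $k$-manifold $Q$, $J_Q$ is an almost complex structure on $T^*Q$ for which the zero section $Q$ is totally real, and $f_Q\colon T^*Q\to[0,\infty)$ is a smooth function that vanishes exactly on $Q$ and is $J_Q$-plurisubharmonic on the compact set $\{f_Q\le\delta\}$, for some $0<\delta<1$. * Near the binding: an open neighborhood of $B$ in $W$ is identified with $\{(z_1,z_2,\zeta)\in\mathbb C^2\times T^*B : \operatorname{Re}z_2>1-\delta,\ \tfrac12(|z_1|^2+|z_2|^2)+f_B(\zeta)\le\tfrac12\}$ such that $J=i\oplus J_B$, $M$ is given by equality in the last inequality, $N$ is $\{\operatorname{Im}z_2=0,\ |z_1|^2+|z_2|^2=1\}\times B$, and the binding is $\{(0,1)\}\times B$. * Near $\partial N$ (if nonempty): for some closed $k$-manifold $F$, an open neighborhood of $\partial N$ in $W$ is identified with $\{(z,\varphi+ir,\zeta)\in\mathbb C\times T^*S^1\times T^*F : \operatorname{Re}z>1-\delta,\ \tfrac12(|z|^2+r^2)+f_F(\zeta)\le\tfrac12\}$, where $T^*S^1=\mathbb C/2\pi\mathbb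 Z$, such that $J=i\oplus i\oplus J_F$, $M$ is given by equality, $N$ is $\{\operatorname{Im}z=0,\ r\ge0,\ |z|^2+r^2=1\}\times F$, and $\partial N$ corresponds to $r=0$. Let $\widetilde{\mathcal M}(\mathbb D^2,N)$ be the space of non-constant smooth $J$-holomorphic maps $u\colon(\mathbb D^2,\partial\mathbb D^2)\to(W,N)$ on the closed unit disk, with the $C^\infty$-topology. For a connected component $B_0$ of $B$ let $\widetilde{\mathcal M}_0(\mathbb D^2,N)$ be the connected component of $\widetilde{\mathcal M}(\mathbb D^2,N)$ that contains the Bishop family around $B_0$, that is, the disks $u_{s,q}(z)=(\sqrt{1-s^2}\,z,\,s;\,q)$ with $s\in(1-\delta,1)$ and $q\in B_0$ ($q$ being regarded as a point of the zero section). **Proposition.** There is a smooth function $f\colon N\to\mathbb R$ with $\alpha|_{TN}=f\,d\vartheta$ on $N\setminus B$ and $f^{-1}(0)=B\cup\partial N$; the function $|f|$ attains a maximum, and $C:=2\pi\max_{x\in N}|f(x)|$ is positive. For every component $B_0$ of the binding and every $u\in\widetilde{\mathcal M}_0(\mathbb D^2,N)$, the $\omega$-energy $E(u)=\int_{\mathbb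 D^2}u^*\omega$ (the integral of an integrable function) satisfies $$E(u)\le C .$$ -/

import Mathlib

open Set Filter Topology MeasureTheory Manifold Bundle
open scoped ContDiff UniformConvergence

noncomputable section

namespace BishopDisk

/-! ## Differential forms and almost complex structures on manifolds -/

section General

variable {E : Type*} [NormedAddCommGroup E] [NormedSpace ℝ E]
  {H : Type*} [TopologicalSpace H] (I : ModelWithCorners ℝ E H)
  {X : Type*} [TopologicalSpace X] [ChartedSpace H X]

/-- The expression of a differential `m`-form in the preferred chart at `x₀`, as a form on (a subset
of) the model vector space. -/
def formInChart {m : ℕ} (σ : ∀ x : X, TangentSpace I x [⋀^Fin m]→L[ℝ] ℝ) (x₀ : X) :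
    E → E [⋀^Fin m]→L[ℝ] ℝ := fun y =>
  (σ ((extChartAt I x₀).symm y)).compContinuousLinearMap
    (mfderivWithin 𝓘(ℝ, E) I (extChartAt I x₀).symm (range I) y)

/-- Smoothness of a differential form: its expressions in charts are smooth. -/
def IsSmoothForm {m : ℕ} (σ : ∀ x : X, TangentSpace I x [⋀^Fin m]→L[ℝ] ℝ) : Prop :=
  ∀ x₀ : X, ContDiffOn ℝ ∞ (formInChart I σ x₀) (extChartAt I x₀).target

/-- The exterior derivative of a differential form, computed at `x` in the preferred chart at `x`.
(The differential of that chart at `x` is the identity of `TangentSpace I x = E`.) -/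
def dForm {m : ℕ} (σ : ∀ x : X, TangentSpace I x [⋀^Fin m]→L[ℝ] ℝ) (x : X) :
    TangentSpace I x [⋀^Fin (m + 1)]→L[ℝ] ℝ :=
  (extDerivWithin (formInChart I σ x) (range I) (extChartAt I x x) : E [⋀^Fin (m + 1)]→L[ℝ] ℝ)

/-- A field of covectors as a differential `1`-form. -/
def oneForm (a : ∀ x : X, TangentSpace I x →L[ℝ] ℝ) (x : X) : TangentSpace I x [⋀^Fin 1]→L[ℝ] ℝ :=
  (ContinuousAlternatingMap.ofSubsingleton ℝ E ℝ (0 : Fin 1) (a x) : E [⋀^Fin 1]→L[ℝ] ℝ)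

/-- A symplectic form: smooth, closed and nondegenerate. -/
structure IsSymplecticForm (Ω : ∀ x : X, TangentSpace I x [⋀^Fin 2]→L[ℝ] ℝ) : Prop where
  smooth : IsSmoothForm I Ω
  closed : ∀ x, dForm I Ω x = 0
  nondegenerate : ∀ (x : X) (v : TangentSpace I x), (∀ w, Ω x ![v, w] = 0) → v = 0

/-- An almost complex structure: a smooth field of endomorphisms with `J² = -1`. -/
structure IsAlmostComplex [IsManifold I ∞ X]
    (J : ∀ x : X, TangentSpace I x →L[ℝ] TangentSpace I x) : Prop where
  smooth : ContMDiff I (I.prod 𝓘(ℝ, E →L[ℝ] E)) ∞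
    (fun x => TotalSpace.mk' (E →L[ℝ] E) (E := fun x : X => TangentSpace I x →L[ℝ] TangentSpace I x)
      x (J x))
  sq : ∀ (x : X) (v : TangentSpace I x), J x (J x v) = -v

/-- `d^J h (v) = - dh (J v)`. -/
def dJ (J : ∀ x : X, TangentSpace I x →L[ℝ] TangentSpace I x) (h : X → ℝ) (x : X) :
    TangentSpace I x →L[ℝ] ℝ :=
  (-((mfderiv I 𝓘(ℝ, ℝ) h x : E →L[ℝ] ℝ).comp (J x : E →L[ℝ] E)) : E →L[ℝ] ℝ)

/-- `h` is `J`-plurisubharmonic at `x`: the form `d d^J h` is positive on complex lines in `T_x X`. -/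
def PshAt (J : ∀ x : X, TangentSpace I x →L[ℝ] TangentSpace I x) (h : X → ℝ) (x : X) : Prop :=
  ∀ v : TangentSpace I x, v ≠ 0 → 0 < dForm I (oneForm I (dJ I J h)) x ![v, J x v]

/-- The boundary is `J`-convex: it has a regular equation `h ≤ 0` that is `J`-plurisubharmonic on a
neighborhood of the boundary. -/
def HasConvexBoundary (J : ∀ x : X, TangentSpace I x →L[ℝ] TangentSpace I x) : Prop :=
  ∃ h : X → ℝ, ContMDiff I 𝓘(ℝ, ℝ) ∞ h ∧ (∀ x, h x ≤ 0) ∧ (∀ x, h x = 0 ↔ x ∈ I.boundary X) ∧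
    (∀ x ∈ I.boundary X, mfderiv I 𝓘(ℝ, ℝ) h x ≠ 0) ∧
    ∃ V : Set X, IsOpen V ∧ I.boundary X ⊆ V ∧ ∀ x ∈ V, PshAt I J h x

end General

/-! ## Linear algebra: top exterior powers -/

/-- A positive multiple of `Ω ∧ ⋯ ∧ Ω` (`m` factors), evaluated on `2m` vectors. -/
def topPower {V : Type*} (m : ℕ) (Ω : V → V → ℝ) (v : Fin (2 * m) → V) : ℝ :=
  ∑ σ : Equiv.Perm (Fin (2 * m)), ((Equiv.Perm.sign σ : ℤ) : ℝ) *
    ∏ i : Fin m, Ω (v (σ ⟨2 * i, by omega⟩)) (v (σ ⟨2 * i + 1, by omega⟩))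

/-- A positive multiple of `a ∧ Ω ∧ ⋯ ∧ Ω` (`m` factors `Ω`), evaluated on `2m + 1` vectors. -/
def topWedge {V : Type*} (m : ℕ) (a : V → ℝ) (Ω : V → V → ℝ) (v : Fin (2 * m + 1) → V) : ℝ :=
  ∑ σ : Equiv.Perm (Fin (2 * m + 1)), ((Equiv.Perm.sign σ : ℤ) : ℝ) * (a (v (σ ⟨0, by omega⟩)) *
    ∏ i : Fin m, Ω (v (σ ⟨2 * i + 1, by omega⟩)) (v (σ ⟨2 * i + 2, by omega⟩)))

/-! ## Weak fillings

Dimensions: `dim W = 2k + 4`, `dim M = 2k + 3`, `dim N = k + 2`, and the binding has dimension `k`. -/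

/-- The model vector space `ℝ^k`. -/
abbrev Eu (k : ℕ) : Type := EuclideanSpace ℝ (Fin k)

section Filling

variable {k : ℕ}
  {W : Type*} [TopologicalSpace W] [ChartedSpace (EuclideanHalfSpace (2 * k + 4)) W]
  {M : Type*} [TopologicalSpace M] [ChartedSpace (Eu (2 * k + 3)) M]

/-- The zeroth coordinate of a vector. At boundary points of a manifold modelled on a half space,
the tangent vectors with vanishing zeroth coordinate are those tangent to the boundary. -/
def coordZero {n : ℕ} [NeZero n] (v : Eu n) : ℝ := v 0

/-- A tangent vector at a boundary point of `W` points transversely out of `W`: its zeroth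
coordinate is negative in the half space chart at that point. -/
def IsOutward (x : W) (ν : TangentSpace (𝓡∂ (2 * k + 4)) x) : Prop :=
  coordZero (n := 2 * k + 4) ν < 0

/-- `(W, Ω)` is a weak symplectic filling of `(M, ker α)`, where `ι` identifies `M` with the boundary
of `W` and `α` is a positive contact form: on every basis `v` of `T_p M` that is positive for the
boundary orientation of `(W, Ω)`, the forms `α ∧ dα^{k+1}` and `α ∧ (T dα + Ω)^{k+1}`, `T ≥ 0`,
are positive. -/
structure IsWeakFilling (Ω : ∀ x : W, TangentSpace (𝓡∂ (2 * k + 4)) x [⋀^Fin 2]→L[ℝ] ℝ)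
    (ι : M → W) (α : ∀ p : M, TangentSpace (𝓡 (2 * k + 3)) p →L[ℝ] ℝ) : Prop where
  symplectic : IsSymplecticForm (𝓡∂ (2 * k + 4)) Ω
  embedding : IsSmoothEmbedding (𝓡 (2 * k + 3)) (𝓡∂ (2 * k + 4)) ∞ ι
  range_eq : range ι = (𝓡∂ (2 * k + 4)).boundary W
  smooth : IsSmoothForm (𝓡 (2 * k + 3)) (oneForm (𝓡 (2 * k + 3)) α)
  contact : ∀ (p : M) (ν : TangentSpace (𝓡∂ (2 * k + 4)) (ι p))
    (v : Fin (2 * (k + 1) + 1) → TangentSpace (𝓡 (2 * k + 3)) p), IsOutward (ι p) ν →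
    0 < topPower (k + 2) (fun a b : TangentSpace (𝓡∂ (2 * k + 4)) (ι p) => Ω (ι p) ![a, b])
      (Fin.cons ν fun i => mfderiv (𝓡 (2 * k + 3)) (𝓡∂ (2 * k + 4)) ι p (v i)) →
    0 < topWedge (k + 1) (fun a => α p a)
      (fun a b => dForm (𝓡 (2 * k + 3)) (oneForm (𝓡 (2 * k + 3)) α) p ![a, b]) v
  filling : ∀ (p : M) (ν : TangentSpace (𝓡∂ (2 * k + 4)) (ι p))
    (v : Fin (2 * (k + 1) + 1) → TangentSpace (𝓡 (2 * k + 3)) p), IsOutward (ι p) ν →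
    0 < topPower (k + 2) (fun a b : TangentSpace (𝓡∂ (2 * k + 4)) (ι p) => Ω (ι p) ![a, b])
      (Fin.cons ν fun i => mfderiv (𝓡 (2 * k + 3)) (𝓡∂ (2 * k + 4)) ι p (v i)) →
    ∀ T : ℝ, 0 ≤ T → 0 < topWedge (k + 1) (fun a => α p a)
      (fun a b => T * dForm (𝓡 (2 * k + 3)) (oneForm (𝓡 (2 * k + 3)) α) p ![a, b] +
        Ω (ι p) ![mfderiv (𝓡 (2 * k + 3)) (𝓡∂ (2 * k + 4)) ι p a,
          mfderiv (𝓡 (2 * k + 3)) (𝓡∂ (2 * k + 4)) ι p b]) v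

/-- `J` is tamed by `Ω`, makes the boundary `J`-convex, and the bundle of complex tangencies of the
boundary is `ker α`. -/
structure IsTamedConvex [IsManifold (𝓡∂ (2 * k + 4)) ∞ W]
    (Ω : ∀ x : W, TangentSpace (𝓡∂ (2 * k + 4)) x [⋀^Fin 2]→L[ℝ] ℝ)
    (ι : M → W) (α : ∀ p : M, TangentSpace (𝓡 (2 * k + 3)) p →L[ℝ] ℝ)
    (J : ∀ x : W, TangentSpace (𝓡∂ (2 * k + 4)) x →L[ℝ] TangentSpace (𝓡∂ (2 * k + 4)) x) :
    Prop where
  almostComplex : IsAlmostComplex (𝓡∂ (2 * k + 4)) J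
  tamed : ∀ (x : W) (v : TangentSpace (𝓡∂ (2 * k + 4)) x), v ≠ 0 → 0 < Ω x ![v, J x v]
  convex : HasConvexBoundary (𝓡∂ (2 * k + 4)) J
  tangencies : ∀ (p : M) (v : TangentSpace (𝓡 (2 * k + 3)) p), α p v = 0 ↔
    ∃ w : TangentSpace (𝓡 (2 * k + 3)) p,
      J (ι p) (mfderiv (𝓡 (2 * k + 3)) (𝓡∂ (2 * k + 4)) ι p v) =
        mfderiv (𝓡 (2 * k + 3)) (𝓡∂ (2 * k + 4)) ι p w

end Filling

/-! ## Legendrian open books -/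

section OpenBooks

variable {k : ℕ}
  {N : Type*} [TopologicalSpace N] [ChartedSpace (EuclideanHalfSpace (k + 2)) N]
  {L : Type*} [TopologicalSpace L] [ChartedSpace (Eu k) L]

/-- The `1`-form `dϑ` of a unit complex valued function `ϑ = exp (i ·)`. -/
def dAngle (ϑ : N → ℂ) (x : N) (v : TangentSpace (𝓡∂ (k + 2)) x) : ℝ :=
  let w : ℂ := mfderiv (𝓡∂ (k + 2)) 𝓘(ℝ, ℂ) ϑ x v
  (star (ϑ x) * w).im

variable (k N L) in
/-- A (relative) open book on `N` with nonempty binding diffeomorphic to `L`. The binding has the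
tubular neighborhood `tube '' (L × 𝔻)`, in which `ϑ` is the normal angular coordinate. The map `ϑ`
(whose values on the binding are irrelevant) is a submersion to the unit circle whose fibers are
transverse to the boundary of `N`; given its form near the binding, this amounts to being a
fibration when `N` is compact. -/
structure OpenBook where
  tube : L × ℂ → N
  ϑ : N → ℂ
  nonempty : Nonempty L
  tube_smooth : ContMDiffOn ((𝓡 k).prod 𝓘(ℝ, ℂ)) (𝓡∂ (k + 2)) ∞ tube (univ ×ˢ Metric.ball 0 1)
  tube_injOn : InjOn tube (univ ×ˢ Metric.ball 0 1)
  tube_bijective : ∀ p ∈ (univ ×ˢ Metric.ball 0 1 : Set (L × ℂ)),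
    Function.Bijective (mfderiv ((𝓡 k).prod 𝓘(ℝ, ℂ)) (𝓡∂ (k + 2)) tube p)
  tube_interior : ∀ p ∈ (univ ×ˢ Metric.ball 0 1 : Set (L × ℂ)), tube p ∉ (𝓡∂ (k + 2)).boundary N
  norm_ϑ : ∀ x ∉ range (fun q => tube (q, 0)), ‖ϑ x‖ = 1
  ϑ_smooth : ContMDiffOn (𝓡∂ (k + 2)) 𝓘(ℝ, ℂ) ∞ ϑ (range fun q => tube (q, 0))ᶜ
  ϑ_tube : ∀ (q : L) (z : ℂ), z ≠ 0 → ‖z‖ < 1 → ϑ (tube (q, z)) = z / (‖z‖ : ℂ)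
  ϑ_submersion : ∀ x ∉ range (fun q => tube (q, 0)), ∃ v : TangentSpace (𝓡∂ (k + 2)) x,
    dAngle ϑ x v ≠ 0
  ϑ_transverse : ∀ x ∈ (𝓡∂ (k + 2)).boundary N, ∃ v : TangentSpace (𝓡∂ (k + 2)) x,
    coordZero (n := k + 2) v = 0 ∧ dAngle ϑ x v ≠ 0

/-- The binding of an open book. -/
def OpenBook.binding (ob : OpenBook k N L) : Set N := range fun q => ob.tube (q, 0)

variable {M : Type*} [TopologicalSpace M] [ChartedSpace (Eu (2 * k + 3)) M]

/-- The restriction of a `1`-form on `M` to `N`, mapped to `M` by `j`. -/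
def restrictForm (α : ∀ p : M, TangentSpace (𝓡 (2 * k + 3)) p →L[ℝ] ℝ) (j : N → M) (x : N)
    (v : TangentSpace (𝓡∂ (k + 2)) x) : ℝ :=
  α (j x) (mfderiv (𝓡∂ (k + 2)) (𝓡 (2 * k + 3)) j x v)

/-- The singular set of the distribution `ker α ∩ TN` on `N`. -/
def singSet (α : ∀ p : M, TangentSpace (𝓡 (2 * k + 3)) p →L[ℝ] ℝ) (j : N → M) : Set N :=
  {x | ∀ v : TangentSpace (𝓡∂ (k + 2)) x, restrictForm α j x v = 0}

/-- The regular leaves of the distribution `ker α ∩ TN` lie in the fibers of the open book: away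
from the singular set, `ker α ∩ TN` is the tangent space of the fiber. -/
def LeavesInPages (α : ∀ p : M, TangentSpace (𝓡 (2 * k + 3)) p →L[ℝ] ℝ) (j : N → M)
    (ob : OpenBook k N L) : Prop :=
  ∀ x ∉ singSet α j, ∀ v : TangentSpace (𝓡∂ (k + 2)) x,
    restrictForm α j x v = 0 ↔ dAngle ob.ϑ x v = 0

/-- `N` (embedded by `j`) is a Legendrian open book. -/
structure IsLob (α : ∀ p : M, TangentSpace (𝓡 (2 * k + 3)) p →L[ℝ] ℝ) (j : N → M)
    (ob : OpenBook k N L) : Prop where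
  embedding : IsSmoothEmbedding (𝓡∂ (k + 2)) (𝓡 (2 * k + 3)) ∞ j
  boundary : (𝓡∂ (k + 2)).boundary N = ∅
  sing : singSet α j = ob.binding
  leaves : LeavesInPages α j ob

/-- `N` (embedded by `j`) is a bordered Legendrian open book. -/
structure IsBLob (α : ∀ p : M, TangentSpace (𝓡 (2 * k + 3)) p →L[ℝ] ℝ) (j : N → M)
    (ob : OpenBook k N L) : Prop where
  embedding : IsSmoothEmbedding (𝓡∂ (k + 2)) (𝓡 (2 * k + 3)) ∞ j
  boundary : ((𝓡∂ (k + 2)).boundary N).Nonempty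
  sing : singSet α j = (𝓡∂ (k + 2)).boundary N ∪ ob.binding
  leaves : LeavesInPages α j ob

end OpenBooks

/-! ## Normal forms of the almost complex structure near the binding and near the boundary -/

/-- The total space of the cotangent bundle of `Q`. -/
abbrev Cotangent (k : ℕ) (Q : Type*) [TopologicalSpace Q] [ChartedSpace (Eu k) Q] : Type _ :=
  TotalSpace (Eu k →L[ℝ] ℝ) (fun q : Q => TangentSpace (𝓡 k) q →L[ℝ] ℝ)

/-- The model with corners of the cotangent bundle. -/
abbrev IT (k : ℕ) : ModelWithCorners ℝ (Eu k × (Eu k →L[ℝ] ℝ)) (ModelProd (Eu k) (Eu k →L[ℝ] ℝ)) :=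
  (𝓡 k).prod 𝓘(ℝ, Eu k →L[ℝ] ℝ)

/-- The model with corners of `ℂ² × T*Q`. -/
abbrev IC (k : ℕ) : ModelWithCorners ℝ ((ℂ × ℂ) × (Eu k × (Eu k →L[ℝ] ℝ)))
    (ModelProd (ℂ × ℂ) (ModelProd (Eu k) (Eu k →L[ℝ] ℝ))) :=
  𝓘(ℝ, ℂ × ℂ).prod (IT k)

section Models

variable {k : ℕ} {Q : Type*} [TopologicalSpace Q] [ChartedSpace (Eu k) Q]

/-- The zero section of the cotangent bundle. -/
def zeroCovector (q : Q) : Cotangent k Q := ⟨q, 0⟩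

/-- The almost complex structure `i ⊕ JQ` on `ℂ² × T*Q`. -/
def modelJ [IsManifold (𝓡 k) ∞ Q]
    (JQ : ∀ ξ : Cotangent k Q, TangentSpace (IT k) ξ →L[ℝ] TangentSpace (IT k) ξ)
    (p : (ℂ × ℂ) × Cotangent k Q) : TangentSpace (IC k) p →L[ℝ] TangentSpace (IC k) p :=
  ((Complex.I • ContinuousLinearMap.id ℝ (ℂ × ℂ)).prodMap
    (JQ p.2 : (Eu k × (Eu k →L[ℝ] ℝ)) →L[ℝ] (Eu k × (Eu k →L[ℝ] ℝ))) :
    ((ℂ × ℂ) × (Eu k × (Eu k →L[ℝ] ℝ))) →L[ℝ] ((ℂ × ℂ) × (Eu k × (Eu k →L[ℝ] ℝ))))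

/-- The model domain `{(z, ξ) ∈ ℂ² × T*Q | z ∈ R, g z + f ξ ≤ 1/2}`. -/
def modelDomain (g : ℂ × ℂ → ℝ) (R : Set (ℂ × ℂ)) (f : Cotangent k Q → ℝ) :
    Set ((ℂ × ℂ) × Cotangent k Q) :=
  {p | p.1 ∈ R ∧ g p.1 + f p.2 ≤ 1 / 2}

variable {W : Type*} [TopologicalSpace W] [ChartedSpace (EuclideanHalfSpace (2 * k + 4)) W]
  {N : Type*} [TopologicalSpace N]

variable (Q) in
/-- An identification of an open set `O ⊆ W` with a model domain in `ℂ² × T*Q` that carries `J` to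
`i ⊕ JQ`, the boundary of `W` to the hypersurface `g + f = 1/2`, and the submanifold `e(N)` to the
product of `S ⊆ ℂ²` with the zero section. Here the zero section is totally real for `JQ`, and `f` is
a nonnegative function that vanishes exactly on the zero section. The size `δ` of the
model is so small that `{f ≤ δ}` is compact and `f` is `JQ`-plurisubharmonic there. -/
structure ModelChart [IsManifold (𝓡 k) ∞ Q]
    (J : ∀ x : W, TangentSpace (𝓡∂ (2 * k + 4)) x →L[ℝ] TangentSpace (𝓡∂ (2 * k + 4)) x)
    (e : N → W) (g : ℂ × ℂ → ℝ) (R : ℝ → Set (ℂ × ℂ)) (S : Set (ℂ × ℂ)) where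
  JQ : ∀ ξ : Cotangent k Q, TangentSpace (IT k) ξ →L[ℝ] TangentSpace (IT k) ξ
  JQ_almostComplex : IsAlmostComplex (IT k) JQ
  totallyReal : ∀ (q : Q) (v w : TangentSpace (𝓡 k) q),
    JQ (zeroCovector q) (mfderiv (𝓡 k) (IT k) (zeroCovector (k := k)) q v) =
      mfderiv (𝓡 k) (IT k) (zeroCovector (k := k)) q w → v = 0
  f : Cotangent k Q → ℝ
  f_smooth : ContMDiff (IT k) 𝓘(ℝ, ℝ) ∞ f
  f_nonneg : ∀ ξ, 0 ≤ f ξ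
  f_eq_zero : ∀ ξ, f ξ = 0 ↔ ξ ∈ range (zeroCovector (k := k) (Q := Q))
  δ : ℝ
  δ_pos : 0 < δ
  δ_lt_one : δ < 1
  f_compact : IsCompact {ξ | f ξ ≤ δ}
  f_psh : ∀ ξ, f ξ ≤ δ → PshAt (IT k) JQ f ξ
  O : Set W
  isOpen_O : IsOpen O
  toModel : W → (ℂ × ℂ) × Cotangent k Q
  ofModel : (ℂ × ℂ) × Cotangent k Q → W
  toModel_mapsTo : MapsTo toModel O (modelDomain g (R δ) f)
  ofModel_mapsTo : MapsTo ofModel (modelDomain g (R δ) f) O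
  invOn : InvOn ofModel toModel O (modelDomain g (R δ) f)
  toModel_smooth : ContMDiffOn (𝓡∂ (2 * k + 4)) (IC k) ∞ toModel O
  ofModel_smooth : ContMDiffOn (IC k) (𝓡∂ (2 * k + 4)) ∞ ofModel (modelDomain g (R δ) f)
  holomorphic : ∀ x ∈ O, ∀ v : TangentSpace (𝓡∂ (2 * k + 4)) x,
    mfderiv (𝓡∂ (2 * k + 4)) (IC k) toModel x (J x v) =
      modelJ JQ (toModel x) (mfderiv (𝓡∂ (2 * k + 4)) (IC k) toModel x v)
  boundary : ∀ x ∈ O, x ∈ (𝓡∂ (2 * k + 4)).boundary W ↔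
    g (toModel x).1 + f (toModel x).2 = 1 / 2
  submanifold : ∀ x ∈ O, x ∈ range e ↔
    (toModel x).1 ∈ S ∧ (toModel x).2 ∈ range (zeroCovector (k := k) (Q := Q))

end Models

section Adapted

variable {k : ℕ}
  {W : Type*} [TopologicalSpace W] [ChartedSpace (EuclideanHalfSpace (2 * k + 4)) W]
  {N : Type*} [TopologicalSpace N] [ChartedSpace (EuclideanHalfSpace (k + 2)) N]
  {L : Type*} [TopologicalSpace L] [ChartedSpace (Eu k) L] [IsManifold (𝓡 k) ∞ L]
  {F : Type*} [TopologicalSpace F] [ChartedSpace (Eu k) F] [IsManifold (𝓡 k) ∞ F]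

/-- `J` has the elliptic normal form near the binding of the open book `ob`: in coordinates
`(z₁, z₂, ξ) ∈ ℂ² × T*L`, a neighborhood of the binding in `W` is given by `Re z₂ > 1 - δ`,
`(|z₁|² + |z₂|²) / 2 + f ξ ≤ 1/2`, and `N` is `{Im z₂ = 0, |z₁|² + |z₂|² = 1} × L`, with binding
`{(0, 1)} × L`. -/
structure BindingModel
    (J : ∀ x : W, TangentSpace (𝓡∂ (2 * k + 4)) x →L[ℝ] TangentSpace (𝓡∂ (2 * k + 4)) x)
    (e : N → W) (ob : OpenBook k N L) extends
    ModelChart L J e (fun z => (‖z.1‖ ^ 2 + ‖z.2‖ ^ 2) / 2)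
      (fun δ => {z | 1 - δ < z.2.re})
      {z | z.2.im = 0 ∧ ‖z.1‖ ^ 2 + ‖z.2‖ ^ 2 = 1} where
  binding_mem : ∀ q : L, e (ob.tube (q, 0)) ∈ O
  binding_eq : ∀ q : L, toModel (e (ob.tube (q, 0))) = ((0, 1), zeroCovector q)

variable (F) in
/-- `J` has the normal form near the boundary of `N ≅ 𝕊¹ × [0, ε) × F`. The cotangent bundle
`T*𝕊¹ = ℂ / 2πℤ`, with complex coordinate `φ + i r`, is identified with `ℂ ∖ {0}` by
`w = exp (i (φ + i r))`, so that `r = - log |w|`. In coordinates `(z, w, ξ) ∈ ℂ × (ℂ ∖ {0}) × T*F`,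
a neighborhood of the boundary of `N` in `W` is given by `Re z > 1 - δ`, `(|z|² + r²) / 2 + f ξ ≤ 1/2`,
and `N` is `{Im z = 0, r ≥ 0, |z|² + r² = 1} × F`, with boundary at `r = 0`. -/
structure BoundaryModel
    (J : ∀ x : W, TangentSpace (𝓡∂ (2 * k + 4)) x →L[ℝ] TangentSpace (𝓡∂ (2 * k + 4)) x)
    (e : N → W) extends
    ModelChart F J e (fun z => (‖z.1‖ ^ 2 + Real.log ‖z.2‖ ^ 2) / 2)
      (fun δ => {z | z.2 ≠ 0 ∧ 1 - δ < z.1.re})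
      {z | z.1.im = 0 ∧ ‖z.2‖ ≤ 1 ∧ ‖z.1‖ ^ 2 + Real.log ‖z.2‖ ^ 2 = 1} where
  boundary_mem : ∀ x ∈ (𝓡∂ (k + 2)).boundary N, e x ∈ O
  boundary_iff : ∀ x : N, e x ∈ O → (x ∈ (𝓡∂ (k + 2)).boundary N ↔ ‖(toModel (e x)).1.2‖ = 1)

end Adapted

/-! ## Holomorphic disks -/

/-- The closed unit disk. -/
abbrev Disk : Type := Metric.closedBall (0 : ℂ) 1

section Disks

variable {k : ℕ}
  {W : Type*} [TopologicalSpace W] [ChartedSpace (EuclideanHalfSpace (2 * k + 4)) W]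
  {N : Type*}

/-- An extension of a map on the closed unit disk to `ℂ`; the values outside the disk are irrelevant,
all derivatives being taken within the disk. -/
def diskExt {Y : Type*} (u : Disk → Y) : ℂ → Y :=
  Function.extend Subtype.val u (fun _ => u ⟨0, by simp⟩)

/-- The differential of a map on the closed unit disk. -/
def diskDeriv (u : Disk → W) (z : Disk) :
    ℂ →L[ℝ] TangentSpace (𝓡∂ (2 * k + 4)) (diskExt u z) :=
  mfderivWithin 𝓘(ℝ, ℂ) (𝓡∂ (2 * k + 4)) (diskExt u) (Metric.closedBall 0 1) (z : ℂ)

/-- The space of nonconstant smooth `J`-holomorphic maps `(𝔻, ∂𝔻) → (W, e(N))`. -/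
structure HolDisk
    (J : ∀ x : W, TangentSpace (𝓡∂ (2 * k + 4)) x →L[ℝ] TangentSpace (𝓡∂ (2 * k + 4)) x)
    (e : N → W) where
  toFun : Disk → W
  smooth : ContMDiffOn 𝓘(ℝ, ℂ) (𝓡∂ (2 * k + 4)) ∞ (diskExt toFun) (Metric.closedBall 0 1)
  holomorphic : ∀ (z : Disk) (v : ℂ),
    diskDeriv toFun z (Complex.I * v) = J (diskExt toFun z) (diskDeriv toFun z v)
  boundary : ∀ z : Disk, ‖(z : ℂ)‖ = 1 → toFun z ∈ range e
  nonconstant : ∃ z z' : Disk, toFun z ≠ toFun z'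

/-- The `C^∞`-topology on the space of disks: the coarsest one for which, for all smooth functions
`h` on `W` and all orders `m`, the `m`-th derivative of `h ∘ u` on the closed disk depends continuously
on `u` in the topology of uniform convergence. -/
instance
    (J : ∀ x : W, TangentSpace (𝓡∂ (2 * k + 4)) x →L[ℝ] TangentSpace (𝓡∂ (2 * k + 4)) x)
    (e : N → W) : TopologicalSpace (HolDisk J e) :=
  ⨅ (h : C^∞⟮𝓡∂ (2 * k + 4), W; ℝ⟯) (m : ℕ),
    TopologicalSpace.induced (fun u : HolDisk J e => UniformFun.ofFun fun z : Disk =>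
      iteratedFDerivWithin ℝ m (h ∘ diskExt u.toFun) (Metric.closedBall 0 1) (z : ℂ)) inferInstance

/-- The integrand of `u^* Ω` with respect to the standard area form of the disk. -/
def energyDensity (Ω : ∀ x : W, TangentSpace (𝓡∂ (2 * k + 4)) x [⋀^Fin 2]→L[ℝ] ℝ) (u : Disk → W)
    (z : ℂ) : ℝ :=
  Ω (diskExt u z)
    ![mfderivWithin 𝓘(ℝ, ℂ) (𝓡∂ (2 * k + 4)) (diskExt u) (Metric.closedBall 0 1) z (1 : ℂ),
      mfderivWithin 𝓘(ℝ, ℂ) (𝓡∂ (2 * k + 4)) (diskExt u) (Metric.closedBall 0 1) z Complex.I]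

/-- The `Ω`-energy `E(u) = ∫_𝔻 u^* Ω`. -/
def energy (Ω : ∀ x : W, TangentSpace (𝓡∂ (2 * k + 4)) x [⋀^Fin 2]→L[ℝ] ℝ) (u : Disk → W) : ℝ :=
  ∫ z in Metric.closedBall (0 : ℂ) 1, energyDensity Ω u z

variable [TopologicalSpace N] [ChartedSpace (EuclideanHalfSpace (k + 2)) N]
  {L : Type*} [TopologicalSpace L] [ChartedSpace (Eu k) L] [IsManifold (𝓡 k) ∞ L]
  {J : ∀ x : W, TangentSpace (𝓡∂ (2 * k + 4)) x →L[ℝ] TangentSpace (𝓡∂ (2 * k + 4)) x}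
  {e : N → W} {ob : OpenBook k N L}

/-- The Bishop family around the part `B₀` of the binding: in the model near the binding, the maps
`z ↦ (√(1 - s²) z, s; q, 0)` with `s ∈ (1 - δ, 1)` and `q ∈ B₀`. -/
def bishopFamily (c : BindingModel J e ob) (B₀ : Set L) : Set (HolDisk J e) :=
  {u | ∃ q ∈ B₀, ∃ s ∈ Ioo (1 - c.δ) 1, ∀ z : Disk, u.toFun z ∈ c.O ∧
    c.toModel (u.toFun z) = (((Real.sqrt (1 - s ^ 2) : ℂ) * z, (s : ℂ)), zeroCovector q)}

/-- The component of the space of holomorphic disks that contains the Bishop family around the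
connected component of `q₀` in the binding. -/
def bishopComponent (c : BindingModel J e ob) (q₀ : L) : Set (HolDisk J e) :=
  {u | ∃ v ∈ bishopFamily c (connectedComponent q₀), u ∈ connectedComponent v}

end Disks

end BishopDisk

end

open BishopDisk

noncomputable section

namespace BishopDisk

/-! ## Pullback of differential forms -/

section Pullback

variable {E : Type*} [NormedAddCommGroup E] [NormedSpace ℝ E]
  {H : Type*} [TopologicalSpace H] (I : ModelWithCorners ℝ E H)
  {X : Type*} [TopologicalSpace X] [ChartedSpace H X]
  {V : Type*} [NormedAddCommGroup V] [NormedSpace ℝ V] {m : ℕ}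

/-! By Stokes' theorem the energy of a disk is the action `∫ α` of its boundary loop, and this
action is controlled by the angle through which the loop turns around the binding.

Energy equals action. The form `Ω` is closed and restricts to `dα` on `N`. Hence the `excess` of a
disk, its `Ω`-area minus the integral of `α` over its boundary, is unchanged by a smooth homotopy
through disks with boundary on `N` (`stokes_cylinder`, `excess_eq_of_homotopy`). Uniformly close
disks are joined by a finite chain of such homotopies, each supported in a small patch and built
from local interpolations in `W` that preserve `N` (`exists_isInterpolation_of_mem`,
`eventually_eq_of_tendstoOnDisk`). So the excess is locally constant on the space of holomorphic
disks, hence constant on components. A Bishop disk contracts to a point of the binding through disks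
with boundary on `N`, so the constant is zero (`excess_bishop_eq_zero`).

Transversality. Let `h ≤ 0` be the plurisubharmonic equation of the boundary. Along a nonconstant
holomorphic disk `u` the function `h ∘ u` is subharmonic wherever `u` is close to the boundary of
`W`. By the strong maximum principle it is negative inside the disk, and by Hopf's lemma its radial
derivative is positive on the circle (`hopf_lemma`, `IsHolCurve.radial_deriv_pos`). If the boundary
loop `γ` had `α(γ') = 0` somewhere, then `J γ'` would be tangent to `M`; but `J γ'` is minus the
radial derivative of `u`, a contradiction. So `α(γ')` never vanishes, and in particular `γ` avoids
the binding.

Winding. The total angle swept by `ϑ ∘ γ` is therefore defined and locally constant on the space of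
disks. For a Bishop disk it is `±2π`: after shrinking the disk, the normal coordinate of the tubular
neighborhood is nearly an invertible real linear function of the coordinate of the disk
(`abs_sweptAngle_disk`).

Estimate. Write `α = f dϑ` on `N`. Then `f(γ) dϑ(γ')` has no zero, so `dϑ(γ')` has constant sign,
and `|∫ f dϑ(γ')| ≤ max |f| · |∫ dϑ(γ')| = 2π max |f|` (`abs_pathIntegral_le`). Only absolute values
enter, so no orientation has to be tracked. The function `f` is smooth across the binding because
there it equals `α` of the rotation field of the tubular neighborhood
(`contMDiffAt_contactFun_of_mem`). -/

/-- The pullback of a differential form under a map defined on a subset of a vector space. -/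
def pullForm (σ : ∀ x : X, TangentSpace I x [⋀^Fin m]→L[ℝ] ℝ) (f : V → X) (s : Set V) (p : V) :
    V [⋀^Fin m]→L[ℝ] ℝ :=
  (σ (f p)).compContinuousLinearMap (mfderivWithin 𝓘(ℝ, V) I f s p)

variable {I}

theorem contDiffWithinAt_extChartAt_comp {f : V → X}
    {s : Set V} (hf : ContMDiffOn 𝓘(ℝ, V) I ∞ f s) {p : V} (hp : p ∈ s) :
    ContDiffWithinAt ℝ ∞ (fun z => extChartAt I (f p) (f z)) s p :=
  ((contMDiffAt_extChartAt (I := I) (x := f p)).comp_contMDiffWithinAt p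
    (hf p hp)).contDiffWithinAt

theorem mapsTo_extChartAt_comp {f : V → X} {s : Set V} (hf : ContMDiffOn 𝓘(ℝ, V) I ∞ f s) {p : V}
    (hp : p ∈ s) : ∀ᶠ y in 𝓝[s] p, extChartAt I (f p) (f y) ∈ (extChartAt I (f p)).target := by
  filter_upwards [(hf p hp).continuousWithinAt (extChartAt_source_mem_nhds (I := I) (f p))] with y hy
  exact (extChartAt I (f p)).map_source hy

/-- The pullback is multilinear in the linear map and linear in the form; both dependences are
continuous, hence smooth. -/
theorem contDiffWithinAt_compContinuousLinearMap_apply {F : Type*} [NormedAddCommGroup F] [NormedSpace ℝ F]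
    {n : ℕ∞ω} {s : Set V} {p : V} {τ : V → F [⋀^Fin m]→L[ℝ] ℝ} {L : V → V →L[ℝ] F}
    (hτ : ContDiffWithinAt ℝ n τ s p) (hL : ContDiffWithinAt ℝ n L s p) (v : Fin m → V) :
    ContDiffWithinAt ℝ n (fun y => (τ y).compContinuousLinearMap (L y) v) s p := by
  have h1 : ContDiffWithinAt ℝ n (fun y =>
      ContinuousMultilinearMap.compContinuousLinearMapContinuousMultilinear ℝ (fun _ : Fin m => V)
        (fun _ => F) ℝ (fun _ => L y)
        (τ y).toContinuousMultilinearMap v) s p := by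
    have h2 : ContDiffWithinAt ℝ n (fun y =>
      ContinuousMultilinearMap.compContinuousLinearMapContinuousMultilinear ℝ (fun _ : Fin m => V)
        (fun _ => F) ℝ (fun _ => L y)) s p :=
      (ContinuousMultilinearMap.contDiff _).contDiffAt.comp_contDiffWithinAt p
        (contDiffWithinAt_pi.2 fun _ => hL)
    have h3 := h2.clm_apply
      ((ContinuousAlternatingMap.toContinuousMultilinearMapLI (𝕜 := ℝ) (E := F) (F := ℝ)
        (ι := Fin m)).contDiff.contDiffAt.comp_contDiffWithinAt p hτ)
    exact (ContinuousMultilinearMap.apply ℝ (fun _ : Fin m => V) ℝ v).contDiff.contDiffAt.comp_contDiffWithinAt p h3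
  exact h1

variable [IsManifold I ∞ X]

/-- By the chain rule the pullback factors through one chart, fixed near `p`. This reduces
statements about forms on `X` to forms on the model vector space. -/
theorem pullForm_eventuallyEq (σ : ∀ x : X, TangentSpace I x [⋀^Fin m]→L[ℝ] ℝ) {f : V → X}
    {s : Set V} (hf : ContMDiffOn 𝓘(ℝ, V) I ∞ f s) (hs : UniqueDiffOn ℝ s) {p : V} (hp : p ∈ s) :
    ∀ᶠ y in 𝓝[s] p, pullForm I σ f s y =
      (formInChart I σ (f p) (extChartAt I (f p) (f y))).compContinuousLinearMap
        (fderivWithin ℝ (fun z => extChartAt I (f p) (f z)) s y) := by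
  have hc : ContinuousWithinAt f s p := (hf p hp).continuousWithinAt
  have h1 : ∀ᶠ y in 𝓝[s] p, f y ∈ (chartAt H (f p)).source :=
    hc ((chartAt H (f p)).open_source.mem_nhds (mem_chart_source H (f p)))
  filter_upwards [h1, eventually_mem_nhdsWithin, eventually_eventually_nhdsWithin.2 h1]
    with y hy hys hye
  have hsrc : f y ∈ (extChartAt I (f p)).source := by simpa using hy
  have hinv : (extChartAt I (f p)).symm (extChartAt I (f p) (f y)) = f y :=
    (extChartAt I (f p)).left_inv hsrc
  have hd1 : MDifferentiableWithinAt 𝓘(ℝ, E) I (extChartAt I (f p)).symm (range I)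
      (extChartAt I (f p) (f y)) :=
    mdifferentiableWithinAt_extChartAt_symm ((extChartAt I (f p)).map_source hsrc)
  have hd2 : MDifferentiableWithinAt 𝓘(ℝ, V) 𝓘(ℝ, E) (fun z => extChartAt I (f p) (f z)) s y :=
    (mdifferentiableAt_extChartAt hy).comp_mdifferentiableWithinAt y
      ((hf y hys).mdifferentiableWithinAt (by simp))
  have hu : UniqueMDiffWithinAt 𝓘(ℝ, V) s y := (hs y hys).uniqueMDiffWithinAt
  have hch := mfderivWithin_comp y hd1 hd2 (fun z _ => by
    simp only [mem_preimage, extChartAt, OpenPartialHomeomorph.extend, PartialEquiv.coe_trans,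
      ModelWithCorners.toPartialEquiv_coe, Function.comp_apply, mem_range_self]) hu
  have hcongr : mfderivWithin 𝓘(ℝ, V) I
      ((extChartAt I (f p)).symm ∘ fun z => extChartAt I (f p) (f z)) s y =
      mfderivWithin 𝓘(ℝ, V) I f s y := by
    refine Filter.EventuallyEq.mfderivWithin_eq ?_ hinv
    filter_upwards [hye] with z hz
    exact (extChartAt I (f p)).left_inv (by simpa using hz)
  rw [mfderivWithin_eq_fderivWithin] at hch
  have hσ := congrArg (fun x : X => (show E [⋀^Fin m]→L[ℝ] ℝ from σ x)) hinv
  have hD : (mfderivWithin 𝓘(ℝ, V) I f s y : V →L[ℝ] E) =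
      (mfderivWithin 𝓘(ℝ, E) I (extChartAt I (f p)).symm (range I)
        (extChartAt I (f p) (f y)) : E →L[ℝ] E).comp
      (fderivWithin ℝ (fun z => extChartAt I (f p) (f z)) s y) := hcongr.symm.trans hch
  ext v
  change (σ (f y) : E [⋀^Fin m]→L[ℝ] ℝ)
      (fun i => (mfderivWithin 𝓘(ℝ, V) I f s y : V →L[ℝ] E) (v i)) =
    (σ ((extChartAt I (f p)).symm (extChartAt I (f p) (f y))) : E [⋀^Fin m]→L[ℝ] ℝ)
      (fun i => (mfderivWithin 𝓘(ℝ, E) I (extChartAt I (f p)).symm (range I)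
        (extChartAt I (f p) (f y)) : E →L[ℝ] E)
        (fderivWithin ℝ (fun z => extChartAt I (f p) (f z)) s y (v i)))
  rw [hD]
  exact (congrArg (fun τ : E [⋀^Fin m]→L[ℝ] ℝ => τ _) hσ).symm

theorem contDiffOn_pullForm {σ : ∀ x : X, TangentSpace I x [⋀^Fin m]→L[ℝ] ℝ}
    (hσ : IsSmoothForm I σ) {f : V → X}
    {s : Set V} (hf : ContMDiffOn 𝓘(ℝ, V) I ∞ f s) (hs : UniqueDiffOn ℝ s) (v : Fin m → V) :
    ContDiffOn ℝ ∞ (fun p => pullForm I σ f s p v) s := by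
  intro p hp
  have hF := contDiffWithinAt_extChartAt_comp hf hp
  have hev := pullForm_eventuallyEq σ hf hs hp
  refine ContDiffWithinAt.congr_of_eventuallyEq ?_ (hev.mono fun y hy => congrArg (fun τ : V [⋀^Fin m]→L[ℝ] ℝ => τ v) hy)
    (congrArg (fun τ : V [⋀^Fin m]→L[ℝ] ℝ => τ v) (hev.self_of_nhdsWithin hp))
  have hFd : ContDiffWithinAt ℝ ∞ (fderivWithin ℝ (fun z => extChartAt I (f p) (f z)) s) s p :=
    hF.fderivWithin_right hs (by simp) hp
  have h1 : ContDiffWithinAt ℝ ∞ (fun y => formInChart I σ (f p) (extChartAt I (f p) (f y))) s p := by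
    exact (hσ (f p) _ (mem_extChartAt_target (I := I) (f p))).comp_of_preimage_mem_nhdsWithin p hF
      (mapsTo_extChartAt_comp hf hp)
  exact contDiffWithinAt_compContinuousLinearMap_apply h1 hFd v

/-- Naturality of `d`, reduced to vector spaces through the chart at `f p`, the same chart that
defines `dForm` at `f p`. Only differentiability of the form at that single point is required,
because for `d^J h` regularity is established only at the center of each chart. -/
theorem extDerivWithin_pullForm {σ : ∀ x : X, TangentSpace I x [⋀^Fin m]→L[ℝ] ℝ} {f : V → X}
    {s : Set V} (hf : ContMDiffOn 𝓘(ℝ, V) I ∞ f s) (hs : UniqueDiffOn ℝ s) {p : V} (hp : p ∈ s)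
    (hσ : DifferentiableWithinAt ℝ (formInChart I σ (f p)) (range I) (extChartAt I (f p) (f p)))
    (hp' : p ∈ closure (interior s)) :
    extDerivWithin (pullForm I σ f s) s p = pullForm I (dForm I σ) f s p := by
  have hF := contDiffWithinAt_extChartAt_comp hf hp
  have hev := pullForm_eventuallyEq σ hf hs hp
  rw [Filter.EventuallyEq.extDerivWithin_eq_of_mem hev hp]
  have := extDerivWithin_pullback (f := fun z => extChartAt I (f p) (f z)) (t := range I) (r := ∞) hσ hF (by simp; exact WithTop.coe_le_coe.2 le_top) hs hp' hp
    (fun z _ => by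
      simp only [extChartAt, OpenPartialHomeomorph.extend, PartialEquiv.coe_trans,
        ModelWithCorners.toPartialEquiv_coe, Function.comp_apply, mem_range_self])
  rw [this]
  have hm : mfderivWithin 𝓘(ℝ, V) I f s p = fderivWithin ℝ (fun z => extChartAt I (f p) (f z)) s p := by
    have hmd : MDifferentiableWithinAt 𝓘(ℝ, V) I f s p :=
      (hf p hp).mdifferentiableWithinAt (by simp)
    refine hmd.mfderivWithin.trans ?_
    change fderivWithin ℝ (fun z => extChartAt I (f p) (f z)) (s ∩ range id) p = _
    rw [range_id, inter_univ]
  unfold pullForm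
  rw [hm]
  rfl

end Pullback

/-! ## Stokes' theorem on boxes -/

/-- The standard basis of `ℝⁿ`. -/
def stdVec {n : ℕ} (i : Fin n) : Fin n → ℝ := Pi.single i 1

/-- This is the divergence theorem: `dη` evaluated on the standard basis is the divergence of the
field whose `i`-th component is `(-1)^i` times `η` on the basis with the `i`-th vector omitted. -/
theorem integral_extDeriv_box {n : ℕ} (a b : Fin (n + 1) → ℝ) (hle : a ≤ b)
    (η : (Fin (n + 1) → ℝ) → (Fin (n + 1) → ℝ) [⋀^Fin n]→L[ℝ] ℝ) (hd : Differentiable ℝ η)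
    (hi : Continuous fun x => extDeriv η x stdVec) :
    ∫ x in Icc a b, extDeriv η x stdVec =
      ∑ i : Fin (n + 1), ((∫ x in Icc (a ∘ i.succAbove) (b ∘ i.succAbove),
        (-1) ^ i.val * η (i.insertNth (α := fun _ => ℝ) (b i) x) (stdVec ∘ i.succAbove)) -
        ∫ x in Icc (a ∘ i.succAbove) (b ∘ i.succAbove),
          (-1) ^ i.val * η (i.insertNth (α := fun _ => ℝ) (a i) x) (stdVec ∘ i.succAbove)) := by
  have hd' : ∀ (v : Fin n → Fin (n + 1) → ℝ), Differentiable ℝ fun x => η x v := fun v x =>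
    (ContinuousAlternatingMap.apply ℝ _ ℝ v).differentiableAt.comp x (hd x)
  have key : ∀ x, extDeriv η x stdVec =
      ∑ i : Fin (n + 1), ((-1 : ℝ) ^ i.val • fderiv ℝ (fun y => η y (stdVec ∘ i.succAbove)) x) (stdVec i) := fun x => by
    rw [extDeriv_apply (hd x)]
    refine Finset.sum_congr rfl fun i _ => ?_
    rw [_root_.smul_apply, ← Int.cast_smul_eq_zsmul ℝ]
    push_cast
    rfl
  simp only [key] at hi ⊢
  refine integral_divergence_of_hasFDerivAt_off_countable' a b hle
    (fun i x => (-1) ^ i.val * η x (stdVec ∘ i.succAbove))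
    (fun i x => (-1 : ℝ) ^ i.val • fderiv ℝ (fun y => η y (stdVec ∘ i.succAbove)) x) ∅ countable_empty
    (fun i => ((hd' _).continuous.const_mul _ |>.continuousOn)) (fun x _ i => ?_)
    (hi.continuousOn.integrableOn_compact isCompact_Icc)
  exact (hd' (stdVec ∘ i.succAbove) x).hasFDerivAt.const_mul ((-1 : ℝ) ^ i.val)

/-! ## The Hopf boundary point lemma in the plane -/

section Hopf

/-- If `c > 0`, the second derivative test makes `0` a local minimum as well. Then `φ` is constant
near `0`, which forces `c = 0`. -/
theorem second_deriv_nonpos_of_isLocalMax {φ φ' : ℝ → ℝ} {c : ℝ} (hmax : IsLocalMax φ 0)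
    (h1 : ∀ᶠ t in 𝓝 0, HasDerivAt φ (φ' t) t) (h2 : HasDerivAt φ' c 0) : c ≤ 0 := by
  by_contra! hc
  have hd : deriv φ =ᶠ[𝓝 0] φ' := h1.mono fun t ht => ht.deriv
  have h0 : deriv φ 0 = 0 := hmax.deriv_eq_zero
  have h2' : deriv (deriv φ) 0 = c := hd.deriv_eq.trans h2.deriv
  have hmin : IsLocalMin φ 0 := isLocalMin_of_deriv_deriv_pos (by rw [h2']; exact hc) h0
    h1.self_of_nhds.continuousAt
  have hconst : φ =ᶠ[𝓝 0] fun _ => φ 0 := by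
    filter_upwards [hmax, hmin] with t h1 h2 using le_antisymm h1 h2
  have : deriv φ =ᶠ[𝓝 0] fun _ => 0 := by
    have := hconst.deriv
    simpa using this
  have h3 := this.deriv_eq
  simp only [deriv_const] at h3
  linarith

/-- The Laplacian of a function on `ℂ`. -/
def lap (g : ℂ → ℝ) (z : ℂ) : ℝ :=
  fderiv ℝ (fun w => fderiv ℝ g w 1) z 1 + fderiv ℝ (fun w => fderiv ℝ g w Complex.I) z Complex.I

theorem directional_derivs {g : ℂ → ℝ} {z : ℂ} (hg : ContDiffAt ℝ 2 g z) (v : ℂ) :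
    (∀ᶠ t : ℝ in 𝓝 0, HasDerivAt (fun t : ℝ => g (z + t * v)) (fderiv ℝ g (z + t * v) v) t) ∧
    HasDerivAt (fun t : ℝ => fderiv ℝ g (z + t * v) v) (fderiv ℝ (fun w => fderiv ℝ g w v) z v) 0 := by
  have hl : ∀ t : ℝ, HasDerivAt (fun t : ℝ => z + t * v) v t := fun t => by
    simpa using ((Complex.ofRealCLM.hasDerivAt (x := t)).mul_const v).const_add z
  constructor
  · have hev : ∀ᶠ w in 𝓝 z, DifferentiableAt ℝ g w :=
      (hg.eventually (by simp)).mono fun w hw => hw.differentiableAt (by simp)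
    have hc : Tendsto (fun t : ℝ => z + t * v) (𝓝 0) (𝓝 z) := by
      have := (hl 0).continuousAt.tendsto
      simpa using this
    filter_upwards [hc.eventually hev] with t ht
    exact ht.hasFDerivAt.comp_hasDerivAt t (hl t)
  · have hd : DifferentiableAt ℝ (fun w => fderiv ℝ g w v) (z + (0 : ℝ) * v) := by
      simp only [Complex.ofReal_zero, zero_mul, add_zero]
      have : ContDiffAt ℝ 1 (fderiv ℝ g) z := hg.fderiv_right (by norm_num)
      exact (this.differentiableAt (by simp)).clm_apply (differentiableAt_const v)
    have := hd.hasFDerivAt.comp_hasDerivAt (0 : ℝ) (hl 0)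
    simp only [Complex.ofReal_zero, zero_mul, add_zero] at this
    exact this

/-- These are the first two derivatives of the barrier `|z|⁻²` along a coordinate line, with `a` the
coordinate along the line and `b` the transverse one. The two second derivatives add up to the
Laplacian `4 |z|⁻⁴ > 0`. -/
theorem barrier_derivs (a b : ℝ) (h : a ^ 2 + b ^ 2 ≠ 0) :
    (∀ᶠ t : ℝ in 𝓝 0, HasDerivAt (fun t : ℝ => ((a + t) ^ 2 + b ^ 2)⁻¹)
      (-(2 * (a + t)) / ((a + t) ^ 2 + b ^ 2) ^ 2) t) ∧
    HasDerivAt (fun t : ℝ => -(2 * (a + t)) / ((a + t) ^ 2 + b ^ 2) ^ 2)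
      ((8 * a ^ 2 - 2 * (a ^ 2 + b ^ 2)) / (a ^ 2 + b ^ 2) ^ 3) 0 := by
  have hq : ∀ t : ℝ, HasDerivAt (fun t : ℝ => (a + t) ^ 2 + b ^ 2) (2 * (a + t)) t := fun t => by
    simpa using (((hasDerivAt_id t).const_add a).pow 2).add_const (b ^ 2)
  constructor
  · have : ∀ᶠ t : ℝ in 𝓝 0, (a + t) ^ 2 + b ^ 2 ≠ 0 := by
      refine ContinuousAt.eventually_ne (hq 0).continuousAt (by simpa using h)
    filter_upwards [this] with t ht
    exact (hq t).inv ht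
  · have h1 : HasDerivAt (fun t : ℝ => -(2 * (a + t))) (-2) 0 := by
      have := (((hasDerivAt_id (0 : ℝ)).const_add a).const_mul 2).fun_neg
      simpa using this
    refine (h1.fun_div ((hq 0).fun_pow 2) (by simpa using h)).congr_deriv ?_
    simp
    field_simp
    ring

/-- **Hopf's lemma**: a negative subharmonic function on a disk that vanishes at a boundary point
decreases at least linearly along the radius to that point. -/
theorem hopf_lemma {g : ℂ → ℝ} {c z₀ : ℂ} {ρ : ℝ} (hρ : 0 < ρ) (hz₀ : ‖z₀ - c‖ = ρ)
    (hcont : ContinuousOn g (Metric.closedBall c ρ)) (hsm : ∀ z ∈ Metric.ball c ρ, ContDiffAt ℝ 2 g z)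
    (hsub : ∀ z ∈ Metric.ball c ρ, 0 ≤ lap g z) (hneg : ∀ z ∈ Metric.ball c ρ, g z < 0)
    (hle : ∀ z ∈ Metric.closedBall c ρ, g z ≤ 0) :
    ∃ ε > 0, ∀ s ∈ Icc (0 : ℝ) (1 / 2), g (z₀ - s * (z₀ - c)) ≤ -ε * s := by
  -- the maximum on the circle of half the radius
  have hne : (Metric.sphere c (ρ / 2)).Nonempty := NormedSpace.sphere_nonempty.2 (by positivity)
  have hsub1 : Metric.sphere c (ρ / 2) ⊆ Metric.closedBall c ρ := fun z hz => by
    simp only [Metric.mem_sphere] at hz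
    simp only [Metric.mem_closedBall]; linarith
  obtain ⟨zm, hzm, hmax⟩ := (isCompact_sphere c (ρ / 2)).exists_isMaxOn hne (hcont.mono hsub1)
  have hgm : g zm < 0 := hneg zm (by
    simp only [Metric.mem_sphere] at hzm
    simp only [Metric.mem_ball]; linarith)
  set η : ℝ := -g zm with hη
  have hηpos : 0 < η := by linarith
  -- On the inner circle the barrier `b` below equals `4/ρ² - 1/ρ² = 3/ρ²`, so this `ε` makes `ε *
  -- b` equal to `η` there and `g + ε * b ≤ 0` on both boundary circles of the annulus.
  set ε : ℝ := η * ρ ^ 2 / 3 with hε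
  have hεpos : 0 < ε := by positivity
  set b : ℂ → ℝ := fun z => ((z - c).re ^ 2 + (z - c).im ^ 2)⁻¹ - (ρ ^ 2)⁻¹ with hb
  have hnorm : ∀ z : ℂ, (z - c).re ^ 2 + (z - c).im ^ 2 = dist z c ^ 2 := fun z => by
    rw [dist_eq_norm, Complex.sq_norm, Complex.normSq_apply]; ring
  set A : Set ℂ := Metric.closedBall c ρ \ Metric.ball c (ρ / 2) with hA
  have hAc : IsCompact A := (isCompact_closedBall c ρ).diff Metric.isOpen_ball
  have hbcont : ContinuousOn b A := by
    intro z hz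
    have : (z - c).re ^ 2 + (z - c).im ^ 2 ≠ 0 := by
      rw [hnorm]
      have : ρ / 2 ≤ dist z c := by simpa using hz.2
      have : 0 < dist z c := by linarith
      positivity
    have h1 : ContinuousAt (fun z : ℂ => (z - c).re ^ 2 + (z - c).im ^ 2) z := by fun_prop
    exact ((h1.inv₀ this).sub continuousAt_const).continuousWithinAt
  have hz₀A : z₀ ∈ A := ⟨by simp [dist_eq_norm, hz₀], by
    simp only [Metric.mem_ball, dist_eq_norm, hz₀]; linarith⟩
  obtain ⟨p, hpA, hp⟩ := hAc.exists_isMaxOn ⟨z₀, hz₀A⟩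
    (f := fun z => g z + ε * b z) ((hcont.mono sdiff_subset).add (continuousOn_const.mul hbcont))
  have hpd1 : dist p c ≤ ρ := hpA.1
  have hpd2 : ρ / 2 ≤ dist p c := by simpa using hpA.2
  have hple : g p + ε * b p ≤ 0 := by
    rcases hpd1.eq_or_lt with h1 | h1
    · have : b p = 0 := by simp only [hb, hnorm, h1, sub_self]
      rw [this]; simpa using hle p hpA.1
    rcases hpd2.eq_or_lt with h2 | h2
    · have : b p = 3 / ρ ^ 2 := by
        simp only [hb, hnorm, ← h2]; field_simp; ring
      rw [this]
      have : g p ≤ g zm := hmax (by rw [Metric.mem_sphere, h2])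
      have h3 : ε * (3 / ρ ^ 2) = η := by rw [hε]; field_simp
      linarith
    -- A maximum inside the annulus is impossible: both second derivatives of `g + ε * b` would be
    -- nonpositive, although their sum is a nonnegative Laplacian plus `ε` times a positive one.
    · exfalso
      have hN : (p - c).re ^ 2 + (p - c).im ^ 2 ≠ 0 := by
        rw [hnorm]
        have : 0 < dist p c := by linarith
        positivity
      have hpb : p ∈ Metric.ball c ρ := h1
      have hnhds : A ∈ 𝓝 p := by
        refine Filter.mem_of_superset (inter_mem (Metric.isOpen_ball.mem_nhds hpb)
          ((Metric.isClosed_closedBall (x := c) (ε := ρ / 2)).isOpen_compl.mem_nhds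
            (by simpa using h2))) ?_
        rintro z ⟨h3, h4⟩
        exact ⟨Metric.ball_subset_closedBall h3, fun h5 => h4 (Metric.ball_subset_closedBall h5)⟩
      have hloc : IsLocalMax (fun z => g z + ε * b z) p := hp.isLocalMax hnhds
      have hlv : ∀ v : ℂ, IsLocalMax (fun t : ℝ => g (p + t * v) + ε * b (p + t * v)) 0 := fun v => by
        have hc : Tendsto (fun t : ℝ => p + t * v) (𝓝 0) (𝓝 p) := by
          have : Continuous fun t : ℝ => p + t * v := by fun_prop
          simpa using this.tendsto 0
        have := hc.eventually hloc
        simpa [IsLocalMax, IsMaxFilter] using this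
      set x := (p - c).re with hx
      set y := (p - c).im with hy
      have e1 : ∀ t : ℝ, b (p + t * 1) = ((x + t) ^ 2 + y ^ 2)⁻¹ - (ρ ^ 2)⁻¹ := fun t => by
        simp [hb, hx, hy]; ring_nf
      have e2 : ∀ t : ℝ, b (p + t * Complex.I) = ((y + t) ^ 2 + x ^ 2)⁻¹ - (ρ ^ 2)⁻¹ := fun t => by
        simp [hb, hx, hy]; ring_nf
      have d1 := directional_derivs (hsm p hpb) 1
      have d2 := directional_derivs (hsm p hpb) Complex.I
      have b1 := barrier_derivs x y hN
      have b2 := barrier_derivs y x (by rwa [add_comm])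
      have c1 := second_deriv_nonpos_of_isLocalMax (hlv 1)
        (by
          filter_upwards [d1.1, b1.1] with t h3 h4
          simp only [e1]
          exact h3.add ((h4.sub_const _).const_mul ε))
        (d1.2.add (b1.2.const_mul ε))
      have c2 := second_deriv_nonpos_of_isLocalMax (hlv Complex.I)
        (by
          filter_upwards [d2.1, b2.1] with t h3 h4
          simp only [e2]
          exact h3.add ((h4.sub_const _).const_mul ε))
        (d2.2.add (b2.2.const_mul ε))
      have hl := hsub p hpb
      rw [lap] at hl
      have hpos : 0 < (8 * x ^ 2 - 2 * (x ^ 2 + y ^ 2)) / (x ^ 2 + y ^ 2) ^ 3 +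
          (8 * y ^ 2 - 2 * (y ^ 2 + x ^ 2)) / (y ^ 2 + x ^ 2) ^ 3 := by
        have hN' : 0 < x ^ 2 + y ^ 2 := lt_of_le_of_ne (by positivity) (Ne.symm hN)
        have : (8 * x ^ 2 - 2 * (x ^ 2 + y ^ 2)) / (x ^ 2 + y ^ 2) ^ 3 +
          (8 * y ^ 2 - 2 * (y ^ 2 + x ^ 2)) / (y ^ 2 + x ^ 2) ^ 3 = 4 / (x ^ 2 + y ^ 2) ^ 2 := by
          rw [add_comm (y ^ 2)]
          field_simp
          ring
        rw [this]; positivity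
      have := mul_pos hεpos hpos
      linarith
  refine ⟨ε * (2 / ρ ^ 2), by positivity, fun s hs => ?_⟩
  have hs1 : 0 < 1 - s := by linarith [hs.2]
  have hdist : dist (z₀ - s * (z₀ - c)) c = (1 - s) * ρ := by
    rw [dist_eq_norm, show z₀ - s * (z₀ - c) - c = ((1 - s : ℝ) : ℂ) * (z₀ - c) by push_cast; ring,
      norm_mul, hz₀, Complex.norm_real, Real.norm_of_nonneg hs1.le]
  have hmem : z₀ - s * (z₀ - c) ∈ A := by
    refine ⟨?_, ?_⟩
    · rw [Metric.mem_closedBall, hdist]; nlinarith [hs.1]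
    · rw [Metric.mem_ball, hdist]; nlinarith [hs.2]
  have h1 : g (z₀ - s * (z₀ - c)) + ε * b (z₀ - s * (z₀ - c)) ≤ 0 := (hp hmem).trans hple
  have h2 : 2 / ρ ^ 2 * s ≤ b (z₀ - s * (z₀ - c)) := by
    simp only [hb, hnorm, hdist]
    rw [mul_pow, mul_inv]
    -- This bounds the barrier from below by `2 s / ρ²` along the radius, which yields the linear
    -- rate.
    have : 1 + 2 * s ≤ ((1 - s) ^ 2)⁻¹ := by
      rw [le_inv_comm₀ (by linarith [hs.1]) (by positivity), inv_eq_one_div, le_div_iff₀ (by linarith [hs.1])]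
      nlinarith [hs.1, hs.2, mul_nonneg hs.1 hs.1, mul_nonneg hs.1 (sub_nonneg.2 hs.2)]
    have h3 : 0 < (ρ ^ 2)⁻¹ := by positivity
    rw [div_eq_mul_inv]
    nlinarith
  nlinarith

end Hopf

/-! ## Winding numbers of loops in the punctured plane -/

section Winding

/-- The total angle `∫ Im (c' / c)` swept out by a loop. -/
def sweptAngle (c : ℝ → ℂ) : ℝ := ∫ t in -Real.pi..Real.pi, (deriv c t / c t).im

/-- The imaginary part of `log (c₁ / c₂)` is a primitive of the difference of the two integrands,
and it takes equal values at the end points because both loops are closed. -/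
theorem sweptAngle_eq_of_div_mem_slitPlane {c₁ c₂ : ℝ → ℂ} (h₁ : ContDiff ℝ 1 c₁)
    (h₂ : ContDiff ℝ 1 c₂) (n₁ : ∀ t, c₁ t ≠ 0) (n₂ : ∀ t, c₂ t ≠ 0)
    (p₁ : c₁ (-Real.pi) = c₁ Real.pi) (p₂ : c₂ (-Real.pi) = c₂ Real.pi)
    (hs : ∀ t ∈ Icc (-Real.pi) Real.pi, c₁ t / c₂ t ∈ Complex.slitPlane) :
    sweptAngle c₁ = sweptAngle c₂ := by
  have hcont : ∀ {c : ℝ → ℂ}, ContDiff ℝ 1 c → (∀ t, c t ≠ 0) →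
      Continuous fun t => (deriv c t / c t).im := fun hc hn =>
    Complex.continuous_im.comp ((hc.continuous_deriv (by simp)).div hc.continuous hn)
  have hd : ∀ t ∈ uIcc (-Real.pi) Real.pi, HasDerivAt (fun t => (Complex.log (c₁ t / c₂ t)).im)
      ((deriv c₁ t / c₁ t).im - (deriv c₂ t / c₂ t).im) t := fun t ht => by
    rw [uIcc_of_le (by linarith [Real.pi_pos])] at ht
    have d₁ := (h₁.differentiable (by simp) t).hasDerivAt
    have d₂ := (h₂.differentiable (by simp) t).hasDerivAt
    have := ((d₁.fun_div d₂ (n₂ t)).clog_real (hs t ht))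
    have h := Complex.imCLM.hasFDerivAt.comp_hasDerivAt t this
    refine h.congr_deriv ?_
    rw [Complex.imCLM_apply, ← Complex.sub_im]
    congr 1
    have := n₁ t
    have := n₂ t
    field_simp
  have h := intervalIntegral.integral_eq_sub_of_hasDerivAt hd
    (((hcont h₁ n₁).sub (hcont h₂ n₂)).intervalIntegrable _ _)
  rw [intervalIntegral.integral_sub ((hcont h₁ n₁).intervalIntegrable _ _)
    ((hcont h₂ n₂).intervalIntegrable _ _), p₁, p₂, sub_self] at h
  exact sub_eq_zero.1 h

/-- As in Rouché's theorem, the quotient stays within distance less than `1` of `1`, hence in the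
slit plane. -/
theorem sweptAngle_eq_of_norm_sub_lt {c₁ c₂ : ℝ → ℂ} (h₁ : ContDiff ℝ 1 c₁)
    (h₂ : ContDiff ℝ 1 c₂) (n₁ : ∀ t, c₁ t ≠ 0) (n₂ : ∀ t, c₂ t ≠ 0)
    (p₁ : c₁ (-Real.pi) = c₁ Real.pi) (p₂ : c₂ (-Real.pi) = c₂ Real.pi)
    (hs : ∀ t ∈ Icc (-Real.pi) Real.pi, ‖c₁ t - c₂ t‖ < ‖c₂ t‖) :
    sweptAngle c₁ = sweptAngle c₂ := by
  refine sweptAngle_eq_of_div_mem_slitPlane h₁ h₂ n₁ n₂ p₁ p₂ fun t ht => ?_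
  have : c₁ t / c₂ t = 1 + (c₁ t - c₂ t) / c₂ t := by
    have := n₂ t
    field_simp
    ring
  rw [this]
  refine Complex.mem_slitPlane_of_norm_lt_one ?_
  rw [norm_div, div_lt_one (norm_pos_iff.2 (n₂ t))]
  exact hs t ht

theorem sweptAngle_const_mul_exp {a κ : ℂ} (ha : a ≠ 0) :
    sweptAngle (fun t : ℝ => a * Complex.exp (t * κ)) = 2 * Real.pi * κ.im := by
  have : ∀ t : ℝ, deriv (fun t : ℝ => a * Complex.exp (t * κ)) t / (a * Complex.exp (t * κ)) = κ :=
    fun t => by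
    have h1 : HasDerivAt (fun t : ℝ => (t : ℂ) * κ) κ t := by
      simpa using (Complex.ofRealCLM.hasDerivAt (x := t)).mul_const κ
    rw [((h1.cexp).const_mul a).deriv]
    have := Complex.exp_ne_zero (t * κ)
    field_simp
  simp only [sweptAngle, this, intervalIntegral.integral_const, smul_eq_mul]
  ring

theorem contDiff_const_mul_exp (a κ : ℂ) {n : ℕ∞ω} :
    ContDiff ℝ n fun t : ℝ => a * Complex.exp (t * κ) :=
  contDiff_const.mul ((Complex.ofRealCLM.contDiff.mul contDiff_const).cexp)

theorem exists_eq_add_conj (A : ℂ →L[ℝ] ℂ) :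
    ∃ a b : ℂ, ∀ z, A z = a * z + b * (starRingEnd ℂ) z := by
  refine ⟨(A 1 - Complex.I * A Complex.I) / 2, (A 1 + Complex.I * A Complex.I) / 2, fun z => ?_⟩
  have : A z = z.re * A 1 + z.im * A Complex.I := by
    conv_lhs => rw [show z = z.re • (1 : ℂ) + z.im • Complex.I by simp [Complex.re_add_im]]
    rw [map_add, map_smul, map_smul]
    simp
  rw [this]
  apply Complex.ext <;> simp <;> ring

/-- For `a ≠ 0` take a unit `z` with `z² = -b/a`. Thus a real linear map `a z + b z̄` can be
injective only if `|a| ≠ |b|`. -/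
theorem exists_mul_add_mul_conj_eq_zero {a b : ℂ} (h : ‖a‖ = ‖b‖) :
    ∃ z ≠ 0, a * z + b * (starRingEnd ℂ) z = 0 := by
  by_cases ha : a = 0
  · have hb : b = 0 := by rw [← norm_eq_zero, ← h, ha, norm_zero]
    exact ⟨1, one_ne_zero, by simp [ha, hb]⟩
  set w := -b / a with hw
  have hn : ‖w‖ = 1 := by
    rw [hw, norm_div, norm_neg, ← h, div_self (norm_ne_zero_iff.2 ha)]
  set z := Complex.exp ((w.arg / 2 : ℝ) * Complex.I) with hz
  have hz0 : z ≠ 0 := Complex.exp_ne_zero _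
  have hzz : z * z = w := by
    rw [hz, ← Complex.exp_add]
    conv_rhs => rw [← Complex.norm_mul_exp_arg_mul_I w, hn]
    push_cast
    rw [one_mul]
    congr 1
    ring
  have hzc : z * (starRingEnd ℂ) z = 1 := by
    rw [Complex.mul_conj, Complex.normSq_eq_norm_sq, hz, Complex.norm_exp_ofReal_mul_I]
    simp
  refine ⟨z, hz0, ?_⟩
  have h1 : a * w = -b := by rw [hw]; field_simp
  have : z * (a * z + b * (starRingEnd ℂ) z) = 0 := by
    calc z * (a * z + b * (starRingEnd ℂ) z) = a * (z * z) + b * (z * (starRingEnd ℂ) z) := by ring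
      _ = 0 := by rw [hzz, hzc, h1]; ring
  exact (mul_eq_zero.1 this).resolve_left hz0

/-- The image of the unit circle under a linear isomorphism of the plane winds once around the
origin. -/
theorem abs_sweptAngle_linear {A : ℂ →L[ℝ] ℂ} (hA : ∀ z, A z = 0 → z = 0) :
    |sweptAngle fun t : ℝ => A (Complex.exp (t * Complex.I))| = 2 * Real.pi := by
  obtain ⟨a, b, hab⟩ := exists_eq_add_conj A
  have hne : ‖a‖ ≠ ‖b‖ := fun h => by
    obtain ⟨z, hz, h0⟩ := exists_mul_add_mul_conj_eq_zero h
    exact hz (hA z (by rw [hab, h0]))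
  have hconj : ∀ t : ℝ, (starRingEnd ℂ) (Complex.exp (t * Complex.I)) =
      Complex.exp (t * -Complex.I) := fun t => by
    rw [← Complex.exp_conj]; simp
  have he : ∀ t : ℝ, ‖Complex.exp (t * Complex.I)‖ = 1 := fun t => Complex.norm_exp_ofReal_mul_I t
  have he' : ∀ t : ℝ, ‖Complex.exp (t * -Complex.I)‖ = 1 := fun t => by
    rw [← hconj, RCLike.norm_conj, he]
  have hsm : ContDiff ℝ 1 fun t : ℝ => A (Complex.exp (t * Complex.I)) := by
    have := contDiff_const_mul_exp 1 Complex.I (n := 1)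
    simp only [one_mul] at this
    exact A.contDiff.comp this
  have hn : ∀ t : ℝ, A (Complex.exp (t * Complex.I)) ≠ 0 := fun t h =>
    Complex.exp_ne_zero _ (hA _ h)
  have hper : Complex.exp ((-Real.pi : ℝ) * Complex.I) = Complex.exp ((Real.pi : ℝ) * Complex.I) := by
    push_cast
    rw [neg_mul, Complex.exp_neg, Complex.exp_pi_mul_I]; norm_num
  have hper' : Complex.exp ((-Real.pi : ℝ) * -Complex.I) = Complex.exp ((Real.pi : ℝ) * -Complex.I) := by
    rw [← hconj, ← hconj, hper]
  have hpi : 0 < 2 * Real.pi := by positivity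
  -- The larger of the two terms `a e^{it}` and `b e^{-it}` determines the winding, which is `1` or
  -- `-1` according to orientation.
  rcases hne.lt_or_gt with h | h
  · have hb : b ≠ 0 := fun hb => by simp [hb] at h; linarith [norm_nonneg a]
    rw [sweptAngle_eq_of_norm_sub_lt hsm (contDiff_const_mul_exp b (-Complex.I)) hn
      (fun t => mul_ne_zero hb (Complex.exp_ne_zero _)) (by simp only [hper]) (by simp only [hper'])
      (fun t _ => by rw [hab, hconj, add_sub_cancel_right, norm_mul, norm_mul, he, he']; linarith),
      sweptAngle_const_mul_exp hb]
    simp [abs_of_pos Real.pi_pos]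
  · have ha : a ≠ 0 := fun ha => by simp [ha] at h; linarith [norm_nonneg b]
    rw [sweptAngle_eq_of_norm_sub_lt hsm (contDiff_const_mul_exp a Complex.I) hn
      (fun t => mul_ne_zero ha (Complex.exp_ne_zero _)) (by simp only [hper]) (by simp only [hper])
      (fun t _ => by rw [hab, hconj, add_sub_cancel_left, norm_mul, norm_mul, he, he']; linarith),
      sweptAngle_const_mul_exp ha]
    simp [abs_of_pos Real.pi_pos]

end Winding

/-! ## Integrals over boxes and over the disk -/

section Integrals

theorem setIntegral_Icc_fin_one (a b : ℝ) (hab : a ≤ b) (f : (Fin 1 → ℝ) → ℝ) :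
    ∫ x in Icc (fun _ => a) (fun _ => b), f x = ∫ t in a..b, f fun _ => t := by
  rw [intervalIntegral.integral_of_le hab, ← integral_Icc_eq_integral_Ioc]
  have h := (volume_preserving_funUnique (Fin 1) ℝ).setIntegral_preimage_emb
    (MeasurableEquiv.measurableEmbedding _) (fun t => f fun _ => t) (Icc a b)
  rw [← h]
  have hs : (MeasurableEquiv.funUnique (Fin 1) ℝ) ⁻¹' Icc a b = Icc (fun _ => a) (fun _ => b) := by
    ext x
    simp [Pi.le_def, MeasurableEquiv.funUnique]
  rw [hs]
  refine setIntegral_congr_fun measurableSet_Icc fun x _ => ?_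
  congr 1
  ext i
  rw [Subsingleton.elim i 0]
  rfl

theorem setIntegral_Icc_fin_two (a b : Fin 2 → ℝ) (f : (Fin 2 → ℝ) → ℝ) :
    ∫ x in Icc a b, f x = ∫ p in Icc (a 0) (b 0) ×ˢ Icc (a 1) (b 1), f ![p.1, p.2] := by
  have h := (volume_preserving_finTwoArrow ℝ).setIntegral_preimage_emb
    (MeasurableEquiv.measurableEmbedding _) (fun p => f ![p.1, p.2])
    (Icc (a 0) (b 0) ×ˢ Icc (a 1) (b 1))
  rw [← h]
  have hs : (MeasurableEquiv.finTwoArrow) ⁻¹' (Icc (a 0) (b 0) ×ˢ Icc (a 1) (b 1)) = Icc a b := by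
    ext x
    simp [Pi.le_def, MeasurableEquiv.finTwoArrow, Fin.forall_fin_two]
  rw [hs]
  refine setIntegral_congr_fun measurableSet_Icc fun x _ => ?_
  congr 1
  ext i
  fin_cases i <;> rfl

/-- Polar coordinates on the unit disk, with radius `sin ρ`. -/
def polar (x : Fin 2 → ℝ) : ℂ := Real.sin (x 0) * Complex.exp (x 1 * Complex.I)

/-- Substitute `r = sin ρ` in the usual polar formula; the Jacobian becomes `sin ρ cos ρ`. With this
radius `polar` sends all of `ℝ²` into the closed disk, so maps defined only on the disk pull back to
globally smooth maps and derivatives no longer have to be restricted to a set. -/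
theorem setIntegral_disk_eq {F : ℂ → ℝ} (hF : ContinuousOn F (Metric.closedBall 0 1)) :
    ∫ z in Metric.closedBall (0 : ℂ) 1, F z =
      ∫ x in Icc ![0, -Real.pi] ![Real.pi / 2, Real.pi],
        Real.sin (x 0) * Real.cos (x 0) * F (polar x) := by
  have hpi := Real.pi_pos
  have hP : ∀ p : ℝ × ℝ, Complex.polarCoord.symm p = p.1 * Complex.exp (p.2 * Complex.I) := fun p => by
    rw [Complex.polarCoord_symm_apply, Complex.exp_mul_I, Complex.ofReal_cos, Complex.ofReal_sin]
  have hPc : Continuous fun p : ℝ × ℝ => (p.1 : ℂ) * Complex.exp (p.2 * Complex.I) := by fun_prop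
  have hPn : ∀ p : ℝ × ℝ, ‖(p.1 : ℂ) * Complex.exp (p.2 * Complex.I)‖ = |p.1| := fun p => by
    rw [norm_mul, Complex.norm_exp_ofReal_mul_I, mul_one, Complex.norm_real, Real.norm_eq_abs]
  set G : ℝ × ℝ → ℝ := fun p => p.1 * F (p.1 * Complex.exp (p.2 * Complex.I)) with hG
  have hGc : ContinuousOn G (Icc 0 1 ×ˢ Icc (-Real.pi) Real.pi) := by
    refine continuousOn_fst.mul (hF.comp hPc.continuousOn fun p hp => ?_)
    rw [mem_closedBall_zero_iff, hPn, abs_of_nonneg hp.1.1]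
    exact hp.1.2
  have hGi : IntegrableOn G (Ioc 0 1 ×ˢ Ioo (-Real.pi) Real.pi) :=
    (hGc.integrableOn_compact (isCompact_Icc.prod isCompact_Icc)).mono_set
      (prod_mono Ioc_subset_Icc_self Ioo_subset_Icc_self)
  have step1 : ∫ z in Metric.closedBall (0 : ℂ) 1, F z =
      ∫ p in Ioc (0 : ℝ) 1 ×ˢ Ioo (-Real.pi) Real.pi, G p := by
    rw [← integral_indicator measurableSet_closedBall, ← Complex.integral_comp_polarCoord_symm]
    have hT : MeasurableSet (polarCoord.target) := polarCoord.open_target.measurableSet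
    rw [← integral_indicator hT,
      ← integral_indicator (measurableSet_Ioc.prod measurableSet_Ioo)]
    congr 1
    ext p
    by_cases hp : p ∈ polarCoord.target
    · rw [indicator_of_mem hp, hP, smul_eq_mul]
      by_cases h1 : p.1 ≤ 1
      · rw [indicator_of_mem (by
          rw [mem_closedBall_zero_iff, hPn, abs_of_pos hp.1]; exact h1),
          indicator_of_mem (s := Ioc (0 : ℝ) 1 ×ˢ Ioo (-Real.pi) Real.pi) (by
            exact ⟨⟨hp.1, h1⟩, hp.2⟩)]
      · rw [indicator_of_notMem (by
          rw [mem_closedBall_zero_iff, hPn, abs_of_pos hp.1]; exact h1),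
          indicator_of_notMem fun h => h1 h.1.2, mul_zero]
    · rw [indicator_of_notMem hp, indicator_of_notMem fun h => hp ⟨h.1.1, h.2⟩]
  rw [step1, Measure.volume_eq_prod, setIntegral_prod _ (by rwa [← Measure.volume_eq_prod]),
    integral_Ioc_eq_integral_Ioo]
  have himg : Real.sin '' Ioo 0 (Real.pi / 2) = Ioo 0 1 := by
    ext r
    constructor
    · rintro ⟨x, hx, rfl⟩
      refine ⟨Real.sin_pos_of_pos_of_lt_pi hx.1 (by linarith [hx.2]), ?_⟩
      rw [← Real.sin_pi_div_two]
      exact Real.sin_lt_sin_of_lt_of_le_pi_div_two (by linarith [hx.1]) le_rfl hx.2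
    · intro hr
      exact ⟨Real.arcsin r, ⟨Real.arcsin_pos.2 hr.1, Real.arcsin_lt_pi_div_two.2 hr.2⟩,
        Real.sin_arcsin (by linarith [hr.1]) hr.2.le⟩
  rw [← himg, integral_image_eq_integral_abs_deriv_smul measurableSet_Ioo
    (fun x _ => (Real.hasDerivAt_sin x).hasDerivWithinAt)
    (Real.injOn_sin.mono (Ioo_subset_Icc_self.trans (Icc_subset_Icc (by linarith) le_rfl)))]
  rw [setIntegral_Icc_fin_two]
  set K : ℝ × ℝ → ℝ := fun p =>
    Real.sin p.1 * Real.cos p.1 * F (Real.sin p.1 * Complex.exp (p.2 * Complex.I)) with hK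
  have hKc : Continuous K := by
    refine Continuous.mul (by fun_prop) (hF.comp_continuous (by fun_prop) fun p => ?_)
    rw [mem_closedBall_zero_iff, hPn (Real.sin p.1, p.2)]
    exact Real.abs_sin_le_one _
  have hKi : IntegrableOn K (Icc 0 (Real.pi / 2) ×ˢ Icc (-Real.pi) Real.pi) :=
    hKc.continuousOn.integrableOn_compact (isCompact_Icc.prod isCompact_Icc)
  change _ = ∫ p in Icc 0 (Real.pi / 2) ×ˢ Icc (-Real.pi) Real.pi, K p
  rw [Measure.volume_eq_prod, setIntegral_prod _ (by rwa [← Measure.volume_eq_prod]),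
    integral_Icc_eq_integral_Ioo]
  refine setIntegral_congr_fun measurableSet_Ioo fun x hx => ?_
  simp only [integral_Icc_eq_integral_Ioo, smul_eq_mul, hG, hK]
  rw [abs_of_nonneg (Real.cos_nonneg_of_mem_Icc ⟨by linarith [hx.1], hx.2.le⟩),
    ← integral_const_mul]
  refine setIntegral_congr_fun measurableSet_Ioo fun t _ => ?_
  ring

end Integrals

/-! ## Stokes' theorem for homotopies of disks with boundary on a submanifold -/

section PullComp

variable {E : Type*} [NormedAddCommGroup E] [NormedSpace ℝ E]
  {H : Type*} [TopologicalSpace H] {I : ModelWithCorners ℝ E H}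
  {X : Type*} [TopologicalSpace X] [ChartedSpace H X]
  {V : Type*} [NormedAddCommGroup V] [NormedSpace ℝ V] {m : ℕ}
  {V' : Type*} [NormedAddCommGroup V'] [NormedSpace ℝ V']

theorem pullForm_comp (σ : ∀ x : X, TangentSpace I x [⋀^Fin m]→L[ℝ] ℝ) {f : V → X} {s : Set V}
    {A : V' → V} {t : Set V'} {x : V'} {L : V' →L[ℝ] V} (hx : UniqueDiffWithinAt ℝ t x)
    (hA : HasFDerivWithinAt A L t x) (hf : MDifferentiableWithinAt 𝓘(ℝ, V) I f s (A x))
    (hst : MapsTo A t s) (v : Fin m → V') :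
    pullForm I σ (f ∘ A) t x v = pullForm I σ f s (A x) (fun i => L (v i)) := by
  have hA' : HasMFDerivWithinAt 𝓘(ℝ, V') 𝓘(ℝ, V) A t x L := hA.hasMFDerivWithinAt
  have h := (hf.hasMFDerivWithinAt.comp x hA' hst).mfderivWithin hx.uniqueMDiffWithinAt
  unfold pullForm
  rw [h]
  rfl

/-- Insertion of a coordinate, as a linear map. -/
def insertCLM {n : ℕ} (i : Fin (n + 1)) : (Fin n → ℝ) →L[ℝ] (Fin (n + 1) → ℝ) :=
  LinearMap.toContinuousLinearMap
    { toFun := fun x => i.insertNth (α := fun _ => ℝ) 0 x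
      map_add' := fun x y => by
        have := Fin.insertNth_add i (α := fun _ => ℝ) 0 0 x y
        rw [add_zero] at this
        exact this
      map_smul' := fun c x => by
        ext j
        refine Fin.succAboveCases i ?_ (fun k => ?_) j <;> simp }

theorem insertNth_eq {n : ℕ} (i : Fin (n + 1)) (c : ℝ) (x : Fin n → ℝ) :
    i.insertNth (α := fun _ => ℝ) c x = insertCLM i x + Pi.single i c := by
  ext j
  refine Fin.succAboveCases i ?_ (fun k => ?_) j <;> simp [insertCLM]

theorem insertCLM_stdVec {n : ℕ} (i : Fin (n + 1)) (k : Fin n) :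
    insertCLM i (stdVec k) = stdVec (i.succAbove k) := by
  ext j
  refine Fin.succAboveCases i ?_ (fun l => ?_) j
  · simp [insertCLM, stdVec]
  · simp [insertCLM, stdVec, Pi.single_apply]

theorem hasFDerivAt_insertNth {n : ℕ} (i : Fin (n + 1)) (c : ℝ) (x : Fin n → ℝ) :
    HasFDerivAt (fun x => i.insertNth (α := fun _ => ℝ) c x) (insertCLM i) x := by
  simp only [insertNth_eq]
  exact (insertCLM i).hasFDerivAt.add_const _

theorem contMDiff_insertNth {n : ℕ} (i : Fin (n + 1)) (c : ℝ) :
    ContMDiff 𝓘(ℝ, Fin n → ℝ) 𝓘(ℝ, Fin (n + 1) → ℝ) ∞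
      (fun x : Fin n → ℝ => i.insertNth (α := fun _ => ℝ) c x) := by
  simp only [insertNth_eq]
  exact ((insertCLM i).contDiff.add contDiff_const).contMDiff

/-- The face is included by an affine map that sends standard vectors to standard vectors. This
turns each boundary term of the box formula into the pullback under the restricted map. -/
theorem pullForm_face {n : ℕ} (σ : ∀ x : X, TangentSpace I x [⋀^Fin m]→L[ℝ] ℝ)
    {U : (Fin (n + 1) → ℝ) → X} (hU : ContMDiff 𝓘(ℝ, Fin (n + 1) → ℝ) I ∞ U) (i : Fin (n + 1))
    (c : ℝ) (x : Fin n → ℝ) (l : Fin m → Fin n) :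
    pullForm I σ U univ (i.insertNth (α := fun _ => ℝ) c x) (fun k => stdVec (i.succAbove (l k))) =
      pullForm I σ (fun x => U (i.insertNth (α := fun _ => ℝ) c x)) univ x
        (fun k => stdVec (l k)) := by
  refine ((pullForm_comp σ (f := U) uniqueDiffWithinAt_univ
    (hasFDerivAt_insertNth i c x).hasFDerivWithinAt
    (hU.mdifferentiable (by simp) _).mdifferentiableWithinAt (mapsTo_univ _ _) _).trans ?_).symm
  simp only [insertCLM_stdVec]

theorem extDeriv_pullForm [IsManifold I ∞ X] {σ : ∀ x : X, TangentSpace I x [⋀^Fin m]→L[ℝ] ℝ}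
    (hσ : IsSmoothForm I σ) {f : V → X} (hf : ContMDiff 𝓘(ℝ, V) I ∞ f) (p : V) :
    extDeriv (pullForm I σ f univ) p = pullForm I (dForm I σ) f univ p := by
  rw [← extDerivWithin_univ]
  refine extDerivWithin_pullForm hf.contMDiffOn uniqueDiffOn_univ (mem_univ _) ?_ (by simp)
  have := hσ (f p) _ (mem_extChartAt_target (I := I) (f p))
  have h2 := this.differentiableWithinAt (by simp)
  exact h2.mono_of_mem_nhdsWithin (extChartAt_target_mem_nhdsWithin (I := I) (f p))

theorem differentiable_pullForm [IsManifold I ∞ X] {σ : ∀ x : X, TangentSpace I x [⋀^Fin m]→L[ℝ] ℝ}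
    (hσ : IsSmoothForm I σ) {f : V → X} (hf : ContMDiff 𝓘(ℝ, V) I ∞ f) :
    Differentiable ℝ (pullForm I σ f univ) := by
  intro p
  rw [← differentiableWithinAt_univ]
  have hF := contDiffWithinAt_extChartAt_comp hf.contMDiffOn (mem_univ p)
  have hev := pullForm_eventuallyEq σ hf.contMDiffOn uniqueDiffOn_univ (mem_univ p)
  refine DifferentiableWithinAt.congr_of_eventuallyEq ?_ hev (hev.self_of_nhdsWithin (mem_univ p))
  have h1 : DifferentiableWithinAt ℝ
      (fun y => formInChart I σ (f p) (extChartAt I (f p) (f y))) univ p := by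
    have := (hσ (f p) _ (mem_extChartAt_target (I := I) (f p))).comp_of_preimage_mem_nhdsWithin p hF
      (mapsTo_extChartAt_comp hf.contMDiffOn (mem_univ p))
    exact this.differentiableWithinAt (by simp)
  have hFd : DifferentiableWithinAt ℝ
      (fderivWithin ℝ (fun z => extChartAt I (f p) (f z)) univ) univ p :=
    (hF.fderivWithin_right (m := ∞) uniqueDiffOn_univ (by simp) (mem_univ p)).differentiableWithinAt
      (by simp)
  exact (h1.hasFDerivWithinAt.continuousAlternatingMapCompContinuousLinearMap
    hFd.hasFDerivWithinAt).differentiableWithinAt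

theorem continuous_pullForm [IsManifold I ∞ X] {σ : ∀ x : X, TangentSpace I x [⋀^Fin m]→L[ℝ] ℝ}
    (hσ : IsSmoothForm I σ) {f : V → X} (hf : ContMDiff 𝓘(ℝ, V) I ∞ f) (v : Fin m → V) :
    Continuous fun p => pullForm I σ f univ p v :=
  continuousOn_univ.1 (contDiffOn_pullForm hσ hf.contMDiffOn uniqueDiffOn_univ v).continuousOn

end PullComp

section Cylinder

variable {EW : Type*} [NormedAddCommGroup EW] [NormedSpace ℝ EW]
  {HW : Type*} [TopologicalSpace HW] {IW : ModelWithCorners ℝ EW HW}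
  {W : Type*} [TopologicalSpace W] [ChartedSpace HW W]
  {EM : Type*} [NormedAddCommGroup EM] [NormedSpace ℝ EM]
  {HM : Type*} [TopologicalSpace HM] {IM : ModelWithCorners ℝ EM HM}
  {M : Type*} [TopologicalSpace M] [ChartedSpace HM M]
  {EN : Type*} [NormedAddCommGroup EN] [NormedSpace ℝ EN]
  {HN : Type*} [TopologicalSpace HN] {IN : ModelWithCorners ℝ EN HN}
  {N : Type*} [TopologicalSpace N] [ChartedSpace HN N]

/-- The integral of the pullback of a `2`-form over the rectangle `[0, π / 2] × [-π, π]`. -/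
def rectIntegral (Ω : ∀ x : W, TangentSpace IW x [⋀^Fin 2]→L[ℝ] ℝ) (U : (Fin 2 → ℝ) → W) : ℝ :=
  ∫ x in Icc ![0, -Real.pi] ![Real.pi / 2, Real.pi], pullForm IW Ω U univ x stdVec

/-- The integral of a `1`-form along a path parametrized by `[-π, π]`. -/
def pathIntegral (β : ∀ x : M, TangentSpace IM x [⋀^Fin 1]→L[ℝ] ℝ) (γ : (Fin 1 → ℝ) → M) : ℝ :=
  ∫ x in Icc (fun _ => -Real.pi) (fun _ => Real.pi), pullForm IM β γ univ x stdVec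

theorem pullForm_restrict {Ω : ∀ x : W, TangentSpace IW x [⋀^Fin 2]→L[ℝ] ℝ}
    {β : ∀ x : M, TangentSpace IM x [⋀^Fin 1]→L[ℝ] ℝ} {ι : M → W} {j : N → M}
    (hι : ContMDiff IM IW ∞ ι) (hj : ContMDiff IN IM ∞ j)
    (hΩβ : ∀ (x : N) (v w : TangentSpace IN x),
      Ω (ι (j x)) ![mfderiv IN IW (ι ∘ j) x v, mfderiv IN IW (ι ∘ j) x w] =
        dForm IM β (j x) ![mfderiv IN IM j x v, mfderiv IN IM j x w])
    {K : (Fin 2 → ℝ) → N} (hK : ContMDiff 𝓘(ℝ, Fin 2 → ℝ) IN ∞ K) (x : Fin 2 → ℝ) :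
    pullForm IW Ω (fun y => ι (j (K y))) univ x stdVec =
      pullForm IM (dForm IM β) (fun y => j (K y)) univ x stdVec := by
  have hKd := hK.mdifferentiable (by simp) x
  have hjd := hj.mdifferentiable (by simp) (K x)
  have hed := (hι.comp hj).mdifferentiable (by simp) (K x)
  have h1 : mfderiv 𝓘(ℝ, Fin 2 → ℝ) IW (fun y => ι (j (K y))) x =
      (mfderiv IN IW (ι ∘ j) (K x)).comp (mfderiv 𝓘(ℝ, Fin 2 → ℝ) IN K x) := mfderiv_comp x hed hKd
  have h2 : mfderiv 𝓘(ℝ, Fin 2 → ℝ) IM (fun y => j (K y)) x =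
      (mfderiv IN IM j (K x)).comp (mfderiv 𝓘(ℝ, Fin 2 → ℝ) IN K x) := mfderiv_comp x hjd hKd
  have h := hΩβ (K x) (mfderiv 𝓘(ℝ, Fin 2 → ℝ) IN K x (stdVec 0))
    (mfderiv 𝓘(ℝ, Fin 2 → ℝ) IN K x (stdVec 1))
  unfold pullForm
  rw [mfderivWithin_univ, mfderivWithin_univ, h1, h2]
  refine Eq.trans ?_ (h.trans ?_)
  · refine congrArg (Ω (ι (j (K x)))) ?_
    ext i
    fin_cases i <;> rfl
  · refine congrArg (dForm IM β (j (K x))) ?_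
    ext i
    fin_cases i <;> rfl

variable [IsManifold IW ∞ W] [IsManifold IM ∞ M]

/-- The coordinates of `U` are the homotopy parameter, the polar radius and the angle. Since `Ω` is
closed, its integrals over the six faces of the box sum to zero. The two angular faces cancel, the
face at the center is degenerate, and the two parameter faces are the disks. The remaining face lies
in `N`, where `Ω = dβ`, and a second application of Stokes turns its integral into the difference of
the boundary integrals. -/
theorem stokes_cylinder {Ω : ∀ x : W, TangentSpace IW x [⋀^Fin 2]→L[ℝ] ℝ}
    {β : ∀ x : M, TangentSpace IM x [⋀^Fin 1]→L[ℝ] ℝ} {ι : M → W} {j : N → M}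
    (hΩ : IsSmoothForm IW Ω) (hcl : ∀ x, dForm IW Ω x = 0) (hβ : IsSmoothForm IM β)
    (hι : ContMDiff IM IW ∞ ι) (hj : ContMDiff IN IM ∞ j)
    (hΩβ : ∀ (x : N) (v w : TangentSpace IN x),
      Ω (ι (j x)) ![mfderiv IN IW (ι ∘ j) x v, mfderiv IN IW (ι ∘ j) x w] =
        dForm IM β (j x) ![mfderiv IN IM j x v, mfderiv IN IM j x w])
    {U : (Fin 3 → ℝ) → W} (hU : ContMDiff 𝓘(ℝ, Fin 3 → ℝ) IW ∞ U)
    {K : (Fin 2 → ℝ) → N} (hK : ContMDiff 𝓘(ℝ, Fin 2 → ℝ) IN ∞ K)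
    (hUK : ∀ x, ι (j (K x)) = U (Fin.insertNth (α := fun _ => ℝ) 1 (Real.pi / 2) x))
    (hcenter : ∀ x y : Fin 2 → ℝ, x 0 = y 0 →
      U (Fin.insertNth (α := fun _ => ℝ) 1 0 x) = U (Fin.insertNth (α := fun _ => ℝ) 1 0 y))
    (hper : ∀ x, U (Fin.insertNth (α := fun _ => ℝ) 2 (-Real.pi) x) =
      U (Fin.insertNth (α := fun _ => ℝ) 2 Real.pi x))
    (hKper : ∀ x, K (Fin.insertNth (α := fun _ => ℝ) 1 (-Real.pi) x) =
      K (Fin.insertNth (α := fun _ => ℝ) 1 Real.pi x)) :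
    rectIntegral Ω (fun x => U (Fin.insertNth (α := fun _ => ℝ) 0 1 x)) -
        pathIntegral β (fun x => j (K (Fin.insertNth (α := fun _ => ℝ) 0 1 x))) =
      rectIntegral Ω (fun x => U (Fin.insertNth (α := fun _ => ℝ) 0 0 x)) -
        pathIntegral β (fun x => j (K (Fin.insertNth (α := fun _ => ℝ) 0 0 x))) := by
  have hpi := Real.pi_pos
  have hjK : ContMDiff 𝓘(ℝ, Fin 2 → ℝ) IM ∞ fun x => j (K x) := hj.comp hK
  -- the closed form on the three dimensional box
  have h3 := integral_extDeriv_box ![0, 0, -Real.pi] ![1, Real.pi / 2, Real.pi]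
    (by intro i; fin_cases i <;> simp <;> linarith) (pullForm IW Ω U univ)
    (differentiable_pullForm hΩ hU)
    (by
      simp only [extDeriv_pullForm hΩ hU, pullForm, hcl]
      exact continuous_const)
  have hz : ∀ x, extDeriv (pullForm IW Ω U univ) x stdVec = 0 := fun x => by
    rw [extDeriv_pullForm hΩ hU, pullForm, hcl]; rfl
  simp only [hz, integral_zero] at h3
  replace h3 := h3.trans (Fin.sum_univ_three _)
  have face3 : ∀ (i : Fin 3) (c : ℝ) (x : Fin 2 → ℝ),
      pullForm IW Ω U univ (i.insertNth (α := fun _ => ℝ) c x) (stdVec ∘ i.succAbove) =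
        pullForm IW Ω (fun x => U (i.insertNth (α := fun _ => ℝ) c x)) univ x stdVec :=
    fun i c x => pullForm_face Ω hU i c x id
  simp only [face3] at h3
  -- the primitive on the boundary
  have h2 := integral_extDeriv_box ![0, -Real.pi] ![1, Real.pi]
    (by intro i; fin_cases i <;> simp; linarith) (pullForm IM β (fun x => j (K x)) univ)
    (differentiable_pullForm hβ hjK)
    (by
      simp only [extDeriv_pullForm hβ hjK, ← pullForm_restrict hι hj hΩβ hK]
      exact continuous_pullForm hΩ (hι.comp hjK) _)
  simp only [extDeriv_pullForm hβ hjK, ← pullForm_restrict hι hj hΩβ hK] at h2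
  replace h2 := h2.trans (Fin.sum_univ_two _)
  have face2 : ∀ (i : Fin 2) (c : ℝ) (x : Fin 1 → ℝ),
      pullForm IM β (fun x => j (K x)) univ (i.insertNth (α := fun _ => ℝ) c x)
        (stdVec ∘ i.succAbove) =
        pullForm IM β (fun x => j (K (i.insertNth (α := fun _ => ℝ) c x))) univ x stdVec :=
    fun i c x => pullForm_face β hjK i c x id
  simp only [face2] at h2
  -- At the center of the disk the map depends only on the homotopy parameter. It therefore factors
  -- through a projection that kills the second basis vector, and the `2`-form vanishes on it.
  have hc0 : ∀ x, pullForm IW Ω (fun x => U (Fin.insertNth (α := fun _ => ℝ) 1 0 x)) univ x stdVec = 0 := by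
    intro x
    set A : (Fin 2 → ℝ) →L[ℝ] (Fin 2 → ℝ) :=
      ContinuousLinearMap.pi ![ContinuousLinearMap.proj 0, 0] with hA
    have hf : ContMDiff 𝓘(ℝ, Fin 2 → ℝ) IW ∞
        fun x => U (Fin.insertNth (α := fun _ => ℝ) 1 0 x) := hU.comp (contMDiff_insertNth 1 0)
    have heq : (fun x => U (Fin.insertNth (α := fun _ => ℝ) 1 0 x)) =
        (fun x => U (Fin.insertNth (α := fun _ => ℝ) 1 0 x)) ∘ A := by
      ext x
      exact hcenter _ _ (by simp [hA])
    rw [heq, pullForm_comp Ω uniqueDiffWithinAt_univ A.hasFDerivAt.hasFDerivWithinAt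
      (hf.mdifferentiable (by simp) _).mdifferentiableWithinAt (mapsTo_univ _ _)]
    refine ContinuousAlternatingMap.map_coord_zero _ (1 : Fin 2) ?_
    ext i
    fin_cases i <;> simp [hA, stdVec]
  simp only [rectIntegral, pathIntegral]
  have e0 : (![0, 0, -Real.pi] : Fin 3 → ℝ) ∘ Fin.succAbove 0 = ![0, -Real.pi] := by
    ext i; fin_cases i <;> rfl
  have e0' : (![1, Real.pi / 2, Real.pi] : Fin 3 → ℝ) ∘ Fin.succAbove 0 = ![Real.pi / 2, Real.pi] := by
    ext i; fin_cases i <;> rfl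
  have e1 : (![0, 0, -Real.pi] : Fin 3 → ℝ) ∘ Fin.succAbove 1 = ![0, -Real.pi] := by
    ext i; fin_cases i <;> rfl
  have e1' : (![1, Real.pi / 2, Real.pi] : Fin 3 → ℝ) ∘ Fin.succAbove 1 = ![1, Real.pi] := by
    ext i; fin_cases i <;> rfl
  have e2 : (![0, -Real.pi] : Fin 2 → ℝ) ∘ Fin.succAbove 0 = fun _ => -Real.pi := by
    ext i; fin_cases i; rfl
  have e2' : (![1, Real.pi] : Fin 2 → ℝ) ∘ Fin.succAbove 0 = fun _ => Real.pi := by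
    ext i; fin_cases i; rfl
  have q0 : (![0, 0, -Real.pi] : Fin 3 → ℝ) 0 = 0 := rfl
  have q0' : (![1, Real.pi / 2, Real.pi] : Fin 3 → ℝ) 0 = 1 := rfl
  have q1 : (![0, 0, -Real.pi] : Fin 3 → ℝ) 1 = 0 := rfl
  have q1' : (![1, Real.pi / 2, Real.pi] : Fin 3 → ℝ) 1 = Real.pi / 2 := rfl
  have q2 : (![0, 0, -Real.pi] : Fin 3 → ℝ) 2 = -Real.pi := rfl
  have q2' : (![1, Real.pi / 2, Real.pi] : Fin 3 → ℝ) 2 = Real.pi := rfl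
  have r0 : (![0, -Real.pi] : Fin 2 → ℝ) 0 = 0 := rfl
  have r0' : (![1, Real.pi] : Fin 2 → ℝ) 0 = 1 := rfl
  have r1 : (![0, -Real.pi] : Fin 2 → ℝ) 1 = -Real.pi := rfl
  have r1' : (![1, Real.pi] : Fin 2 → ℝ) 1 = Real.pi := rfl
  have t0 : ((0 : Fin 3) : ℕ) = 0 := rfl
  have t1 : ((1 : Fin 3) : ℕ) = 1 := rfl
  have t2 : ((2 : Fin 3) : ℕ) = 2 := rfl
  have s0 : ((0 : Fin 2) : ℕ) = 0 := rfl
  have s1 : ((1 : Fin 2) : ℕ) = 1 := rfl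
  rw [e0, e0', e1, e1', q0, q0', q1, q1', q2, q2', t0, t1, t2] at h3
  rw [e2, e2', r0, r0', r1, r1', s0, s1] at h2
  simp only [hc0, hper, ← hUK, pow_zero, pow_one, one_mul, neg_one_mul, sub_self, add_zero,
    integral_neg, neg_zero, sub_zero, integral_zero] at h3
  simp only [hKper, pow_zero, pow_one, one_mul, sub_self, add_zero] at h2
  linarith

end Cylinder

/-! ## Disks with boundary on a submanifold and their homotopies -/

section Lifts

variable {EM : Type*} [NormedAddCommGroup EM] [NormedSpace ℝ EM]
  {HM : Type*} [TopologicalSpace HM] {IM : ModelWithCorners ℝ EM HM}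
  {M : Type*} [TopologicalSpace M] [ChartedSpace HM M]
  {EN : Type*} [NormedAddCommGroup EN] [NormedSpace ℝ EN]
  {HN : Type*} [TopologicalSpace HN] {IN : ModelWithCorners ℝ EN HN}
  {N : Type*} [TopologicalSpace N] [ChartedSpace HN N]
  {V : Type*} [NormedAddCommGroup V] [NormedSpace ℝ V]

/-- Continuity descends because `j` is a topological embedding, and smoothness then descends because
`j` is an immersion. -/
theorem contMDiffAt_of_comp_embedding {j : N → M} (hj : IsSmoothEmbedding IN IM ∞ j) {g : V → N}
    {x : V} (h : ContMDiffAt 𝓘(ℝ, V) IM ∞ (fun y => j (g y)) x) : ContMDiffAt 𝓘(ℝ, V) IN ∞ g x :=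
  (ContMDiffAt.iff_comp_isImmersionAt (hj.isImmersion.isImmersionAt _)).2
    ⟨hj.isEmbedding.isInducing.continuousAt_iff.2 h.continuousAt, h⟩

end Lifts

section Disks

variable {EW : Type*} [NormedAddCommGroup EW] [NormedSpace ℝ EW]
  {HW : Type*} [TopologicalSpace HW] {IW : ModelWithCorners ℝ EW HW}
  {W : Type*} [TopologicalSpace W] [ChartedSpace HW W]
  {EM : Type*} [NormedAddCommGroup EM] [NormedSpace ℝ EM]
  {HM : Type*} [TopologicalSpace HM] {IM : ModelWithCorners ℝ EM HM}
  {M : Type*} [TopologicalSpace M] [ChartedSpace HM M]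
  {EN : Type*} [NormedAddCommGroup EN] [NormedSpace ℝ EN]
  {HN : Type*} [TopologicalSpace HN] {IN : ModelWithCorners ℝ EN HN}
  {N : Type*} [TopologicalSpace N] [ChartedSpace HN N] [Nonempty N]

/-- The point `exp (i t)` of the unit circle. -/
def circlePt (t : ℝ) : ℂ := Complex.exp (t * Complex.I)

theorem norm_circlePt (t : ℝ) : ‖circlePt t‖ = 1 := Complex.norm_exp_ofReal_mul_I t

theorem circlePt_mem (t : ℝ) : circlePt t ∈ Metric.closedBall (0 : ℂ) 1 := by
  rw [mem_closedBall_zero_iff, norm_circlePt]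

theorem circlePt_neg_pi : circlePt (-Real.pi) = circlePt Real.pi := by
  simp only [circlePt]
  push_cast
  rw [neg_mul, Complex.exp_neg, Complex.exp_pi_mul_I]; norm_num

theorem contDiff_circlePt {n : ℕ∞ω} : ContDiff ℝ n circlePt := by
  have := contDiff_const_mul_exp 1 Complex.I (n := n)
  simp only [one_mul] at this
  exact this

theorem polar_mem (x : Fin 2 → ℝ) : polar x ∈ Metric.closedBall (0 : ℂ) 1 := by
  rw [mem_closedBall_zero_iff, polar, norm_mul, Complex.norm_exp_ofReal_mul_I, mul_one,
    Complex.norm_real]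
  exact Real.abs_sin_le_one _

theorem contDiff_polar {n : ℕ∞ω} : ContDiff ℝ n polar := by
  have h1 : ContDiff ℝ n fun x : Fin 2 → ℝ => (Real.sin (x 0) : ℂ) :=
    Complex.ofRealCLM.contDiff.comp (Real.contDiff_sin.comp (contDiff_apply ℝ ℝ 0))
  exact h1.mul (contDiff_circlePt.comp (contDiff_apply ℝ ℝ 1))

variable (IW) in
/-- A smooth map from the closed unit disk with boundary on the image of `e`. -/
structure IsDiskMap (e : N → W) (a : ℂ → W) : Prop where
  smooth : ContMDiffOn 𝓘(ℝ, ℂ) IW ∞ a (Metric.closedBall 0 1)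
  boundary : ∀ z, ‖z‖ = 1 → a z ∈ range e

/-- The boundary loop of a disk, as a loop in `N`. -/
def boundaryLoop (e : N → W) (a : ℂ → W) (t : ℝ) : N := Function.invFun e (a (circlePt t))

omit [TopologicalSpace W] [TopologicalSpace N] in
theorem apply_boundaryLoop {e : N → W} {a : ℂ → W} (ha : ∀ z, ‖z‖ = 1 → a z ∈ range e) (t : ℝ) :
    e (boundaryLoop e a t) = a (circlePt t) :=
  Function.invFun_eq (ha _ (norm_circlePt t))

omit [TopologicalSpace W] [TopologicalSpace N] in
theorem boundaryLoop_neg_pi (e : N → W) (a : ℂ → W) :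
    boundaryLoop e a (-Real.pi) = boundaryLoop e a Real.pi := by
  rw [boundaryLoop, boundaryLoop, circlePt_neg_pi]

omit [TopologicalSpace N] [Nonempty N] in
theorem IsDiskMap.contMDiff_circle {e : N → W} {a : ℂ → W} (ha : IsDiskMap IW e a) :
    ContMDiff 𝓘(ℝ, ℝ) IW ∞ fun t => a (circlePt t) :=
  ha.smooth.comp_contMDiff contDiff_circlePt.contMDiff circlePt_mem

theorem IsDiskMap.contMDiff_boundaryLoop {ι : M → W} {j : N → M}
    (hι : IsSmoothEmbedding IM IW ∞ ι) (hj : IsSmoothEmbedding IN IM ∞ j) {a : ℂ → W}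
    (ha : IsDiskMap IW (ι ∘ j) a) : ContMDiff 𝓘(ℝ, ℝ) IN ∞ (boundaryLoop (ι ∘ j) a) := fun t => by
  refine contMDiffAt_of_comp_embedding hj (contMDiffAt_of_comp_embedding hι ?_)
  have := ha.contMDiff_circle t
  refine this.congr_of_eventuallyEq (.of_forall fun t => apply_boundaryLoop ha.boundary t)

/-- The difference between the integral of a `2`-form over a disk and the integral of a `1`-form
over its boundary. -/
def excess (Ω : ∀ x : W, TangentSpace IW x [⋀^Fin 2]→L[ℝ] ℝ)
    (β : ∀ x : M, TangentSpace IM x [⋀^Fin 1]→L[ℝ] ℝ) (ι : M → W) (j : N → M) (a : ℂ → W) : ℝ :=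
  rectIntegral Ω (fun x => a (polar x)) -
    pathIntegral β (fun x => j (boundaryLoop (ι ∘ j) a (x 0)))

variable [IsManifold IW ∞ W] [IsManifold IM ∞ M]

/-- The excess is invariant under homotopies of disks. -/
theorem excess_eq_of_homotopy {Ω : ∀ x : W, TangentSpace IW x [⋀^Fin 2]→L[ℝ] ℝ}
    {β : ∀ x : M, TangentSpace IM x [⋀^Fin 1]→L[ℝ] ℝ} {ι : M → W} {j : N → M}
    (hΩ : IsSmoothForm IW Ω) (hcl : ∀ x, dForm IW Ω x = 0) (hβ : IsSmoothForm IM β)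
    (hι : IsSmoothEmbedding IM IW ∞ ι) (hj : IsSmoothEmbedding IN IM ∞ j)
    (hΩβ : ∀ (x : N) (v w : TangentSpace IN x),
      Ω (ι (j x)) ![mfderiv IN IW (ι ∘ j) x v, mfderiv IN IW (ι ∘ j) x w] =
        dForm IM β (j x) ![mfderiv IN IM j x v, mfderiv IN IM j x w])
    {h : ℝ × ℂ → W} (hh : ContMDiffOn 𝓘(ℝ, ℝ × ℂ) IW ∞ h (univ ×ˢ Metric.closedBall 0 1))
    (hb : ∀ τ z, ‖z‖ = 1 → h (τ, z) ∈ range (ι ∘ j)) :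
    excess Ω β ι j (fun z => h (1, z)) = excess Ω β ι j (fun z => h (0, z)) := by
  -- Since `polar` takes values in the closed disk, this is smooth on all of `ℝ³`, although `h` is
  -- controlled only on the solid cylinder.
  have hU : ContMDiff 𝓘(ℝ, Fin 3 → ℝ) IW ∞ fun x : Fin 3 → ℝ => h (x 0, polar ![x 1, x 2]) := by
    refine hh.comp_contMDiff (f := fun x : Fin 3 → ℝ => (x 0, polar ![x 1, x 2]))
      (ContDiff.contMDiff ?_) fun x => ⟨mem_univ _, polar_mem _⟩
    refine (contDiff_apply ℝ ℝ 0).prodMk (contDiff_polar.comp (contDiff_pi.2 fun i => ?_))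
    fin_cases i
    exacts [contDiff_apply ℝ ℝ 1, contDiff_apply ℝ ℝ 2]
  have hE : ContMDiff 𝓘(ℝ, Fin 2 → ℝ) IW ∞ fun x : Fin 2 → ℝ => h (x 0, circlePt (x 1)) := by
    refine hh.comp_contMDiff (f := fun x : Fin 2 → ℝ => (x 0, circlePt (x 1)))
      (ContDiff.contMDiff ?_) fun x => ⟨mem_univ _, circlePt_mem _⟩
    exact (contDiff_apply ℝ ℝ 0).prodMk (contDiff_circlePt.comp (contDiff_apply ℝ ℝ 1))
  set K : (Fin 2 → ℝ) → N := fun x => boundaryLoop (ι ∘ j) (fun z => h (x 0, z)) (x 1) with hKdef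
  have hKe : ∀ x, ι (j (K x)) = h (x 0, circlePt (x 1)) := fun x =>
    apply_boundaryLoop (hb (x 0)) (x 1)
  have hK : ContMDiff 𝓘(ℝ, Fin 2 → ℝ) IN ∞ K := fun x =>
    contMDiffAt_of_comp_embedding hj (contMDiffAt_of_comp_embedding hι
      ((hE x).congr_of_eventuallyEq (.of_forall hKe)))
  have hp : ∀ a b : ℝ, polar ![a, b] = Real.sin a * circlePt b := fun a b => rfl
  have := stokes_cylinder hΩ hcl hβ hι.contMDiff hj.contMDiff hΩβ hU hK (fun x => by
      rw [hKe]
      change _ = h (x 0, polar ![Real.pi / 2, x 1])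
      rw [hp, Real.sin_pi_div_two, Complex.ofReal_one, one_mul])
    (fun x y hxy => by
      change h (x 0, polar ![0, x 1]) = h (y 0, polar ![0, y 1])
      rw [hp, hp, hxy, Real.sin_zero, Complex.ofReal_zero, zero_mul, zero_mul])
    (fun x => by
      change h (x 0, polar ![x 1, -Real.pi]) = h (x 0, polar ![x 1, Real.pi])
      rw [hp, hp, circlePt_neg_pi])
    (fun x => boundaryLoop_neg_pi _ _)
  have hx : ∀ x : Fin 2 → ℝ, ![x 0, x 1] = x := fun x => by
    ext i; fin_cases i <;> rfl
  simp only [excess]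
  refine Eq.trans ?_ (this.trans ?_)
  · change _ = rectIntegral Ω (fun x : Fin 2 → ℝ => h (1, polar ![x 0, x 1])) - _
    simp only [hx]
    rfl
  · change rectIntegral Ω (fun x : Fin 2 → ℝ => h (0, polar ![x 0, x 1])) - _ = _
    simp only [hx]
    rfl

end Disks

/-! ## Local convex structure of a manifold with boundary and a submanifold of its boundary -/

section Interpolation

variable {EW : Type*} [NormedAddCommGroup EW] [NormedSpace ℝ EW]
  {HW : Type*} [TopologicalSpace HW] {IW : ModelWithCorners ℝ EW HW}
  {W : Type*} [TopologicalSpace W] [ChartedSpace HW W]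
  {EM : Type*} [NormedAddCommGroup EM] [NormedSpace ℝ EM]
  {HM : Type*} [TopologicalSpace HM] {IM : ModelWithCorners ℝ EM HM}
  {M : Type*} [TopologicalSpace M] [ChartedSpace HM M]
  {EN : Type*} [NormedAddCommGroup EN] [NormedSpace ℝ EN]
  {HN : Type*} [TopologicalSpace HN] {IN : ModelWithCorners ℝ EN HN}
  {N : Type*} [TopologicalSpace N] [ChartedSpace HN N]

variable (IW) in
/-- A smooth family of paths joining any two points of an open set `O`, that stay in `S` if the end
points are in `S`. -/
structure IsInterpolation (S O : Set W) (m : ℝ × W × W → W) : Prop where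
  isOpen : IsOpen O
  smooth : ContMDiffOn (𝓘(ℝ, ℝ).prod (IW.prod IW)) IW ∞ m (Icc 0 1 ×ˢ O ×ˢ O)
  zero : ∀ p ∈ O, ∀ q ∈ O, m (0, p, q) = p
  one : ∀ p ∈ O, ∀ q ∈ O, m (1, p, q) = q
  diag : ∀ s ∈ Icc (0 : ℝ) 1, ∀ p ∈ O, m (s, p, p) = p
  mem : ∀ s ∈ Icc (0 : ℝ) 1, ∀ p ∈ O, ∀ q ∈ O, p ∈ S → q ∈ S → m (s, p, q) ∈ S

/-- Interpolate along straight segments in the coordinates `Θ`. The segments remain in the domain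
`C` of the inverse and in the set `D` that represents `S`, because both are convex. -/
theorem isInterpolation_of_convex {V : Type*} [NormedAddCommGroup V] [NormedSpace ℝ V]
    {S O : Set W} {C D : Set V} {Θ : W → V} {Ψ : V → W} (hO : IsOpen O)
    (hΘ : ContMDiffOn IW 𝓘(ℝ, V) ∞ Θ O) (hΨ : ContMDiffOn 𝓘(ℝ, V) IW ∞ Ψ C) (hC : Convex ℝ C)
    (hD : Convex ℝ D) (hΘC : MapsTo Θ O C) (hinv : ∀ p ∈ O, Ψ (Θ p) = p)
    (hΘS : ∀ p ∈ O, p ∈ S → Θ p ∈ D) (hΨS : ∀ v ∈ C, v ∈ D → Ψ v ∈ S) :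
    IsInterpolation IW S O fun x => Ψ ((1 - x.1) • Θ x.2.1 + x.1 • Θ x.2.2) := by
  have hmem : ∀ {A : Set V}, Convex ℝ A → ∀ {s : ℝ}, s ∈ Icc (0 : ℝ) 1 → ∀ {a b : V}, a ∈ A → b ∈ A →
      (1 - s) • a + s • b ∈ A := fun hA s hs a b ha hb =>
    hA ha hb (by linarith [hs.2]) hs.1 (by ring)
  refine ⟨hO, ?_, fun p hp q hq => ?_, fun p hp q hq => ?_, fun s hs p hp => ?_,
    fun s hs p hp q hq hpS hqS => ?_⟩
  · have h1 : ContMDiffOn (𝓘(ℝ, ℝ).prod (IW.prod IW)) 𝓘(ℝ, V) ∞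
        (fun x : ℝ × W × W => Θ x.2.1) (Icc 0 1 ×ˢ O ×ˢ O) :=
      hΘ.comp (contMDiff_fst.comp contMDiff_snd).contMDiffOn fun x hx => hx.2.1
    have h2 : ContMDiffOn (𝓘(ℝ, ℝ).prod (IW.prod IW)) 𝓘(ℝ, V) ∞
        (fun x : ℝ × W × W => Θ x.2.2) (Icc 0 1 ×ˢ O ×ˢ O) :=
      hΘ.comp (contMDiff_snd.comp contMDiff_snd).contMDiffOn fun x hx => hx.2.2
    have h0 : ContMDiffOn (𝓘(ℝ, ℝ).prod (IW.prod IW)) 𝓘(ℝ, ℝ) ∞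
        (fun x : ℝ × W × W => x.1) (Icc 0 1 ×ˢ O ×ˢ O) := contMDiff_fst.contMDiffOn
    have h3 : ContMDiffOn (𝓘(ℝ, ℝ).prod (IW.prod IW)) 𝓘(ℝ, ℝ) ∞
        (fun x : ℝ × W × W => 1 - x.1) (Icc 0 1 ×ˢ O ×ˢ O) := contMDiffOn_const.sub h0
    exact hΨ.comp ((h3.smul h1).add (h0.smul h2)) fun x hx =>
      hmem hC hx.1 (hΘC hx.2.1) (hΘC hx.2.2)
  · simp [hinv p hp]
  · simp [hinv q hq]
  · rw [← add_smul, sub_add_cancel, one_smul, hinv p hp]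
  · exact hΨS _ (hmem hC hs (hΘC hp) (hΘC hq)) (hmem hD hs (hΘS p hp hpS) (hΘS q hq hqS))

theorem contMDiffOn_extend {φ : OpenPartialHomeomorph W HW} (hφ : φ ∈ IsManifold.maximalAtlas IW ∞ W) :
    ContMDiffOn IW 𝓘(ℝ, EW) ∞ (φ.extend IW) φ.source := fun _ hx =>
  (OpenPartialHomeomorph.contMDiffAt_extend hφ hx).contMDiffWithinAt

theorem contMDiffOn_extend_symm' {φ : OpenPartialHomeomorph W HW}
    (hφ : φ ∈ IsManifold.maximalAtlas IW ∞ W) :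
    ContMDiffOn 𝓘(ℝ, EW) IW ∞ (φ.extend IW).symm (φ.extend IW).target := by
  rw [φ.extend_target']
  exact contMDiffOn_extend_symm hφ

variable [IsManifold IW ∞ W]

/-- Away from `S` a ball in a chart, cut by the convex range of the model, suffices. As the open set
misses `S`, the set representing `S` may be empty. -/
theorem exists_isInterpolation_of_notMem {S : Set W} (hS : IsClosed S) {w : W} (hw : w ∉ S)
    (hconv : Convex ℝ (range IW)) :
    ∃ O m, IsInterpolation IW S O m ∧ w ∈ O := by
  obtain ⟨ε, hε, hsub⟩ := Metric.mem_nhdsWithin_iff.1 (extChartAt_target_mem_nhdsWithin (I := IW) w)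
  refine ⟨(extChartAt IW w).source ∩ extChartAt IW w ⁻¹' Metric.ball (extChartAt IW w w) ε ∩ Sᶜ, _,
    isInterpolation_of_convex (C := Metric.ball (extChartAt IW w w) ε ∩ range IW) (D := ∅)
    (Ψ := (extChartAt IW w).symm)
    (((continuousOn_extChartAt w).isOpen_inter_preimage (isOpen_extChartAt_source w)
      Metric.isOpen_ball).inter hS.isOpen_compl) ?_ ?_
    ((convex_ball _ _).inter hconv) convex_empty
    (fun p hp => ⟨hp.1.2, extChartAt_target_subset_range (I := IW) w
      ((extChartAt IW w).map_source hp.1.1)⟩)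
    (fun p hp => (extChartAt IW w).left_inv hp.1.1) (fun p hp h => hp.2 h) (fun v _ h => h.elim),
    ⟨⟨mem_extChartAt_source w, Metric.mem_ball_self hε⟩, hw⟩⟩
  · have := contMDiffOn_extChartAt (I := IW) (x := w) (n := ∞)
    exact this.mono fun p hp => by simpa using hp.1.1
  · exact (contMDiffOn_extChartAt_symm w).mono hsub

omit [IsManifold IW ∞ W] in
-- The point is to find coordinates near `ι (j x₀)` in which both `W` and `N` look convex. The
-- immersion charts make `ι` and `j` linear inclusions, but they use two different charts of `M`.
-- Correcting the `M`-component by the transition map makes `N` the model range of `IN` inside a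
-- linear subspace, and the half space condition defining `W` must then be shown to stay convex.
theorem exists_isInterpolation_of_mem {ι : M → W} {j : N → M} (hIM : range IM = univ)
    (hIN : Convex ℝ (range IN)) (l : EW →L[ℝ] ℝ) (hl : range IW = {y | 0 ≤ l y})
    (hι : IsSmoothEmbedding IM IW ∞ ι) (hj : IsSmoothEmbedding IN IM ∞ j) (x₀ : N) :
    ∃ O m, IsInterpolation IW (range (ι ∘ j)) O m ∧ ι (j x₀) ∈ O := by
  obtain ⟨F₁, _, _, hι'⟩ := hι.isImmersion.isImmersionAt (j x₀)
  obtain ⟨F₂, _, _, hj'⟩ := hj.isImmersion.isImmersionAt x₀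
  have : IM.Boundaryless := ⟨hIM⟩
  have he : IsEmbedding (ι ∘ j) := hι.isEmbedding.comp hj.isEmbedding
  set φM := hι'.domChart with hφM
  set φW := hι'.codChart with hφW
  set ψN := hj'.domChart with hψN
  set ψM := hj'.codChart with hψM
  set L₁ := hι'.equiv with hL₁
  set L₂ := hj'.equiv with hL₂
  have mφM : j x₀ ∈ φM.source := hι'.mem_domChart_source
  have mφW : ι (j x₀) ∈ φW.source := hι'.mem_codChart_source
  have mψN : x₀ ∈ ψN.source := hj'.mem_domChart_source
  have mψM : j x₀ ∈ ψM.source := hj'.mem_codChart_source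
  have aφM := hι'.domChart_mem_maximalAtlas
  have aφW := hι'.codChart_mem_maximalAtlas
  have aψN := hj'.domChart_mem_maximalAtlas
  have aψM := hj'.codChart_mem_maximalAtlas
  have w₁ : ∀ p ∈ φM.source, φW.extend IW (ι p) = L₁ (φM.extend IM p, 0) := fun p hp => by
    have := hι'.writtenInCharts ((φM.extend IM).map_source (by rwa [φM.extend_source]))
    simp only [Function.comp_apply] at this
    rw [← hφM, φM.extend_left_inv hp] at this
    exact this
  have w₂ : ∀ x ∈ ψN.source, ψM.extend IM (j x) = L₂ (ψN.extend IN x, 0) := fun x hx => by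
    have := hj'.writtenInCharts ((ψN.extend IN).map_source (by rwa [ψN.extend_source]))
    simp only [Function.comp_apply] at this
    rw [← hψN, ψN.extend_left_inv hx] at this
    exact this
  have s₁ : ∀ p ∈ φM.source, ι p ∈ φW.source := fun p hp => hι'.source_subset_preimage_source hp
  have s₂ : ∀ x ∈ ψN.source, j x ∈ ψM.source := fun p hp => hj'.source_subset_preimage_source hp
  -- the domains of the transition map between the two charts of `M`
  set U₁ : Set EM := (φM.extend IM).target ∩ (φM.extend IM).symm ⁻¹' ψM.source with hU₁
  set U₂ : Set EM := (ψM.extend IM).target ∩ (ψM.extend IM).symm ⁻¹' φM.source with hU₂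
  have oU₁ : IsOpen U₁ := φM.continuousOn_extend_symm.isOpen_inter_preimage
    (φM.isOpen_extend_target) ψM.open_source
  have oU₂ : IsOpen U₂ := ψM.continuousOn_extend_symm.isOpen_inter_preimage
    (ψM.isOpen_extend_target) φM.open_source
  have cT : ContMDiffOn 𝓘(ℝ, EM) 𝓘(ℝ, EM) ∞
      (fun x => ψM.extend IM ((φM.extend IM).symm x)) U₁ :=
    (contMDiffOn_extend aψM).comp ((contMDiffOn_extend_symm' aφM).mono inter_subset_left)
      fun x hx => hx.2
  have cT' : ContMDiffOn 𝓘(ℝ, EM) 𝓘(ℝ, EM) ∞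
      (fun x => φM.extend IM ((ψM.extend IM).symm x)) U₂ :=
    (contMDiffOn_extend aφM).comp ((contMDiffOn_extend_symm' aψM).mono inter_subset_left)
      fun x hx => hx.2
  -- `Θ` splits the chart of `W` into a tangential and a normal component and rewrites the
  -- tangential one in the chart of `M` adapted to `j`; `Q` undoes this.
  set Θ : W → EM × F₁ := fun p =>
    (ψM.extend IM ((φM.extend IM).symm (L₁.symm (φW.extend IW p)).1), (L₁.symm (φW.extend IW p)).2)
    with hΘ
  set Q : EM × F₁ → EW := fun v => L₁ (φM.extend IM ((ψM.extend IM).symm v.1), v.2) with hQ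
  set Ψ : EM × F₁ → W := fun v => (φW.extend IW).symm (Q v) with hΨ
  set O₁ : Set W := φW.source ∩ (fun p => (L₁.symm (φW.extend IW p)).1) ⁻¹' U₁ with hO₁
  have cφW : ContMDiffOn IW 𝓘(ℝ, EW) ∞ (φW.extend IW) φW.source := contMDiffOn_extend aφW
  have cL : ContMDiffOn IW 𝓘(ℝ, EM) ∞ (fun p => (L₁.symm (φW.extend IW p)).1) φW.source :=
    ((ContinuousLinearMap.fst ℝ EM F₁).contMDiff.comp L₁.symm.contDiff.contMDiff).comp_contMDiffOn cφW
  have cL2 : ContMDiffOn IW 𝓘(ℝ, F₁) ∞ (fun p => (L₁.symm (φW.extend IW p)).2) φW.source :=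
    ((ContinuousLinearMap.snd ℝ EM F₁).contMDiff.comp L₁.symm.contDiff.contMDiff).comp_contMDiffOn cφW
  have oO₁ : IsOpen O₁ := cL.continuousOn.isOpen_inter_preimage φW.open_source oU₁
  have cΘ : ContMDiffOn IW 𝓘(ℝ, EM × F₁) ∞ Θ O₁ :=
    (cT.comp (cL.mono inter_subset_left) fun p hp => hp.2).prodMk_space (cL2.mono inter_subset_left)
  have cQ : ContMDiffOn 𝓘(ℝ, EM × F₁) 𝓘(ℝ, EW) ∞ Q (Prod.fst ⁻¹' U₂) :=
    L₁.contDiff.contMDiff.comp_contMDiffOn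
      ((cT'.comp (ContinuousLinearMap.fst ℝ EM F₁).contMDiff.contMDiffOn
        fun v hv => hv).prodMk_space (ContinuousLinearMap.snd ℝ EM F₁).contMDiff.contMDiffOn)
  -- relations between `Θ` and `Q`
  have hQΘ : ∀ p ∈ O₁, (Θ p).1 ∈ U₂ ∧ Q (Θ p) = φW.extend IW p := fun p hp => by
    have h1 : (φM.extend IM).symm (L₁.symm (φW.extend IW p)).1 ∈ φM.source := by
      have := (φM.extend IM).map_target hp.2.1
      rwa [φM.extend_source] at this
    have h2 : (ψM.extend IM).symm (Θ p).1 = (φM.extend IM).symm (L₁.symm (φW.extend IW p)).1 :=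
      ψM.extend_left_inv hp.2.2
    refine ⟨⟨(ψM.extend IM).map_source (by rw [ψM.extend_source]; exact hp.2.2), ?_⟩, ?_⟩
    · rw [mem_preimage, h2]; exact h1
    · simp only [hQ]
      rw [h2, (φM.extend IM).right_inv hp.2.1]
      exact L₁.apply_symm_apply _
  have hΨΘ : ∀ p ∈ O₁, Ψ (Θ p) = p := fun p hp => by
    simp only [hΨ, (hQΘ p hp).2, φW.extend_left_inv hp.1]
  have hΘe : ∀ x, j x ∈ φM.source → x ∈ ψN.source → ι (j x) ∈ O₁ ∧
      Θ (ι (j x)) = (L₂ (ψN.extend IN x, 0), 0) := fun x hx hx' => by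
    have h1 : L₁.symm (φW.extend IW (ι (j x))) = (φM.extend IM (j x), 0) := by
      rw [w₁ _ hx, L₁.symm_apply_apply]
    have h2 : (φM.extend IM).symm (φM.extend IM (j x)) = j x := φM.extend_left_inv hx
    refine ⟨⟨s₁ _ hx, ?_⟩, ?_⟩
    · rw [mem_preimage, h1]
      refine ⟨(φM.extend IM).map_source (by rwa [φM.extend_source]), ?_⟩
      rw [mem_preimage, h2]; exact s₂ _ hx'
    · simp only [hΘ, h1, h2, w₂ _ hx']
  obtain ⟨mO₁, hΘ₀⟩ := hΘe x₀ mφM mψN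
  set v₀ := Θ (ι (j x₀)) with hv₀
  have hQ₀ : Q v₀ = φW.extend IW (ι (j x₀)) := (hQΘ _ mO₁).2
  have hv₀U : v₀.1 ∈ U₂ := (hQΘ _ mO₁).1
  have cQv : ContinuousAt Q v₀ :=
    cQ.continuousOn.continuousAt ((oU₂.preimage continuous_fst).mem_nhds hv₀U)
  -- neighborhoods of `v₀`
  have n₁ : ∀ᶠ v in 𝓝 v₀, v.1 ∈ U₂ := (oU₂.preimage continuous_fst).mem_nhds hv₀U
  have n₂ : ∀ᶠ v in 𝓝 v₀, Q v ∈ range IW → Q v ∈ (φW.extend IW).target := by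
    have := φW.extend_target_mem_nhdsWithin (I := IW) mφW
    rw [← hQ₀] at this
    exact cQv.eventually (eventually_nhdsWithin_iff.1 this)
  -- Here the embedding property enters: every point of `N` mapped into `O₂` lies in the chart
  -- domains used, so no other sheet of `N` comes near.
  obtain ⟨O₂, oO₂, hO₂⟩ : ∃ O₂ : Set W, IsOpen O₂ ∧
      (ι ∘ j) ⁻¹' O₂ = ψN.source ∩ j ⁻¹' φM.source :=
    he.isInducing.isOpen_iff.1 (ψN.open_source.inter (φM.open_source.preimage hj.isEmbedding.continuous))
  have mO₂ : ι (j x₀) ∈ O₂ := by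
    have : x₀ ∈ (ι ∘ j) ⁻¹' O₂ := by rw [hO₂]; exact ⟨mψN, mφM⟩
    exact this
  have n₃ : ∀ᶠ v in 𝓝 v₀, Q v ∈ range IW → Ψ v ∈ O₂ := by
    have h1 : ContinuousAt (φW.extend IW).symm (Q v₀) := by
      rw [hQ₀]; exact φW.continuousAt_extend_symm mφW
    have h2 : Ψ v₀ = ι (j x₀) := hΨΘ _ mO₁
    have h3 : ContinuousAt Ψ v₀ := h1.comp cQv
    exact (h3.eventually_mem (oO₂.mem_nhds (by rw [h2]; exact mO₂))).mono fun v hv _ => hv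
  have n₄ : ∀ᶠ v in 𝓝 v₀, (L₂.symm v.1).1 ∈ range IN → (L₂.symm v.1).1 ∈ (ψN.extend IN).target := by
    have hc : ContinuousAt (fun v : EM × F₁ => (L₂.symm v.1).1) v₀ := by fun_prop
    have := ψN.extend_target_mem_nhdsWithin (I := IN) mψN
    have h0 : (L₂.symm v₀.1).1 = ψN.extend IN x₀ := by rw [hΘ₀]; simp
    rw [← h0] at this
    exact hc.eventually (eventually_nhdsWithin_iff.1 this)
  -- The transition map is nonlinear, so convexity of the half space condition is not automatic. If
  -- `l > 0` at the base point, the condition holds on a neighborhood. If `l = 0` there, the linear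
  -- functional `l (L₁ (·, 0))` has a local minimum, because the image of `ι` lies in `W`. It is
  -- therefore zero, and the condition depends only on the normal component, linearly.
  have n₅ : (∀ᶠ v in 𝓝 v₀, Q v ∈ range IW) ∨ ∀ v, l (Q v) = l (L₁ (0, v.2)) := by
    set x := φM.extend IM (j x₀) with hx
    have h0 : l (Q v₀) = l (L₁ (x, 0)) := by rw [hQ₀, w₁ _ mφM]
    have hnn : ∀ᶠ y in 𝓝 x, 0 ≤ l (L₁ (y, 0)) := by
      filter_upwards [φM.isOpen_extend_target.mem_nhds
        ((φM.extend IM).map_source (by rwa [φM.extend_source]))] with y hy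
      have h1 : (φM.extend IM).symm y ∈ φM.source := by
        have := (φM.extend IM).map_target hy
        rwa [φM.extend_source] at this
      have h2 := w₁ _ h1
      rw [(φM.extend IM).right_inv hy] at h2
      have : φW.extend IW (ι ((φM.extend IM).symm y)) ∈ range IW := by
        simp [OpenPartialHomeomorph.extend]
      rw [hl, h2] at this
      exact this
    rcases (hnn.self_of_nhds).eq_or_lt with h | h
    · right
      set κ : EM →L[ℝ] ℝ := l.comp ((L₁ : EM × F₁ →L[ℝ] EW).comp (ContinuousLinearMap.inl ℝ EM F₁))
      have hmin : IsLocalMin κ x := by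
        filter_upwards [hnn] with y hy
        change l (L₁ (x, 0)) ≤ l (L₁ (y, 0))
        rw [← h]; exact hy
      have hκ : κ = 0 := by
        have := hmin.fderiv_eq_zero
        rwa [κ.fderiv] at this
      intro v
      have : ((φM.extend IM ((ψM.extend IM).symm v.1), v.2) : EM × F₁) =
        (φM.extend IM ((ψM.extend IM).symm v.1), 0) + (0, v.2) := by simp
      simp only [hQ]
      rw [this, map_add, map_add]
      have hk : l (L₁ (φM.extend IM ((ψM.extend IM).symm v.1), 0)) = 0 :=
        congrArg (fun k : EM →L[ℝ] ℝ => k (φM.extend IM ((ψM.extend IM).symm v.1))) hκ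
      rw [hk, zero_add]
    · left
      have : 0 < l (Q v₀) := by rw [h0]; exact h
      filter_upwards [(l.continuous.continuousAt.comp cQv).eventually_const_lt this] with v hv
      rw [hl]; exact hv.le
  obtain ⟨δ, hδ, hball⟩ := Metric.eventually_nhds_iff_ball.1 ((n₁.and n₂).and (n₃.and n₄))
  obtain ⟨δ', hδ', hδδ, hconv⟩ : ∃ δ' > 0, δ' ≤ δ ∧
      Convex ℝ (Metric.ball v₀ δ' ∩ {v | Q v ∈ range IW}) := by
    rcases n₅ with h | h
    · obtain ⟨ε, hε, hb⟩ := Metric.eventually_nhds_iff_ball.1 h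
      refine ⟨min δ ε, lt_min hδ hε, min_le_left _ _, ?_⟩
      have : Metric.ball v₀ (min δ ε) ∩ {v | Q v ∈ range IW} = Metric.ball v₀ (min δ ε) :=
        inter_eq_left.2 fun v hv => hb v (Metric.ball_subset_ball (min_le_right _ _) hv)
      rw [this]
      exact convex_ball _ _
    · refine ⟨δ, hδ, le_rfl, (convex_ball _ _).inter ?_⟩
      have : {v | Q v ∈ range IW} = (l.comp ((L₁ : EM × F₁ →L[ℝ] EW).comp
          ((ContinuousLinearMap.inr ℝ EM F₁).comp (ContinuousLinearMap.snd ℝ EM F₁)))) ⁻¹' Ici 0 := by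
        ext v
        rw [mem_ofPred_eq, hl, mem_ofPred_eq, h v]
        rfl
      rw [this]
      exact (convex_Ici (0 : ℝ)).is_linear_preimage (ContinuousLinearMap.toLinearMap _).isLinear
  set C := Metric.ball v₀ δ' ∩ {v | Q v ∈ range IW} with hC
  have hCb : ∀ v ∈ C, ((v.1 ∈ U₂) ∧ Q v ∈ (φW.extend IW).target) ∧ Ψ v ∈ O₂ ∧
      ((L₂.symm v.1).1 ∈ range IN → (L₂.symm v.1).1 ∈ (ψN.extend IN).target) := fun v hv => by
    obtain ⟨⟨h1, h2⟩, h3, h4⟩ := hball v (Metric.ball_subset_ball hδδ hv.1)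
    exact ⟨⟨h1, h2 hv.2⟩, h3 hv.2, h4⟩
  -- This is the image of `N` in the coordinates `Θ`: both normal components vanish, and the
  -- remaining one lies in the convex model range of `IN`.
  set D : Set (EM × F₁) := {v | v.2 = 0 ∧ (L₂.symm v.1).2 = 0 ∧ (L₂.symm v.1).1 ∈ range IN} with hD
  have hDc : Convex ℝ D := by
    intro v hv w hw a b ha hb hab
    refine ⟨?_, ?_, ?_⟩
    · simp [hv.1, hw.1]
    · simp [hv.2.1, hw.2.1]
    · have := hIN hv.2.2 hw.2.2 ha hb hab
      simpa using this
  have hΘC : MapsTo Θ (O₁ ∩ Θ ⁻¹' Metric.ball v₀ δ') C := fun p hp => by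
    refine ⟨hp.2, ?_⟩
    rw [mem_ofPred_eq, (hQΘ p hp.1).2]
    simp [OpenPartialHomeomorph.extend]
  refine ⟨O₁ ∩ Θ ⁻¹' Metric.ball v₀ δ', _, isInterpolation_of_convex (C := C) (D := D) (Ψ := Ψ)
    (cΘ.continuousOn.isOpen_inter_preimage oO₁ Metric.isOpen_ball) (cΘ.mono inter_subset_left)
    ?_ hconv hDc hΘC (fun p hp => hΨΘ p hp.1) ?_ ?_, ⟨mO₁, Metric.mem_ball_self hδ'⟩⟩
  · exact (contMDiffOn_extend_symm' aφW).comp (cQ.mono fun v hv => (hCb v hv).1.1)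
      fun v hv => (hCb v hv).1.2
  · rintro p hp ⟨x, rfl⟩
    have h1 := (hCb _ (hΘC hp)).2.1
    rw [hΨΘ _ hp.1] at h1
    have h2 : x ∈ ψN.source ∩ j ⁻¹' φM.source := by rw [← hO₂]; exact h1
    have h3 : Θ ((ι ∘ j) x) = _ := (hΘe x h2.2 h2.1).2
    rw [h3]
    refine ⟨rfl, by simp, ?_⟩
    simp [OpenPartialHomeomorph.extend]
  · intro v hv hvD
    have ht := (hCb v hv).2.2 hvD.2.2
    set x := (ψN.extend IN).symm (L₂.symm v.1).1 with hx
    have hxs : x ∈ ψN.source := by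
      have := (ψN.extend IN).map_target ht
      rwa [ψN.extend_source] at this
    have h1 : ψM.extend IM (j x) = v.1 := by
      rw [w₂ x hxs, (ψN.extend IN).right_inv ht]
      have : ((L₂.symm v.1).1, (0 : F₂)) = L₂.symm v.1 := Prod.ext rfl hvD.2.1.symm
      rw [this, L₂.apply_symm_apply]
    have h2 : (ψM.extend IM).symm v.1 = j x := by rw [← h1, ψM.extend_left_inv (s₂ x hxs)]
    have h3 : j x ∈ φM.source := by
      have := (hCb v hv).1.1.2
      rwa [mem_preimage, h2] at this
    refine ⟨x, ?_⟩
    have h4 : Q v = φW.extend IW (ι (j x)) := by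
      rw [w₁ _ h3]
      simp only [hQ, h2, hvD.1]
    simp only [hΨ, h4, Function.comp_apply, φW.extend_left_inv (s₁ _ h3)]

end Interpolation

/-! ## Nearby disks are joined by a chain of homotopies -/

section Chain

variable {EW : Type*} [NormedAddCommGroup EW] [NormedSpace ℝ EW]
  {HW : Type*} [TopologicalSpace HW] {IW : ModelWithCorners ℝ EW HW}
  {W : Type*} [TopologicalSpace W] [ChartedSpace HW W]
  {N : Type*} {T : Type*}

/-- Convergence of a family of maps on the closed disk, locally uniformly. -/
def TendstoOnDisk (l : Filter T) (a : T → ℂ → W) (u : ℂ → W) : Prop :=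
  ∀ z ∈ Metric.closedBall (0 : ℂ) 1,
    Tendsto (fun x : T × ℂ => a x.1 x.2) (l ×ˢ 𝓝[Metric.closedBall 0 1] z) (𝓝 (u z))

omit [ChartedSpace HW W] in
-- Convergence is assumed on a neighborhood of each point of the disk; compactness of `K` makes it
-- uniform.
theorem TendstoOnDisk.eventually_forall_mem {l : Filter T} {a : T → ℂ → W} {u : ℂ → W}
    (h : TendstoOnDisk l a u) {K : Set ℂ} (hK : IsCompact K) (hKD : K ⊆ Metric.closedBall 0 1)
    {O : Set W} (hO : IsOpen O) (hu : ∀ w ∈ K, u w ∈ O) : ∀ᶠ t in l, ∀ w ∈ K, a t w ∈ O := by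
  refine hK.induction_on (p := fun A => ∀ᶠ t in l, ∀ w ∈ A, a t w ∈ O) (by simp)
    (fun A B hAB h => h.mono fun t ht w hw => ht w (hAB hw))
    (fun A B hA hB => (hA.and hB).mono fun t ht w hw => hw.elim (ht.1 w) (ht.2 w)) fun z hz => ?_
  obtain ⟨pa, hpa, pb, hpb, hab⟩ :=
    eventually_prod_iff.1 ((h z (hKD hz)).eventually (hO.mem_nhds (hu z hz)))
  exact ⟨{w | pb w}, nhdsWithin_mono _ hKD hpb, hpa.mono fun t ht w hw => hab ht hw⟩

/-- On a patch, move the map `p` to the map `b`. -/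
def patch (m : ℝ × W × W → W) (χ : ℂ → ℝ) (p b : ℂ → W) (w : ℂ) : W :=
  if χ w = 0 then p w else m (χ w, p w, b w)

/-- Near the support of `χ` both maps lie in `O`, where the interpolation is smooth; away from it
the patched map is `p`. The strict inequality `rOut < R` lets these two open descriptions cover the
disk, and `m` is never evaluated where it carries no information. -/
theorem contMDiffOn_patch {S O : Set W} {m : ℝ × W × W → W}
    (hm : IsInterpolation IW S O m) {c : ℂ} (χ : ContDiffBump c) {R : ℝ} (hR : χ.rOut < R)
    {p b : ℂ → W} (hp : ContMDiffOn 𝓘(ℝ, ℂ) IW ∞ p (Metric.closedBall 0 1))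
    (hb : ContMDiffOn 𝓘(ℝ, ℂ) IW ∞ b (Metric.closedBall 0 1))
    (hO : ∀ w ∈ Metric.closedBall 0 1 ∩ Metric.closedBall c R, p w ∈ O ∧ b w ∈ O) :
    ContMDiffOn 𝓘(ℝ, ℝ × ℂ) IW ∞
      (fun x : ℝ × ℂ => patch m (fun w => Real.smoothTransition x.1 * χ w) p b x.2)
      (univ ×ˢ Metric.closedBall 0 1) := by
  have hp' : ContMDiffOn 𝓘(ℝ, ℝ × ℂ) IW ∞ (fun x : ℝ × ℂ => p x.2)
      (univ ×ˢ Metric.closedBall 0 1) := hp.comp contDiff_snd.contMDiff.contMDiffOn fun x hx => hx.2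
  have hb' : ContMDiffOn 𝓘(ℝ, ℝ × ℂ) IW ∞ (fun x : ℝ × ℂ => b x.2)
      (univ ×ˢ Metric.closedBall 0 1) := hb.comp contDiff_snd.contMDiff.contMDiffOn fun x hx => hx.2
  rintro ⟨τ, w⟩ hw
  by_cases hc : w ∈ Metric.closedBall c χ.rOut
  · have hRw : ∀ᶠ x : ℝ × ℂ in 𝓝 (τ, w), x.2 ∈ Metric.ball c R :=
      continuousAt_snd.eventually_mem
        (Metric.isOpen_ball.mem_nhds (Metric.closedBall_subset_ball hR hc))
    have hcR : ∀ {x : ℝ × ℂ}, x.2 ∈ Metric.ball c R → x ∈ univ ×ˢ Metric.closedBall (0 : ℂ) 1 →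
        (p x.2 ∈ O ∧ b x.2 ∈ O) := fun hx hx' => hO _ ⟨hx'.2, Metric.ball_subset_closedBall hx⟩
    have hmem : ∀ x : ℝ × ℂ, Real.smoothTransition x.1 * χ x.2 ∈ Icc (0 : ℝ) 1 := fun x =>
      ⟨mul_nonneg (Real.smoothTransition.nonneg _) χ.nonneg,
        mul_le_one₀ (Real.smoothTransition.le_one _) χ.nonneg χ.le_one⟩
    have key : ContMDiffWithinAt 𝓘(ℝ, ℝ × ℂ) IW ∞
        (fun x : ℝ × ℂ => m (Real.smoothTransition x.1 * χ x.2, p x.2, b x.2))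
        ((univ ×ˢ Metric.closedBall 0 1) ∩ {x | x.2 ∈ Metric.ball c R}) (τ, w) := by
      have hχ : ContMDiff 𝓘(ℝ, ℝ × ℂ) 𝓘(ℝ, ℝ) ∞
          fun x : ℝ × ℂ => Real.smoothTransition x.1 * χ x.2 :=
        ((Real.smoothTransition.contDiff.comp contDiff_fst).mul
          (χ.contDiff.comp contDiff_snd)).contMDiff
      refine hm.smooth.comp (hχ.contMDiffOn.prodMk ((hp'.mono inter_subset_left).prodMk
        (hb'.mono inter_subset_left))) (fun x hx => ⟨hmem x, ?_⟩) _
        ⟨hw, Metric.closedBall_subset_ball hR hc⟩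
      exact hcR hx.2 hx.1
    have key' := (contMDiffWithinAt_inter hRw).1 key
    refine key'.congr_of_eventuallyEq ?_ ?_
    · filter_upwards [self_mem_nhdsWithin, hRw.filter_mono nhdsWithin_le_nhds] with x hx hxR
      simp only [patch]
      split_ifs with h0
      · rw [h0, hm.zero _ (hcR hxR hx).1 _ (hcR hxR hx).2]
      · rfl
    · have hxR := Metric.closedBall_subset_ball hR hc
      simp only [patch]
      split_ifs with h0
      · rw [h0, hm.zero _ (hcR (x := (τ, w)) hxR hw).1 _ (hcR (x := (τ, w)) hxR hw).2]
      · rfl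
  · have h0 : ∀ᶠ x : ℝ × ℂ in 𝓝 (τ, w), x.2 ∈ (Metric.closedBall c χ.rOut)ᶜ :=
      continuousAt_snd.eventually_mem (Metric.isClosed_closedBall.isOpen_compl.mem_nhds hc)
    have h1 : ∀ {x : ℝ × ℂ}, x.2 ∈ (Metric.closedBall c χ.rOut)ᶜ →
        patch m (fun w => Real.smoothTransition x.1 * χ w) p b x.2 = p x.2 := fun hx => by
      rw [patch, if_pos]
      rw [χ.zero_of_le_dist, mul_zero]
      exact (not_le.1 (fun h => hx h)).le
    exact (hp' (τ, w) hw).congr_of_eventuallyEq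
      ((h0.filter_mono nhdsWithin_le_nhds).mono fun x hx => h1 hx) (h1 (x := (τ, w)) hc)

theorem patch_mem {S O : Set W} {m : ℝ × W × W → W} (hm : IsInterpolation IW S O m)
    {χ : ℂ → ℝ} (hχ : ∀ w, χ w ∈ Icc (0 : ℝ) 1) {p b : ℂ → W} {w : ℂ}
    (hO : χ w ≠ 0 → p w ∈ O ∧ b w ∈ O) (hp : p w ∈ S) (hb : b w ∈ S) : patch m χ p b w ∈ S := by
  rw [patch]
  split_ifs with h
  exacts [hp, hm.mem _ (hχ w) _ (hO h).1 _ (hO h).2 hp hb]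

/-- The interpolation is constant on the diagonal, so two families with the same limit are patched
to a family with that limit. -/
theorem TendstoOnDisk.patch {S O : Set W} {m : ℝ × W × W → W} (hm : IsInterpolation IW S O m)
    {c : ℂ} (χ : ContDiffBump c) {l : Filter T} {p b : T → ℂ → W} {u : ℂ → W}
    (hp : TendstoOnDisk l p u) (hb : TendstoOnDisk l b u)
    (hO : ∀ w ∈ Metric.closedBall 0 1 ∩ Metric.closedBall c χ.rOut, u w ∈ O) :
    TendstoOnDisk l (fun t => patch m χ (p t) (b t)) u := by
  intro z hz
  by_cases hc : z ∈ Metric.closedBall c χ.rOut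
  · have huO := hO z ⟨hz, hc⟩
    refine (hp z hz).if' ?_
    have h1 : Tendsto (fun x : T × ℂ => ((χ x.2 : ℝ), p x.1 x.2, b x.1 x.2))
        (l ×ˢ 𝓝[Metric.closedBall 0 1] z) (𝓝 ((χ z : ℝ), u z, u z)) := by
      refine Tendsto.prodMk_nhds ?_ ((hp z hz).prodMk_nhds (hb z hz))
      exact (χ.continuous.continuousAt (x := z)).tendsto.comp
        (tendsto_snd.mono_right nhdsWithin_le_nhds)
    have h2 : ContinuousWithinAt m (Icc 0 1 ×ˢ O ×ˢ O) ((χ z : ℝ), u z, u z) :=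
      hm.smooth.continuousOn _ ⟨⟨χ.nonneg, χ.le_one⟩, huO, huO⟩
    have h3 : m ((χ z : ℝ), u z, u z) = u z := hm.diag _ ⟨χ.nonneg, χ.le_one⟩ _ huO
    rw [ContinuousWithinAt, h3] at h2
    refine h2.comp (tendsto_nhdsWithin_iff.2 ⟨h1, ?_⟩)
    filter_upwards [(hp z hz).eventually (hm.isOpen.mem_nhds huO),
      (hb z hz).eventually (hm.isOpen.mem_nhds huO)] with x hx hx'
    exact ⟨⟨χ.nonneg, χ.le_one⟩, hx, hx'⟩
  · refine (hp z hz).congr' ?_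
    have h0 : ∀ᶠ w in 𝓝[Metric.closedBall 0 1] z, w ∈ (Metric.closedBall c χ.rOut)ᶜ :=
      nhdsWithin_le_nhds (Metric.isClosed_closedBall.isOpen_compl.mem_nhds hc)
    filter_upwards [tendsto_snd.eventually h0] with x hx
    rw [BishopDisk.patch, if_pos]
    exact χ.zero_of_le_dist (not_le.1 (fun h => hx h)).le

/-- A quantity that is invariant under homotopies takes the same value on disks that are close. -/
theorem eventually_eq_of_tendstoOnDisk {e : N → W} {A : Type*} {G : (ℂ → W) → A}
    (hG : ∀ h : ℝ × ℂ → W, ContMDiffOn 𝓘(ℝ, ℝ × ℂ) IW ∞ h (univ ×ˢ Metric.closedBall 0 1) →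
      (∀ τ z, ‖z‖ = 1 → h (τ, z) ∈ range e) → G (fun z => h (1, z)) = G (fun z => h (0, z)))
    (hGc : ∀ a b : ℂ → W, EqOn a b (Metric.closedBall 0 1) → G a = G b)
    (hint : ∀ w : W, ∃ O m, IsInterpolation IW (range e) O m ∧ w ∈ O)
    {l : Filter T} {b : T → ℂ → W} {u : ℂ → W} (hu : IsDiskMap IW e u)
    (hb : ∀ t, IsDiskMap IW e (b t)) (hbu : TendstoOnDisk l b u) : ∀ᶠ t in l, G (b t) = G u := by
  choose O m hm hO using hint
  have hR : ∀ z : ℂ, ∃ R > 0, z ∈ Metric.closedBall (0 : ℂ) 1 →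
      ∀ w ∈ Metric.closedBall 0 1 ∩ Metric.closedBall z R, u w ∈ O (u z) := fun z => by
    by_cases hz : z ∈ Metric.closedBall (0 : ℂ) 1
    · obtain ⟨ε, hε, h⟩ := Metric.mem_nhdsWithin_iff.1
        ((hu.smooth.continuousOn z hz).preimage_mem_nhdsWithin ((hm (u z)).isOpen.mem_nhds (hO _)))
      exact ⟨ε / 2, by positivity, fun _ w hw =>
        h ⟨Metric.closedBall_subset_ball (by linarith) hw.2, hw.1⟩⟩
    · exact ⟨1, one_pos, fun h => absurd h hz⟩
  choose R hR0 hRO using hR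
  -- The cutoff is `1` on the ball of radius `R z / 3` and vanishes outside radius `R z / 2`, which
  -- leaves a margin inside the ball of radius `R z` on which `u` stays in `O (u z)`.
  let χ : ∀ z : ℂ, ContDiffBump z := fun z => ⟨R z / 3, R z / 2, by linarith [hR0 z], by linarith [hR0 z]⟩
  have hχR : ∀ z, (χ z).rOut < R z := fun z => half_lt_self (hR0 z)
  -- Move `u` to `b t` one ball at a time. The intermediate map `p` still tends to `u`, has the same
  -- value of `G`, and already agrees with `b t` on the balls treated so far; a finite cover of the
  -- disk then finishes.
  have step : ∀ s : Finset ℂ, ↑s ⊆ Metric.closedBall (0 : ℂ) 1 → ∃ p : T → ℂ → W,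
      TendstoOnDisk l p u ∧ (∀ᶠ t in l, IsDiskMap IW e (p t) ∧ G (p t) = G u) ∧
      ∀ᶠ t in l, ∀ z ∈ s, ∀ w ∈ Metric.closedBall 0 1 ∩ Metric.ball z (R z / 3),
        p t w = b t w := by
    intro s
    induction s using Finset.induction_on with
    | empty =>
      intro _
      refine ⟨fun _ => u, fun z hz => ?_, .of_forall fun _ => ⟨hu, rfl⟩, by simp⟩
      exact (hu.smooth.continuousOn z hz).tendsto.comp tendsto_snd
    | insert z s _ ih =>
      intro hs
      obtain ⟨p, hpu, hpG, hpb⟩ := ih fun w hw => hs (by simp [Finset.mem_coe.1 hw])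
      have hz : z ∈ Metric.closedBall (0 : ℂ) 1 := hs (by simp)
      have hK : IsCompact (Metric.closedBall (0 : ℂ) 1 ∩ Metric.closedBall z (R z)) :=
        (isCompact_closedBall _ _).inter (isCompact_closedBall _ _)
      have hpO := hpu.eventually_forall_mem hK inter_subset_left (hm (u z)).isOpen (hRO z hz)
      have hbO := hbu.eventually_forall_mem hK inter_subset_left (hm (u z)).isOpen (hRO z hz)
      refine ⟨fun t => patch (m (u z)) (χ z) (p t) (b t), hpu.patch (hm _) (χ z) hbu
        fun w hw => hRO z hz w ⟨hw.1, Metric.closedBall_subset_closedBall (hχR z).le hw.2⟩, ?_, ?_⟩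
      · filter_upwards [hpG, hpO, hbO] with t ht htp htb
        have hO' : ∀ w ∈ Metric.closedBall 0 1 ∩ Metric.closedBall z (R z),
          p t w ∈ O (u z) ∧ b t w ∈ O (u z) := fun w hw => ⟨htp w hw, htb w hw⟩
        set h : ℝ × ℂ → W := fun x =>
          patch (m (u z)) (fun w => Real.smoothTransition x.1 * χ z w) (p t) (b t) x.2 with hh
        have hs := contMDiffOn_patch (hm (u z)) (χ z) (hχR z) ht.1.smooth (hb t).smooth hO'
        have hbd : ∀ τ w, ‖w‖ = 1 → h (τ, w) ∈ range e := fun τ w hw => by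
          refine patch_mem (hm (u z)) (χ := fun w => Real.smoothTransition τ * χ z w) (fun w =>
            ⟨mul_nonneg (Real.smoothTransition.nonneg _) (χ z).nonneg,
            mul_le_one₀ (Real.smoothTransition.le_one _) (χ z).nonneg (χ z).le_one⟩) (fun h0 => ?_)
            (ht.1.boundary w hw) ((hb t).boundary w hw)
          refine hO' w ⟨mem_closedBall_zero_iff.2 hw.le, ?_⟩
          by_contra hc
          refine h0 ?_
          rw [(χ z).zero_of_le_dist ((hχR z).le.trans (not_le.1 hc).le), mul_zero]
        have h1 : ∀ w, h (1, w) = patch (m (u z)) (χ z) (p t) (b t) w := fun w => by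
          simp [hh, Real.smoothTransition.one]
        have h0 : ∀ w, h (0, w) = p t w := fun w => by
          simp [hh, patch]
        refine ⟨⟨?_, fun w hw => h1 w ▸ hbd 1 w hw⟩, ?_⟩
        · have := hs.comp (f := fun w : ℂ => ((1 : ℝ), w)) (s := Metric.closedBall 0 1)
            (contDiff_prodMk_right (1 : ℝ)).contMDiff.contMDiffOn fun w hw => ⟨mem_univ _, hw⟩
          exact this.congr fun w _ => (h1 w).symm
        · have := hG h hs hbd
          simp only [h1, h0] at this
          exact this.trans ht.2
      · filter_upwards [hpb, hpO, hbO] with t ht htp htb z' hz' w hw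
        -- On the new ball the cutoff moves `p` fully to `b`; on the earlier ones `p` and `b` agree,
        -- and the diagonal property preserves this.
        have hpw : χ z w = 1 ∨ p t w = b t w := by
          rcases Finset.mem_insert.1 hz' with rfl | h
          · exact Or.inl ((χ z').one_of_mem_closedBall (Metric.ball_subset_closedBall hw.2))
          · exact Or.inr (ht z' h w hw)
        simp only [patch]
        split_ifs with h0
        · rcases hpw with h | h
          · exact absurd (h.symm.trans h0) one_ne_zero
          · exact h
        · have hwR : w ∈ Metric.closedBall 0 1 ∩ Metric.closedBall z (R z) := by
            refine ⟨hw.1, ?_⟩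
            by_contra hc
            exact h0 ((χ z).zero_of_le_dist ((hχR z).le.trans (not_le.1 hc).le))
          rcases hpw with h | h
          · rw [h, (hm _).one _ (htp w hwR) _ (htb w hwR)]
          · rw [h, (hm _).diag _ ⟨(χ z).nonneg, (χ z).le_one⟩ _ (htb w hwR)]
  obtain ⟨s, hsD, hs⟩ := (isCompact_closedBall (0 : ℂ) 1).elim_nhds_subcover
    (fun z => Metric.ball z (R z / 3)) fun z _ => Metric.ball_mem_nhds _ (by linarith [hR0 z])
  obtain ⟨p, _, hpG, hpb⟩ := step s hsD
  filter_upwards [hpG, hpb] with t ht ht'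
  rw [← ht.2]
  refine hGc _ _ fun w hw => ?_
  obtain ⟨z, hz, hwz⟩ := mem_iUnion₂.1 (hs hw)
  exact (ht' z hz w ⟨hw, hwz⟩).symm

end Chain

/-! ## Locally constant quantities on the space of holomorphic disks -/

section Winding

variable {EW : Type*} [NormedAddCommGroup EW] [NormedSpace ℝ EW]
  {HW : Type*} [TopologicalSpace HW] {IW : ModelWithCorners ℝ EW HW}
  {W : Type*} [TopologicalSpace W] [ChartedSpace HW W]
  {EM : Type*} [NormedAddCommGroup EM] [NormedSpace ℝ EM]
  {HM : Type*} [TopologicalSpace HM] {IM : ModelWithCorners ℝ EM HM}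
  {M : Type*} [TopologicalSpace M] [ChartedSpace HM M]
  {EN : Type*} [NormedAddCommGroup EN] [NormedSpace ℝ EN]
  {HN : Type*} [TopologicalSpace HN] {IN : ModelWithCorners ℝ EN HN}
  {N : Type*} [TopologicalSpace N] [ChartedSpace HN N] [Nonempty N] {T : Type*}

omit [ChartedSpace HW W] [ChartedSpace HN N] in
-- As `e` is an embedding, convergence in `N` may be tested in `W`, where the loop is the boundary
-- value of the disk.
theorem TendstoOnDisk.boundaryLoop {e : N → W} (he : IsEmbedding e) {l : Filter T}
    {b : T → ℂ → W} {u : ℂ → W} (h : TendstoOnDisk l b u)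
    (hb : ∀ t z, ‖z‖ = 1 → b t z ∈ range e) (hu : ∀ z, ‖z‖ = 1 → u z ∈ range e) (s : ℝ) :
    Tendsto (fun x : T × ℝ => boundaryLoop e (b x.1) x.2) (l ×ˢ 𝓝 s) (𝓝 (boundaryLoop e u s)) := by
  rw [he.isInducing.tendsto_nhds_iff, apply_boundaryLoop hu]
  have h1 : Tendsto (fun x : T × ℝ => (x.1, circlePt x.2)) (l ×ˢ 𝓝 s)
      (l ×ˢ 𝓝[Metric.closedBall 0 1] (circlePt s)) :=
    tendsto_fst.prodMk (tendsto_nhdsWithin_iff.2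
      ⟨((contDiff_circlePt (n := 0)).continuous.tendsto s).comp tendsto_snd,
        .of_forall fun x => circlePt_mem _⟩)
  refine ((h _ (circlePt_mem s)).comp h1).congr fun x => ?_
  exact (apply_boundaryLoop (hb x.1) x.2).symm

theorem IsDiskMap.contDiff_comp_boundaryLoop {ι : M → W} {j : N → M}
    (hι : IsSmoothEmbedding IM IW ∞ ι) (hj : IsSmoothEmbedding IN IM ∞ j) {a : ℂ → W}
    (ha : IsDiskMap IW (ι ∘ j) a) {B : Set N} {ϑ : N → ℂ} (hϑ : ContMDiffOn IN 𝓘(ℝ, ℂ) ∞ ϑ Bᶜ)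
    (hB : ∀ s, boundaryLoop (ι ∘ j) a s ∉ B) :
    ContDiff ℝ ∞ fun s => ϑ (boundaryLoop (ι ∘ j) a s) :=
  (hϑ.comp_contMDiff (ha.contMDiff_boundaryLoop hι hj) hB).contDiff

/-- The winding number of the boundary loops of nearby disks is the same. -/
theorem eventually_sweptAngle_eq {ι : M → W} {j : N → M}
    (hι : IsSmoothEmbedding IM IW ∞ ι) (hj : IsSmoothEmbedding IN IM ∞ j)
    {l : Filter T} {b : T → ℂ → W} {u : ℂ → W} (h : TendstoOnDisk l b u)
    (hb : ∀ t, IsDiskMap IW (ι ∘ j) (b t)) (hu : IsDiskMap IW (ι ∘ j) u)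
    {B : Set N} {ϑ : N → ℂ} (hϑ : ContMDiffOn IN 𝓘(ℝ, ℂ) ∞ ϑ Bᶜ) (hϑ1 : ∀ x ∉ B, ‖ϑ x‖ = 1)
    (hbB : ∀ t s, boundaryLoop (ι ∘ j) (b t) s ∉ B) (huB : ∀ s, boundaryLoop (ι ∘ j) u s ∉ B) :
    ∀ᶠ t in l, sweptAngle (fun s => ϑ (boundaryLoop (ι ∘ j) (b t) s)) =
      sweptAngle (fun s => ϑ (boundaryLoop (ι ∘ j) u s)) := by
  have he : IsEmbedding (ι ∘ j) := hι.isEmbedding.comp hj.isEmbedding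
  have cu := hu.contDiff_comp_boundaryLoop hι hj hϑ huB
  have hlim : ∀ s, Tendsto (fun x : T × ℝ => ϑ (boundaryLoop (ι ∘ j) (b x.1) x.2) -
      ϑ (boundaryLoop (ι ∘ j) u x.2)) (l ×ˢ 𝓝 s) (𝓝 0) := fun s => by
    have h1 : Tendsto (fun x : T × ℝ => ϑ (boundaryLoop (ι ∘ j) (b x.1) x.2)) (l ×ˢ 𝓝 s)
        (𝓝 (ϑ (boundaryLoop (ι ∘ j) u s))) :=
      (hϑ.continuousOn _ (huB s)).tendsto.comp (tendsto_nhdsWithin_iff.2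
        ⟨h.boundaryLoop he (fun t => (hb t).boundary) hu.boundary s, .of_forall fun x => hbB _ _⟩)
    have h2 := h1.sub ((cu.continuous.tendsto s).comp (tendsto_snd (f := l)))
    simpa using h2
  -- Compactness of the parameter interval makes the two angular functions uniformly closer than
  -- `1`, the modulus of `ϑ`, so the Rouché type criterion applies.
  have hall : ∀ᶠ t in l, ∀ s ∈ Icc (-Real.pi) Real.pi,
      ‖ϑ (boundaryLoop (ι ∘ j) (b t) s) - ϑ (boundaryLoop (ι ∘ j) u s)‖ < 1 := by
    refine isCompact_Icc.induction_on (p := fun A => ∀ᶠ t in l, ∀ s ∈ A,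
      ‖ϑ (boundaryLoop (ι ∘ j) (b t) s) - ϑ (boundaryLoop (ι ∘ j) u s)‖ < 1) (by simp)
      (fun A B hAB h => h.mono fun t ht w hw => ht w (hAB hw))
      (fun A B hA hB => (hA.and hB).mono fun t ht w hw => hw.elim (ht.1 w) (ht.2 w)) fun s _ => ?_
    obtain ⟨pa, hpa, pb, hpb, hab⟩ := eventually_prod_iff.1
      ((hlim s).eventually (Metric.ball_mem_nhds _ one_pos))
    refine ⟨{w | pb w}, nhdsWithin_le_nhds hpb, hpa.mono fun t ht w hw => ?_⟩
    have := hab ht hw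
    rwa [dist_zero_right] at this
  filter_upwards [hall] with t ht
  have hne : ∀ {x}, x ∉ B → ϑ x ≠ 0 := fun hx h0 => by
    have := hϑ1 _ hx
    rw [h0, norm_zero] at this
    exact zero_ne_one this
  refine sweptAngle_eq_of_norm_sub_lt
    (((hb t).contDiff_comp_boundaryLoop hι hj hϑ (hbB t)).of_le (by simp)) (cu.of_le (by simp))
    ?_ ?_ ?_ ?_ fun s hs => ?_
  · exact fun s => hne (hbB t s)
  · exact fun s => hne (huB s)
  · rw [boundaryLoop_neg_pi]
  · rw [boundaryLoop_neg_pi]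
  · rw [hϑ1 _ (huB s)]
    exact ht s hs

end Winding

/-! ### Uniform closeness of disks from the `C^∞`-topology -/

section Topology

variable {k : ℕ}
  {W : Type*} [TopologicalSpace W] [ChartedSpace (EuclideanHalfSpace (2 * k + 4)) W]
  {N : Type*}
  {J : ∀ x : W, TangentSpace (𝓡∂ (2 * k + 4)) x →L[ℝ] TangentSpace (𝓡∂ (2 * k + 4)) x}
  {e : N → W}

omit [TopologicalSpace W] [ChartedSpace (EuclideanHalfSpace (2 * k + 4)) W] in
theorem diskExt_apply (u : Disk → W) (z : Disk) : diskExt u z = u z :=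
  Subtype.val_injective.extend_apply _ _ _

theorem HolDisk.isDiskMap (u : HolDisk J e) : IsDiskMap (𝓡∂ (2 * k + 4)) e (diskExt u.toFun) :=
  ⟨u.smooth, fun z hz => by
    have := u.boundary ⟨z, mem_closedBall_zero_iff.2 hz.le⟩ hz
    rwa [← diskExt_apply u.toFun] at this⟩

variable [IsManifold (𝓡∂ (2 * k + 4)) ∞ W]

omit [IsManifold (𝓡∂ (2 * k + 4)) ∞ W] in
-- This is the case of derivatives of order zero in the definition of the topology; no higher order
-- is used.
theorem HolDisk.eventually_abs_sub_lt (u : HolDisk J e) (h : C^∞⟮𝓡∂ (2 * k + 4), W; ℝ⟯) {ε : ℝ}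
    (hε : 0 < ε) : ∀ᶠ v : HolDisk J e in 𝓝 u, ∀ z ∈ Metric.closedBall (0 : ℂ) 1,
      |h (diskExt u.toFun z) - h (diskExt v.toFun z)| < ε := by
  have hc : Continuous (fun u : HolDisk J e => UniformFun.ofFun fun z : Disk =>
      iteratedFDerivWithin ℝ 0 (h ∘ diskExt u.toFun) (Metric.closedBall 0 1) (z : ℂ)) := by
    refine continuous_iff_le_induced.2 ?_
    exact (iInf_le _ h).trans (iInf_le _ 0)
  have := UniformFun.tendsto_iff_tendstoUniformly.1 (hc.tendsto u)
  filter_upwards [Metric.tendstoUniformly_iff.1 this ε hε] with v hv z hz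
  refine lt_of_le_of_lt ?_ (hv ⟨z, hz⟩)
  rw [dist_eq_norm]
  refine le_trans (le_of_eq ?_) (((iteratedFDerivWithin ℝ 0 (h ∘ diskExt u.toFun)
    (Metric.closedBall 0 1) z - iteratedFDerivWithin ℝ 0 (h ∘ diskExt v.toFun)
    (Metric.closedBall 0 1) z).le_opNorm fun _ => 0).trans_eq ?_)
  · rw [_root_.sub_apply, iteratedFDerivWithin_zero_apply,
      iteratedFDerivWithin_zero_apply]
    rfl
  · simp [UniformFun.toFun, UniformFun.ofFun]

/-- Test with a bump function `f` supported in the given neighborhood and equal to `1` at `u z`.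
Near `z` it exceeds `1/2` along `u`, and it differs by less than `1/2` along a nearby disk, so it is
positive there and the nearby disk stays in the neighborhood. -/
theorem HolDisk.tendstoOnDisk_nhds [T2Space W] (u : HolDisk J e) :
    TendstoOnDisk (𝓝 u) (fun v : HolDisk J e => diskExt v.toFun) (diskExt u.toFun) := by
  intro z hz U hU
  obtain ⟨f, -, hf⟩ := (SmoothBumpFunction.nhds_basis_support (I := 𝓡∂ (2 * k + 4)) hU).mem_iff.1 hU
  have h1 := u.eventually_abs_sub_lt ⟨f, f.contMDiff⟩ (ε := 1 / 2) (by norm_num)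
  have h2 : ∀ᶠ w in 𝓝[Metric.closedBall 0 1] z, 1 / 2 < f (diskExt u.toFun w) := by
    have hc : ContinuousWithinAt (fun w => f (diskExt u.toFun w)) (Metric.closedBall 0 1) z :=
      f.continuous.continuousAt.comp_continuousWithinAt (u.smooth.continuousOn z hz)
    refine hc.eventually (lt_mem_nhds ?_)
    change 1 / 2 < f (diskExt u.toFun z)
    rw [f.eq_one]
    norm_num
  refine mem_map.2 (mem_of_superset (prod_mem_prod h1 (inter_mem h2 self_mem_nhdsWithin))
    fun x hx => hf ?_)
  have h3 := hx.1 x.2 hx.2.2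
  have h4 : 1 / 2 < f (diskExt u.toFun x.2) := hx.2.1
  rw [abs_lt] at h3
  have h5 : f (diskExt u.toFun x.2) - f (diskExt x.1.toFun x.2) < 1 / 2 := h3.2
  have : 0 < f (diskExt x.1.toFun x.2) := by linarith
  exact this.ne'

end Topology

/-! ## Plurisubharmonic functions along holomorphic disks -/

section Laplacian

variable {E : Type*} [NormedAddCommGroup E] [NormedSpace ℝ E]
  {H : Type*} [TopologicalSpace H] {I : ModelWithCorners ℝ E H}
  {X : Type*} [TopologicalSpace X] [ChartedSpace H X] [IsManifold I ∞ X]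
  {J : ∀ x : X, TangentSpace I x →L[ℝ] TangentSpace I x} {h : X → ℝ}

/-- Smoothness of `J` is given through the trivializations of the tangent bundle, where it reads `C
∘ J ∘ A` with `A` and `C` the derivatives of the inverse chart and of the chart. Since `A ∘ C` is
the identity, composing with `d(h ∘ φ⁻¹)` recovers `d^J h` in the chart. -/
theorem contDiffWithinAt_formInChart_dJ (hJ : IsAlmostComplex I J) (hh : ContMDiff I 𝓘(ℝ, ℝ) ∞ h)
    (x₀ : X) : ContDiffWithinAt ℝ ∞ (formInChart I (oneForm I (dJ I J h)) x₀) (range I)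
      (extChartAt I x₀ x₀) := by
  set φ := extChartAt I x₀ with hφ
  have h1 := ((contMDiffAt_hom_bundle _).1 (hJ.smooth x₀)).2
  have hsym : ContMDiffWithinAt 𝓘(ℝ, E) I ∞ φ.symm (range I) (φ x₀) :=
    contMDiffWithinAt_extChartAt_symm_range x₀ (mem_extChartAt_target x₀)
  have hinv : φ.symm (φ x₀) = x₀ := extChartAt_to_inv x₀
  have h2 := h1.comp_contMDiffWithinAt_of_eq hsym hinv
  have h3 : ContDiffWithinAt ℝ ∞ (fun y => fderivWithin ℝ (h ∘ φ.symm) (range I) y) (range I) (φ x₀) := by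
    refine ContDiffWithinAt.fderivWithin_right (m := ∞) (n := ∞) ?_ I.uniqueDiffOn (by simp) (by simp [hφ])
    exact (hh.contMDiffAt.comp_contMDiffWithinAt _ hsym).contDiffWithinAt
  have h4 : ContDiffWithinAt ℝ ∞ (fun y => ContinuousAlternatingMap.ofSubsingleton ℝ E ℝ (0 : Fin 1)
      (-((fderivWithin ℝ (h ∘ φ.symm) (range I) y).comp
        (ContinuousLinearMap.inCoordinates E (TangentSpace I) E (TangentSpace I) x₀ (φ.symm y) x₀
          (φ.symm y) (J (φ.symm y)))))) (range I) (φ x₀) :=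
    ((ContinuousAlternatingMap.ofSubsingletonLIE (𝕜 := ℝ) (E := E) (F := ℝ) (0 : Fin 1)).contDiff).contDiffAt.comp_contDiffWithinAt _
      (h3.clm_comp h2.contDiffWithinAt).neg
  refine h4.congr_of_eventuallyEq_of_mem ?_ (by simp [hφ])
  filter_upwards [extChartAt_target_mem_nhdsWithin (I := I) x₀, self_mem_nhdsWithin] with y hy hyr
  have hys : φ.symm y ∈ (chartAt H x₀).source := by
    have := φ.map_target hy
    rwa [hφ, extChartAt_source] at this
  have hyφ : φ (φ.symm y) = y := φ.right_inv hy
  set A : E →L[ℝ] E := mfderivWithin 𝓘(ℝ, E) I φ.symm (range I) y with hA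
  set C : E →L[ℝ] E := mfderiv I 𝓘(ℝ, E) φ (φ.symm y) with hC
  have hAC : A.comp C = ContinuousLinearMap.id ℝ E :=
    mfderivWithin_extChartAt_symm_comp_mfderiv_extChartAt hy
  have eC : ((trivializationAt E (TangentSpace I) x₀).continuousLinearMapAt ℝ (φ.symm y) : E →L[ℝ] E) = C :=
    TangentBundle.continuousLinearMapAt_trivializationAt hys
  have eA : ((trivializationAt E (TangentSpace I) x₀).symmL ℝ (φ.symm y) : E →L[ℝ] E) = A := by
    have := TangentBundle.symmL_trivializationAt (I := I) hys
    refine this.trans ?_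
    change (mfderivWithin 𝓘(ℝ, E) I φ.symm (range I) (φ (φ.symm y)) : E →L[ℝ] E) = _
    rw [hyφ]
  have eD : fderivWithin ℝ (h ∘ φ.symm) (range I) y =
      (mfderiv I 𝓘(ℝ, ℝ) h (φ.symm y) : E →L[ℝ] ℝ).comp A := by
    rw [← mfderivWithin_eq_fderivWithin]
    exact mfderiv_comp_mfderivWithin y (hh.mdifferentiable (by simp) _)
      (mdifferentiableWithinAt_extChartAt_symm hy)
      (I.uniqueDiffOn y hyr).uniqueMDiffWithinAt
  have eI : ContinuousLinearMap.inCoordinates E (TangentSpace I) E (TangentSpace I) x₀ (φ.symm y) x₀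
      (φ.symm y) (J (φ.symm y)) = C.comp ((J (φ.symm y) : E →L[ℝ] E).comp A) := by
    rw [← eC, ← eA]
    rfl
  rw [eI, eD]
  ext v
  change -((mfderiv I 𝓘(ℝ, ℝ) h (φ.symm y) : E →L[ℝ] ℝ) ((J (φ.symm y) : E →L[ℝ] E) (A (v 0)))) =
    -((mfderiv I 𝓘(ℝ, ℝ) h (φ.symm y) : E →L[ℝ] ℝ) ((A.comp C) ((J (φ.symm y) : E →L[ℝ] E) (A (v 0)))))
  rw [hAC]
  rfl

/-- The Laplacian of a function along a holomorphic curve. -/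
theorem lap_comp_eq (hJ : IsAlmostComplex I J) (hh : ContMDiff I 𝓘(ℝ, ℝ) ∞ h) {v : ℂ → X}
    {U : Set ℂ} (hU : IsOpen U) (hv : ContMDiffOn 𝓘(ℝ, ℂ) I ∞ v U)
    (hol : ∀ z ∈ U, ∀ w : ℂ, mfderiv 𝓘(ℝ, ℂ) I v z (Complex.I * w) =
      J (v z) (mfderiv 𝓘(ℝ, ℂ) I v z w)) {z : ℂ} (hz : z ∈ U) :
    lap (fun w => h (v w)) z = dForm I (oneForm I (dJ I J h)) (v z)
      ![mfderiv 𝓘(ℝ, ℂ) I v z (1 : ℂ), J (v z) (mfderiv 𝓘(ℝ, ℂ) I v z (1 : ℂ))] := by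
  set g : ℂ → ℝ := fun w => h (v w) with hg
  have hgd : ContDiffOn ℝ ∞ g U := (hh.comp_contMDiffOn hv).contDiffOn
  have hgz : ContDiffAt ℝ ∞ g z := hgd.contDiffAt (hU.mem_nhds hz)
  have key := extDerivWithin_pullForm hv hU.uniqueDiffOn hz
    ((contDiffWithinAt_formInChart_dJ hJ hh (v z)).differentiableWithinAt (by simp))
    (by rw [hU.interior_eq]; exact subset_closure hz)
  -- Holomorphy of `v` makes the pullback of `d^J h` equal to `-d(h ∘ v) ∘ i`, whose exterior
  -- derivative on `(1, i)` is the Laplacian.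
  set η : ℂ → ℂ [⋀^Fin 1]→L[ℝ] ℝ := fun p => ContinuousAlternatingMap.ofSubsingleton ℝ ℂ ℝ (0 : Fin 1)
    (-((fderiv ℝ g p).comp (Complex.I • ContinuousLinearMap.id ℝ ℂ))) with hη
  have hmU : ∀ p ∈ U, mfderivWithin 𝓘(ℝ, ℂ) I v U p = mfderiv 𝓘(ℝ, ℂ) I v p := fun p hp =>
    mfderivWithin_of_isOpen hU hp
  have hpull : ∀ p ∈ U, pullForm I (oneForm I (dJ I J h)) v U p = η p := fun p hp => by
    have hd : fderiv ℝ g p = (mfderiv I 𝓘(ℝ, ℝ) h (v p) : E →L[ℝ] ℝ).comp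
        (mfderiv 𝓘(ℝ, ℂ) I v p : ℂ →L[ℝ] E) := by
      rw [← mfderiv_eq_fderiv]
      exact mfderiv_comp p (hh.mdifferentiable (by simp) _)
        ((hv.contMDiffAt (hU.mem_nhds hp)).mdifferentiableAt (by simp))
    ext w
    change -((mfderiv I 𝓘(ℝ, ℝ) h (v p) : E →L[ℝ] ℝ) ((J (v p) : E →L[ℝ] E)
      ((mfderivWithin 𝓘(ℝ, ℂ) I v U p : ℂ →L[ℝ] E) (w 0)))) =
      -(fderiv ℝ g p (Complex.I * w 0))
    rw [hd, hmU p hp]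
    have := hol p hp (w 0)
    exact congrArg (fun y : E => -((mfderiv I 𝓘(ℝ, ℝ) h (v p) : E →L[ℝ] ℝ) y)) this.symm
  have hηd : DifferentiableAt ℝ η z := by
    have h1 : DifferentiableAt ℝ (fderiv ℝ g) z :=
      (hgz.fderiv_right (m := 1) (WithTop.coe_le_coe.2 le_top)).differentiableAt (by simp)
    have h2 : DifferentiableAt ℝ
        (fun p => -((fderiv ℝ g p).comp (Complex.I • ContinuousLinearMap.id ℝ ℂ))) z :=
      (h1.clm_comp (differentiableAt_const _)).fun_neg
    exact (ContinuousAlternatingMap.ofSubsingletonLIE (𝕜 := ℝ) (E := ℂ) (F := ℝ)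
      (0 : Fin 1)).differentiableAt.comp z h2
  rw [extDerivWithin_congr hpull (hpull z hz)] at key
  have k2 : extDerivWithin η U z ![1, Complex.I] =
      pullForm I (dForm I (oneForm I (dJ I J h))) v U z ![1, Complex.I] :=
    congrArg (fun τ : ℂ [⋀^Fin 2]→L[ℝ] ℝ => τ ![1, Complex.I]) key
  rw [extDerivWithin_apply hηd.differentiableWithinAt (hU.uniqueDiffOn z hz), Fin.sum_univ_two,
    fderivWithin_of_isOpen hU hz, fderivWithin_of_isOpen hU hz] at k2
  have e0 : (fun p => η p ((0 : Fin 2).removeNth ![(1 : ℂ), Complex.I])) = fun p => fderiv ℝ g p 1 := by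
    funext p
    change -(fderiv ℝ g p (Complex.I * Complex.I)) = _
    rw [Complex.I_mul_I, map_neg, neg_neg]
  have e1 : (fun p => η p ((1 : Fin 2).removeNth ![(1 : ℂ), Complex.I])) =
      fun p => -fderiv ℝ g p Complex.I := by
    funext p
    change -(fderiv ℝ g p (Complex.I * 1)) = _
    rw [mul_one]
  rw [e0, e1, fderiv_fun_neg] at k2
  simp only [Fin.val_zero, pow_zero, one_smul, Fin.val_one, pow_one, neg_smul,
    Matrix.cons_val_zero, Matrix.cons_val_one, _root_.neg_apply, neg_neg] at k2
  have k3 : lap g z = pullForm I (dForm I (oneForm I (dJ I J h))) v U z ![1, Complex.I] := by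
    refine Eq.trans ?_ k2
    rfl
  rw [k3]
  have hI := hol z hz 1
  rw [mul_one] at hI
  have : (fun i => (mfderivWithin 𝓘(ℝ, ℂ) I v U z : ℂ →L[ℝ] E) (![(1 : ℂ), Complex.I] i)) =
      ![(mfderiv 𝓘(ℝ, ℂ) I v z : ℂ →L[ℝ] E) (1 : ℂ),
        (J (v z) : E →L[ℝ] E) ((mfderiv 𝓘(ℝ, ℂ) I v z : ℂ →L[ℝ] E) (1 : ℂ))] := by
    rw [hmU z hz]
    funext i
    fin_cases i
    exacts [rfl, hI]
  exact congrArg (fun y : Fin 2 → E => (dForm I (oneForm I (dJ I J h)) (v z) : E [⋀^Fin 2]→L[ℝ] ℝ) y) this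

end Laplacian

/-! ## Holomorphic disks touch a convex boundary transversely -/

theorem le_of_forall_le_of_hasDerivWithinAt {φ : ℝ → ℝ} {c ε : ℝ}
    (hd : HasDerivWithinAt φ c (Icc 0 (1 / 2)) 0) (h0 : φ 0 = 0)
    (hle : ∀ s ∈ Icc (0 : ℝ) (1 / 2), φ s ≤ -ε * s) : c ≤ -ε := by
  have h1 : HasDerivWithinAt φ c (Ioc 0 (1 / 2)) 0 := hd.mono Ioc_subset_Icc_self
  have h2 := (hasDerivWithinAt_iff_tendsto_slope' (by simp)).1 h1
  rw [nhdsWithin_Ioc_eq_nhdsGT (by norm_num)] at h2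
  refine le_of_tendsto h2 ?_
  filter_upwards [Ioc_mem_nhdsGT (show (0 : ℝ) < 1 / 2 by norm_num)] with s hs
  rw [slope_def_field, h0, sub_zero, sub_zero, div_le_iff₀ hs.1]
  exact hle s ⟨hs.1.le, hs.2⟩

/-- Otherwise the interior of `t` and the complement of its closure would separate `s`. -/
theorem inter_frontier_nonempty {A : Type*} [TopologicalSpace A] {s t : Set A}
    (hs : IsPreconnected s) (h : (s ∩ t).Nonempty) (h' : (s ∩ tᶜ).Nonempty) :
    (s ∩ frontier t).Nonempty := by
  by_contra hne
  have hf : ∀ x ∈ s, x ∉ frontier t := fun x hx hxf => hne ⟨x, hx, hxf⟩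
  have hcov : ∀ x ∈ s, x ∈ closure t → x ∈ interior t := fun x hx hc => by
    by_contra hi
    exact hf x hx ⟨hc, hi⟩
  obtain ⟨x, hx, hxt⟩ := h
  obtain ⟨y, hy, hyt⟩ := h'
  obtain ⟨q, -, hq, hq'⟩ := hs (interior t) (closure t)ᶜ isOpen_interior isClosed_closure.isOpen_compl
    (fun w hw => (em (w ∈ closure t)).imp (hcov w hw) id) ⟨x, hx, hcov x hx (subset_closure hxt)⟩
    ⟨y, hy, fun hc => hyt (interior_subset (hcov y hy hc))⟩
  exact hq' (subset_closure (interior_subset hq))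

section Transversality

variable {E : Type*} [NormedAddCommGroup E] [NormedSpace ℝ E]
  {H : Type*} [TopologicalSpace H] {I : ModelWithCorners ℝ E H}
  {X : Type*} [TopologicalSpace X] [ChartedSpace H X] [IsManifold I ∞ X]
  {J : ∀ x : X, TangentSpace I x →L[ℝ] TangentSpace I x} {h : X → ℝ}

/-- A bump function separating `v z` from `v 0` would have zero derivative along `v` on the open
disk, hence be constant on the closed disk. Testing with functions avoids covering the image of `v`
by charts. -/
theorem eq_of_mfderiv_eq_zero [FiniteDimensional ℝ E] [T2Space X] {v : ℂ → X}
    (hv : ContMDiffOn 𝓘(ℝ, ℂ) I ∞ v (Metric.closedBall 0 1))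
    (h0 : ∀ z ∈ Metric.ball (0 : ℂ) 1, ∀ w : ℂ, mfderiv 𝓘(ℝ, ℂ) I v z w = 0) :
    ∀ z ∈ Metric.closedBall (0 : ℂ) 1, v z = v 0 := by
  intro z hz
  by_contra hne
  obtain ⟨f, -, hf⟩ := (SmoothBumpFunction.nhds_basis_support (I := I)
    (isOpen_compl_singleton.mem_nhds hne)).mem_iff.1 (isOpen_compl_singleton.mem_nhds hne)
  have hfz : f (v z) = 1 := f.eq_one
  have hf0 : f (v 0) = 0 := by
    by_contra hs
    exact hf hs rfl
  have hc : ContMDiffOn 𝓘(ℝ, ℂ) 𝓘(ℝ, ℝ) ∞ (fun w => f (v w)) (Metric.closedBall 0 1) :=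
    f.contMDiff.comp_contMDiffOn hv
  have hd : EqOn (fderiv ℝ fun w => f (v w)) 0 (Metric.ball 0 1) := fun w hw => by
    have hvw : MDifferentiableAt 𝓘(ℝ, ℂ) I v w :=
      (hv.contMDiffAt (mem_of_superset (Metric.isOpen_ball.mem_nhds hw)
        Metric.ball_subset_closedBall)).mdifferentiableAt (by simp)
    have h1 : fderiv ℝ (fun w => f (v w)) w = (mfderiv I 𝓘(ℝ, ℝ) f (v w) : E →L[ℝ] ℝ).comp
        (mfderiv 𝓘(ℝ, ℂ) I v w : ℂ →L[ℝ] E) := by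
      rw [← mfderiv_eq_fderiv]
      exact mfderiv_comp w (f.contMDiff.mdifferentiable (by simp) _) hvw
    have h2 : (mfderiv 𝓘(ℝ, ℂ) I v w : ℂ →L[ℝ] E) = 0 := ContinuousLinearMap.ext (h0 w hw)
    rw [h1, h2, ContinuousLinearMap.comp_zero]
    rfl
  have hdiff : DifferentiableOn ℝ (fun w => f (v w)) (Metric.ball 0 1) :=
    (hc.contDiffOn.mono Metric.ball_subset_closedBall).differentiableOn (by simp)
  have hconst : EqOn (fun w => f (v w)) (fun _ => f (v 0)) (Metric.ball 0 1) := fun w hw =>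
    Metric.isOpen_ball.is_const_of_fderiv_eq_zero (convex_ball _ _).isPreconnected hdiff hd hw
      (Metric.mem_ball_self one_pos)
  have := hconst.of_subset_closure hc.continuousOn continuousOn_const
    Metric.ball_subset_closedBall (by rw [closure_ball _ one_ne_zero]) hz
  simp only [hfz, hf0] at this
  exact one_ne_zero this

variable (I J) in
/-- A holomorphic map from the closed unit disk that is smooth up to the boundary. -/
structure IsHolCurve (v : ℂ → X) : Prop where
  smooth : ContMDiffOn 𝓘(ℝ, ℂ) I ∞ v (Metric.closedBall 0 1)
  holomorphic : ∀ z ∈ Metric.ball (0 : ℂ) 1, ∀ w : ℂ, mfderiv 𝓘(ℝ, ℂ) I v z (Complex.I * w) =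
    J (v z) (mfderiv 𝓘(ℝ, ℂ) I v z w)

omit [IsManifold I ∞ X] in
theorem IsHolCurve.mfderiv_eq_zero {v : ℂ → X} (hv : IsHolCurve I J v) {z : ℂ}
    (hz : z ∈ Metric.ball (0 : ℂ) 1) (h1 : mfderiv 𝓘(ℝ, ℂ) I v z (1 : ℂ) = 0) (w : ℂ) :
    mfderiv 𝓘(ℝ, ℂ) I v z w = 0 := by
  have hI : (mfderiv 𝓘(ℝ, ℂ) I v z : ℂ →L[ℝ] E) Complex.I = 0 := by
    have := hv.holomorphic z hz 1
    rw [mul_one] at this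
    refine Eq.trans this ?_
    rw [h1]
    exact map_zero _
  have hw : w = w.re • (1 : ℂ) + w.im • Complex.I := by
    rw [Complex.real_smul, Complex.real_smul, mul_one, Complex.re_add_im]
  have key : ∀ A : ℂ →L[ℝ] E, A 1 = 0 → A Complex.I = 0 → A w = 0 := fun A hA hAI => by
    rw [hw, map_add, map_smul, map_smul, hA, hAI, smul_zero, smul_zero, add_zero]
  exact key _ h1 hI

variable {V : Set X} {v : ℂ → X}

theorem IsHolCurve.lap_eq (hv : IsHolCurve I J v) (hJ : IsAlmostComplex I J)
    (hh : ContMDiff I 𝓘(ℝ, ℝ) ∞ h) {z : ℂ} (hz : z ∈ Metric.ball (0 : ℂ) 1) :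
    lap (fun w => h (v w)) z = dForm I (oneForm I (dJ I J h)) (v z)
      ![mfderiv 𝓘(ℝ, ℂ) I v z (1 : ℂ), J (v z) (mfderiv 𝓘(ℝ, ℂ) I v z (1 : ℂ))] :=
  lap_comp_eq hJ hh Metric.isOpen_ball (hv.smooth.mono Metric.ball_subset_closedBall)
    hv.holomorphic hz

theorem IsHolCurve.lap_nonneg (hv : IsHolCurve I J v) (hJ : IsAlmostComplex I J)
    (hh : ContMDiff I 𝓘(ℝ, ℝ) ∞ h) {z : ℂ} (hz : z ∈ Metric.ball (0 : ℂ) 1)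
    (hV : PshAt I J h (v z)) : 0 ≤ lap (fun w => h (v w)) z := by
  rw [hv.lap_eq hJ hh hz]
  by_cases h1 : mfderiv 𝓘(ℝ, ℂ) I v z (1 : ℂ) = 0
  · refine le_of_eq (Eq.symm ?_)
    exact ContinuousAlternatingMap.map_coord_zero _ 0 h1
  · exact (hV _ h1).le

/-- This is the strong maximum principle, with plurisubharmonicity available only near the zeros of
`h`. If `h ∘ v` vanishes on the whole open disk, its Laplacian is zero, strict positivity on complex
lines kills the derivative of `v`, and `v` is constant. Otherwise the zero set has a frontier point
inside the disk, and Hopf's lemma is contradicted near it. -/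
theorem IsHolCurve.neg_of_mem_ball [FiniteDimensional ℝ E] [T2Space X]
    (hv : IsHolCurve I J v) (hJ : IsAlmostComplex I J)
    (hh : ContMDiff I 𝓘(ℝ, ℝ) ∞ h) (hle : ∀ x, h x ≤ 0) (hVo : IsOpen V)
    (hV : ∀ x ∈ V, PshAt I J h x) (h0V : ∀ x, h x = 0 → x ∈ V)
    (hnc : ∃ z ∈ Metric.closedBall (0 : ℂ) 1, v z ≠ v 0) {z : ℂ} (hz : z ∈ Metric.ball (0 : ℂ) 1) :
    h (v z) < 0 := by
  set g : ℂ → ℝ := fun w => h (v w) with hg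
  have hgd : ContDiffOn ℝ ∞ g (Metric.closedBall 0 1) := (hh.comp_contMDiffOn hv.smooth).contDiffOn
  have hgat : ∀ w ∈ Metric.ball (0 : ℂ) 1, ContDiffAt ℝ ∞ g w := fun w hw =>
    hgd.contDiffAt (mem_of_superset (Metric.isOpen_ball.mem_nhds hw) Metric.ball_subset_closedBall)
  refine (hle _).lt_of_ne fun hgz => ?_
  set Z : Set ℂ := {w | w ∈ Metric.ball (0 : ℂ) 1 ∧ g w = 0} with hZ
  by_cases hall : ∀ w ∈ Metric.ball (0 : ℂ) 1, g w = 0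
  · obtain ⟨y, hy, hyne⟩ := hnc
    refine hyne (eq_of_mfderiv_eq_zero hv.smooth (fun w hw => ?_) y hy)
    refine hv.mfderiv_eq_zero hw ?_
    by_contra h1
    have hpos := hV (v w) (h0V _ (hall w hw)) _ h1
    rw [← hv.lap_eq hJ hh hw] at hpos
    have hloc : ∀ p ∈ Metric.ball (0 : ℂ) 1, fderiv ℝ g p = 0 := fun p hp => by
      have : g =ᶠ[𝓝 p] fun _ => 0 := by
        filter_upwards [Metric.isOpen_ball.mem_nhds hp] with q hq using hall q hq
      rw [this.fderiv_eq, fderiv_fun_const]; rfl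
    have h2 : ∀ y : ℂ, fderiv ℝ (fun p => fderiv ℝ g p y) w = 0 := fun y => by
      have : (fun p => fderiv ℝ g p y) =ᶠ[𝓝 w] fun _ => 0 := by
        filter_upwards [Metric.isOpen_ball.mem_nhds hw] with q hq
        rw [hloc q hq]; rfl
      rw [this.fderiv_eq, fderiv_fun_const]; rfl
    have : lap g w = 0 := by rw [lap, h2, h2]; simp
    exact hpos.ne' this
  push Not at hall
  obtain ⟨y, hy, hgy⟩ := hall
  obtain ⟨p, hp, hpf⟩ := inter_frontier_nonempty
    (convex_ball (0 : ℂ) 1).isPreconnected (t := Z) ⟨z, hz, hz, hgz⟩ ⟨y, hy, fun h => hgy h.2⟩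
  have hclos : ∀ q ∈ Metric.ball (0 : ℂ) 1, q ∈ closure Z → g q = 0 := fun q hq hqc => by
    have hc := (hgat q hq).continuousAt
    have := hc.continuousWithinAt (s := Z) |>.mem_closure hqc (t := {0}) fun w hw => hw.2
    simpa using this
  have hgp : g p = 0 := hclos p hp hpf.1
  have hvc : ContinuousAt v p := (hv.smooth.continuousOn).continuousAt
    (mem_of_superset (Metric.isOpen_ball.mem_nhds hp) Metric.ball_subset_closedBall)
  obtain ⟨r, hr, hrU⟩ := Metric.eventually_nhds_iff_ball.1
    ((hvc.eventually_mem (hVo.mem_nhds (h0V _ hgp))).and (Metric.isOpen_ball.mem_nhds hp))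
  obtain ⟨w, hwr, hwZ⟩ : ∃ w ∈ Metric.ball p (r / 4), w ∉ Z := by
    have h1 : p ∈ closure Zᶜ := by
      rw [closure_compl]; exact hpf.2
    obtain ⟨w, hw, hd⟩ := Metric.mem_closure_iff.1 h1 (r / 4) (by positivity)
    exact ⟨w, by rwa [Metric.mem_ball, dist_comm], hw⟩
  -- Grow a disk around the nonzero point `w` until it first meets the zero set, at `z₀`. Because
  -- `w` is within `r/4` of `p`, this disk stays in the closed ball of radius `r/2`, where the
  -- subharmonicity is known.
  set Z' : Set ℂ := {q | q ∈ Metric.closedBall p (r / 2) ∧ g q = 0} with hZ'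
  have hsub : Metric.closedBall p (r / 2) ⊆ Metric.ball p r :=
    Metric.closedBall_subset_ball (by linarith)
  have hgcont : ContinuousOn g (Metric.closedBall p (r / 2)) := fun q hq =>
    (hgat q (hrU q (hsub hq)).2).continuousAt.continuousWithinAt
  have hZ'c : IsCompact Z' := by
    have := hgcont.preimage_isClosed_of_isClosed Metric.isClosed_closedBall (isClosed_singleton (x := 0))
    exact (isCompact_closedBall p (r / 2)).of_isClosed_subset this fun q hq => hq.1
  obtain ⟨z₀, hz₀, hmin⟩ := hZ'c.exists_infDist_eq_dist
    ⟨p, Metric.mem_closedBall_self (by positivity), hgp⟩ w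
  have hρle : dist w z₀ ≤ dist w p := by
    rw [← hmin]
    exact Metric.infDist_le_dist_of_mem ⟨Metric.mem_closedBall_self (by positivity), hgp⟩
  rw [Metric.mem_ball] at hwr
  have hwU : w ∈ Metric.ball p r := by rw [Metric.mem_ball]; linarith
  have hgw : g w ≠ 0 := fun h => hwZ ⟨(hrU w hwU).2, h⟩
  have hρ : 0 < dist w z₀ := dist_pos.2 fun h => hgw (h ▸ hz₀.2)
  have hb : Metric.closedBall w (dist w z₀) ⊆ Metric.closedBall p (r / 2) := fun q hq => by
    rw [Metric.mem_closedBall] at hq ⊢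
    linarith [dist_triangle q w p]
  obtain ⟨ε, hε, hH⟩ := hopf_lemma (g := g) (c := w) (z₀ := z₀) hρ
    (by rw [dist_comm, dist_eq_norm]) (hgcont.mono hb)
    (fun q hq => (hgat q (hrU q (hsub (hb (Metric.ball_subset_closedBall hq)))).2).of_le
      (WithTop.coe_le_coe.2 le_top))
    (fun q hq => by
      have := hrU q (hsub (hb (Metric.ball_subset_closedBall hq)))
      exact hv.lap_nonneg hJ hh this.2 (hV _ this.1))
    (fun q hq => (hle _).lt_of_ne fun h => by
      have : q ∈ Z' := ⟨hb (Metric.ball_subset_closedBall hq), h⟩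
      have h2 := Metric.infDist_le_dist_of_mem (x := w) this
      rw [hmin, dist_comm w q] at h2
      exact absurd hq (not_lt.2 h2))
    (fun q _ => hle _)
  have hz₀b := (hrU z₀ (hsub hz₀.1)).2
  -- The touching point is interior and a global maximum of `g`, so the derivative vanishes, against
  -- the linear decay from Hopf's lemma.
  have hfd : fderiv ℝ g z₀ = 0 := IsLocalMax.fderiv_eq_zero (.of_forall fun q => by
    rw [hz₀.2]; exact hle _)
  have hder : HasDerivAt (fun s : ℝ => g (z₀ - s * (z₀ - w))) 0 0 := by
    have h1 : HasDerivAt (fun s : ℝ => z₀ - s * (z₀ - w)) (-(z₀ - w)) 0 := by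
      simpa using ((Complex.ofRealCLM.hasDerivAt (x := 0)).mul_const (z₀ - w)).const_sub z₀
    have h2 : HasFDerivAt g (fderiv ℝ g z₀) (z₀ - (0 : ℝ) * (z₀ - w)) := by
      simpa using ((hgat z₀ hz₀b).differentiableAt (by simp)).hasFDerivAt
    have := h2.comp_hasDerivAt (0 : ℝ) h1
    rw [hfd] at this
    exact this
  have := le_of_forall_le_of_hasDerivWithinAt hder.hasDerivWithinAt
    (by simpa using hz₀.2) hH
  linarith

/-- Apply Hopf's lemma to a small disk tangent to the unit circle at `z₀` from inside, on which `h ∘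
v` is subharmonic and negative. -/
theorem IsHolCurve.radial_deriv_pos [FiniteDimensional ℝ E] [T2Space X]
    (hv : IsHolCurve I J v) (hJ : IsAlmostComplex I J)
    (hh : ContMDiff I 𝓘(ℝ, ℝ) ∞ h) (hle : ∀ x, h x ≤ 0) (hVo : IsOpen V)
    (hV : ∀ x ∈ V, PshAt I J h x) (h0V : ∀ x, h x = 0 → x ∈ V)
    (hnc : ∃ z ∈ Metric.closedBall (0 : ℂ) 1, v z ≠ v 0) {z₀ : ℂ} (hz₀ : ‖z₀‖ = 1)
    (h0 : h (v z₀) = 0) :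
    0 < fderivWithin ℝ (fun w => h (v w)) (Metric.closedBall 0 1) z₀ z₀ := by
  set g : ℂ → ℝ := fun w => h (v w) with hg
  have hgd : ContDiffOn ℝ ∞ g (Metric.closedBall 0 1) := (hh.comp_contMDiffOn hv.smooth).contDiffOn
  have hz₀D : z₀ ∈ Metric.closedBall (0 : ℂ) 1 := mem_closedBall_zero_iff.2 hz₀.le
  obtain ⟨r, hr, hrU⟩ := Metric.mem_nhdsWithin_iff.1
    ((hv.smooth.continuousOn z₀ hz₀D).preimage_mem_nhdsWithin (hVo.mem_nhds (h0V _ h0)))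
  -- With center `(1 - ρ) z₀` the disk of radius `ρ` lies in the unit disk and within `2ρ < r` of
  -- `z₀`, so `v` maps it into `V`.
  set ρ : ℝ := min (1 / 2) (r / 4) with hρ
  have hρ0 : 0 < ρ := by positivity
  have hρ1 : ρ ≤ 1 / 2 := min_le_left _ _
  have hρr : ρ ≤ r / 4 := min_le_right _ _
  set c : ℂ := ((1 - ρ : ℝ) : ℂ) * z₀ with hc
  have hcn : ‖c‖ = 1 - ρ := by
    rw [hc, norm_mul, hz₀, mul_one, Complex.norm_real, Real.norm_of_nonneg (by linarith)]
  have hzc : z₀ - c = (ρ : ℂ) * z₀ := by rw [hc]; push_cast; ring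
  have hzcn : ‖z₀ - c‖ = ρ := by
    rw [hzc, norm_mul, hz₀, mul_one, Complex.norm_real, Real.norm_of_nonneg hρ0.le]
  have hsubD : Metric.closedBall c ρ ⊆ Metric.closedBall 0 1 := fun q hq => by
    rw [mem_closedBall_zero_iff]
    rw [Metric.mem_closedBall, dist_eq_norm] at hq
    have : ‖q‖ ≤ ‖q - c‖ + ‖c‖ := norm_le_norm_sub_add q c
    linarith
  have hsubb : Metric.ball c ρ ⊆ Metric.ball 0 1 := fun q hq => by
    rw [mem_ball_zero_iff]
    rw [Metric.mem_ball, dist_eq_norm] at hq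
    have : ‖q‖ ≤ ‖q - c‖ + ‖c‖ := norm_le_norm_sub_add q c
    linarith
  have hballV : ∀ q ∈ Metric.ball c ρ, v q ∈ V := fun q hq => by
    refine hrU ⟨?_, hsubD (Metric.ball_subset_closedBall hq)⟩
    rw [Metric.mem_ball, dist_eq_norm] at hq ⊢
    have : ‖q - z₀‖ ≤ ‖q - c‖ + ‖c - z₀‖ := norm_sub_le_norm_sub_add_norm_sub q c z₀
    rw [norm_sub_rev c z₀, hzcn] at this
    linarith
  obtain ⟨ε, hε, hH⟩ := hopf_lemma (g := g) (c := c) (z₀ := z₀) hρ0 hzcn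
    (hgd.continuousOn.mono hsubD)
    (fun q hq => (hgd.contDiffAt (mem_of_superset (Metric.isOpen_ball.mem_nhds (hsubb hq))
      Metric.ball_subset_closedBall)).of_le (WithTop.coe_le_coe.2 le_top))
    (fun q hq => hv.lap_nonneg hJ hh (hsubb hq) (hV _ (hballV q hq)))
    (fun q hq => hv.neg_of_mem_ball hJ hh hle hVo hV h0V hnc (hsubb hq))
    (fun q _ => hle _)
  have h1 : HasDerivWithinAt (fun s : ℝ => z₀ - s * (z₀ - c)) (-(z₀ - c)) (Icc 0 (1 / 2)) 0 := by
    have : HasDerivAt (fun s : ℝ => z₀ - s * (z₀ - c)) (-(z₀ - c)) 0 := by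
      simpa using ((Complex.ofRealCLM.hasDerivAt (x := 0)).mul_const (z₀ - c)).const_sub z₀
    exact this.hasDerivWithinAt
  have h2 : HasFDerivWithinAt g (fderivWithin ℝ g (Metric.closedBall 0 1) z₀)
      (Metric.closedBall 0 1) (z₀ - (0 : ℝ) * (z₀ - c)) := by
    have := ((hgd z₀ hz₀D).differentiableWithinAt (by simp)).hasFDerivWithinAt
    simpa using this
  have h3 := h2.comp_hasDerivWithinAt (0 : ℝ) h1 fun s hs => by
    rw [hzc, mem_closedBall_zero_iff, show z₀ - (s : ℂ) * ((ρ : ℂ) * z₀) = ((1 - s * ρ : ℝ) : ℂ) * z₀ by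
      push_cast; ring, norm_mul, hz₀, mul_one, Complex.norm_real, Real.norm_eq_abs, abs_le]
    have := mul_nonneg hs.1 hρ0.le
    have := mul_le_mul hs.2 hρ1 hρ0.le (by norm_num)
    constructor <;> linarith
  have h4 := le_of_forall_le_of_hasDerivWithinAt h3 (by simpa using h0) hH
  rw [map_neg, hzc, ← Complex.real_smul, map_smul, smul_eq_mul] at h4
  have : 0 < ρ * fderivWithin ℝ g (Metric.closedBall 0 1) z₀ z₀ := by linarith
  exact pos_of_mul_pos_right this hρ0.le

end Transversality

theorem uniqueDiffOn_unitDisk : UniqueDiffOn ℝ (Metric.closedBall (0 : ℂ) 1) :=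
  uniqueDiffOn_convex (convex_closedBall 0 1) ⟨0, by
    rw [interior_closedBall _ one_ne_zero]; exact Metric.mem_ball_self one_pos⟩

/-! ### Boundary loops of holomorphic disks are transverse to the contact structure -/

section Boundary

variable {k : ℕ}
  {W : Type*} [TopologicalSpace W] [ChartedSpace (EuclideanHalfSpace (2 * k + 4)) W]
  {M : Type*} [TopologicalSpace M] [ChartedSpace (Eu (2 * k + 3)) M]
  {N : Type*} [TopologicalSpace N] [ChartedSpace (EuclideanHalfSpace (k + 2)) N]
  {Ω : ∀ x : W, TangentSpace (𝓡∂ (2 * k + 4)) x [⋀^Fin 2]→L[ℝ] ℝ}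
  {ι : M → W} {α : ∀ p : M, TangentSpace (𝓡 (2 * k + 3)) p →L[ℝ] ℝ} {j : N → M}
  {J : ∀ x : W, TangentSpace (𝓡∂ (2 * k + 4)) x →L[ℝ] TangentSpace (𝓡∂ (2 * k + 4)) x}

omit [TopologicalSpace N] [ChartedSpace (EuclideanHalfSpace (k + 2)) N] in
theorem HolDisk.isHolCurve {e : N → W} (u : HolDisk J e) :
    IsHolCurve (𝓡∂ (2 * k + 4)) J (diskExt u.toFun) :=
  ⟨u.smooth, fun z hz w => by
    have h := u.holomorphic ⟨z, Metric.ball_subset_closedBall hz⟩ w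
    have hm : mfderivWithin 𝓘(ℝ, ℂ) (𝓡∂ (2 * k + 4)) (diskExt u.toFun) (Metric.closedBall 0 1) z =
        mfderiv 𝓘(ℝ, ℂ) (𝓡∂ (2 * k + 4)) (diskExt u.toFun) z :=
      mfderivWithin_of_mem_nhds (mem_of_superset (Metric.isOpen_ball.mem_nhds hz)
        Metric.ball_subset_closedBall)
    unfold diskDeriv at h
    rw [← hm]
    exact h⟩

omit [TopologicalSpace N] [ChartedSpace (EuclideanHalfSpace (k + 2)) N] in
theorem HolDisk.exists_ne {e : N → W} (u : HolDisk J e) :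
    ∃ z ∈ Metric.closedBall (0 : ℂ) 1, diskExt u.toFun z ≠ diskExt u.toFun 0 := by
  by_contra! h
  obtain ⟨z, z', hz⟩ := u.nonconstant
  rw [← diskExt_apply u.toFun, ← diskExt_apply u.toFun, h z z.2, h z' z'.2] at hz
  exact hz rfl

variable [IsManifold (𝓡∂ (2 * k + 4)) ∞ W] [T2Space W] [Nonempty N]

/-- The boundary of a holomorphic disk is transverse to the contact structure. -/
theorem HolDisk.restrictForm_boundaryLoop_ne_zero (hfill : IsWeakFilling Ω ι α)
    (hj : IsSmoothEmbedding (𝓡∂ (k + 2)) (𝓡 (2 * k + 3)) ∞ j) (hJ : IsTamedConvex Ω ι α J)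
    (u : HolDisk J (ι ∘ j)) (t : ℝ) :
    restrictForm α j (boundaryLoop (ι ∘ j) (diskExt u.toFun) t)
      (mfderiv 𝓘(ℝ, ℝ) (𝓡∂ (k + 2)) (boundaryLoop (ι ∘ j) (diskExt u.toFun)) t (1 : ℝ)) ≠ 0 := by
  obtain ⟨h, hh, hle, hbd, -, V, hVo, hVb, hV⟩ := hJ.convex
  set v := diskExt u.toFun with hv
  set z₀ := circlePt t with hz₀
  have hz₀n : ‖z₀‖ = 1 := norm_circlePt t
  have hz₀D : z₀ ∈ Metric.closedBall (0 : ℂ) 1 := circlePt_mem t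
  have hι0 : ∀ p, h (ι p) = 0 := fun p => (hbd _).2 (by rw [← hfill.range_eq]; exact mem_range_self p)
  set γ := boundaryLoop (ι ∘ j) v with hγ
  have hγe : ∀ s, ι (j (γ s)) = v (circlePt s) := apply_boundaryLoop u.isDiskMap.boundary
  have hpt : ι (j (γ t)) = v z₀ := hγe t
  have h0 : h (v z₀) = 0 := by rw [← hpt]; exact hι0 _
  have hpos := u.isHolCurve.radial_deriv_pos hJ.almostComplex hh hle hVo hV
    (fun x hx => hVb ((hbd x).1 hx)) u.exists_ne hz₀n h0
  have hγs : MDifferentiableAt 𝓘(ℝ, ℝ) (𝓡∂ (k + 2)) γ t :=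
    (u.isDiskMap.contMDiff_boundaryLoop hfill.embedding hj).mdifferentiable (by simp) t
  have hjs : MDifferentiableAt (𝓡∂ (k + 2)) (𝓡 (2 * k + 3)) j (γ t) :=
    hj.contMDiff.mdifferentiable (by simp) _
  have hιs : MDifferentiableAt (𝓡 (2 * k + 3)) (𝓡∂ (2 * k + 4)) ι (j (γ t)) :=
    hfill.embedding.contMDiff.mdifferentiable (by simp) _
  have hvs : MDifferentiableWithinAt 𝓘(ℝ, ℂ) (𝓡∂ (2 * k + 4)) v (Metric.closedBall 0 1) z₀ :=
    (u.smooth z₀ hz₀D).mdifferentiableWithinAt (by simp)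
  have hhs : MDifferentiableAt (𝓡∂ (2 * k + 4)) 𝓘(ℝ, ℝ) h (v z₀) := hh.mdifferentiable (by simp) _
  set dv : ℂ →L[ℝ] Eu (2 * k + 4) :=
    mfderivWithin 𝓘(ℝ, ℂ) (𝓡∂ (2 * k + 4)) v (Metric.closedBall 0 1) z₀ with hdv
  set dh : Eu (2 * k + 4) →L[ℝ] ℝ := mfderiv (𝓡∂ (2 * k + 4)) 𝓘(ℝ, ℝ) h (v z₀) with hdh
  set dι : Eu (2 * k + 3) →L[ℝ] Eu (2 * k + 4) :=
    mfderiv (𝓡 (2 * k + 3)) (𝓡∂ (2 * k + 4)) ι (j (γ t)) with hdι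
  set dj : Eu (k + 2) →L[ℝ] Eu (2 * k + 3) :=
    mfderiv (𝓡∂ (k + 2)) (𝓡 (2 * k + 3)) j (γ t) with hdj
  set dγ : ℝ →L[ℝ] Eu (k + 2) := mfderiv 𝓘(ℝ, ℝ) (𝓡∂ (k + 2)) γ t with hdγ
  have hUD : UniqueDiffWithinAt ℝ (Metric.closedBall (0 : ℂ) 1) z₀ :=
    uniqueDiffOn_unitDisk z₀ hz₀D
  have e1 : fderivWithin ℝ (fun w => h (v w)) (Metric.closedBall 0 1) z₀ = dh.comp dv := by
    rw [← mfderivWithin_eq_fderivWithin]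
    exact mfderiv_comp_mfderivWithin z₀ hhs hvs hUD.uniqueMDiffWithinAt
  have hcirc : HasDerivAt circlePt (Complex.I * z₀) t := by
    have := (((Complex.ofRealCLM.hasDerivAt (x := t)).mul_const Complex.I).cexp)
    convert! this using 1
    simp [hz₀, circlePt, mul_comm]
  have e2 : dι (dj (dγ 1)) = dv (Complex.I * z₀) := by
    have h1 : mfderiv 𝓘(ℝ, ℝ) (𝓡∂ (2 * k + 4)) (fun s => ι (j (γ s))) t = (dι.comp dj).comp dγ := by
      refine (mfderiv_comp t (hιs.comp _ hjs) hγs).trans ?_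
      have := mfderiv_comp (γ t) hιs hjs
      exact congrArg (fun A : Eu (k + 2) →L[ℝ] Eu (2 * k + 4) => A.comp dγ) this
    have h2 : HasMFDerivAt 𝓘(ℝ, ℝ) (𝓡∂ (2 * k + 4)) (fun s => v (circlePt s)) t
        (dv.comp (ContinuousLinearMap.toSpanSingleton ℝ (Complex.I * z₀))) := by
      have hv' : HasMFDerivWithinAt 𝓘(ℝ, ℂ) (𝓡∂ (2 * k + 4)) v (Metric.closedBall 0 1) (circlePt t) dv :=
        hvs.hasMFDerivWithinAt
      have := HasMFDerivWithinAt.comp t hv'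
        (hcirc.hasFDerivAt.hasMFDerivAt.hasMFDerivWithinAt (s := univ)) (fun s _ => show circlePt s ∈ _ from circlePt_mem s)
      exact hasMFDerivWithinAt_univ.1 this
    have h3 : (fun s => ι (j (γ s))) = fun s => v (circlePt s) := funext hγe
    have h4 : (mfderiv 𝓘(ℝ, ℝ) (𝓡∂ (2 * k + 4)) (fun s => ι (j (γ s))) t : ℝ →L[ℝ] Eu (2 * k + 4)) =
        dv.comp (ContinuousLinearMap.toSpanSingleton ℝ (Complex.I * z₀)) := by
      rw [h3]
      exact h2.mfderiv
    have h5 := congrArg (fun A : ℝ →L[ℝ] Eu (2 * k + 4) => A 1) (h1.symm.trans h4)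
    simpa using h5
  -- If `α` vanished on `γ' = dv(i z₀)`, then `J γ' = dv(-z₀)` would be tangent to the boundary of
  -- `W`. There `dh` vanishes, which contradicts the positive radial derivative.
  intro hzero
  obtain ⟨w, hw⟩ := (hJ.tangencies (j (γ t)) (dj (dγ 1))).1 hzero
  obtain ⟨J₀, hJ₀⟩ : ∃ J₀ : Eu (2 * k + 4) →L[ℝ] Eu (2 * k + 4), J₀ = J (v z₀) := ⟨_, rfl⟩
  have hJv : ∀ y : ℂ, dv (Complex.I * y) = J₀ (dv y) := by
    rw [hJ₀]
    exact
      fun y => u.holomorphic ⟨z₀, hz₀D⟩ y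
  have hJpt : (J (ι (j (γ t))) : Eu (2 * k + 4) →L[ℝ] Eu (2 * k + 4)) =
      J₀ := (congrArg (fun x : W => (show Eu (2 * k + 4) →L[ℝ] Eu (2 * k + 4) from J x)) hpt).trans
    hJ₀.symm
  have hw' : dv (-z₀) = dι w := by
    have : J₀ (dι (dj (dγ 1))) = dι w := by
      rw [← hJpt]
      exact hw
    rw [e2, ← hJv, ← mul_assoc, Complex.I_mul_I, neg_one_mul] at this
    exact this
  have hdhι : dh (dι w) = 0 := by
    have h1 : MDifferentiableAt (𝓡∂ (2 * k + 4)) 𝓘(ℝ, ℝ) h (ι (j (γ t))) :=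
      hh.mdifferentiable (by simp) _
    have h2 := mfderiv_comp (j (γ t)) h1 hιs
    have h3 : h ∘ ι = fun _ => (0 : ℝ) := funext hι0
    rw [h3, mfderiv_const] at h2
    have h4 : (mfderiv (𝓡∂ (2 * k + 4)) 𝓘(ℝ, ℝ) h (ι (j (γ t))) : Eu (2 * k + 4) →L[ℝ] ℝ) = dh :=
      congrArg (fun x : W => (show Eu (2 * k + 4) →L[ℝ] ℝ from
        mfderiv (𝓡∂ (2 * k + 4)) 𝓘(ℝ, ℝ) h x)) hpt
    rw [← h4]
    exact (congrArg (fun A : Eu (2 * k + 3) →L[ℝ] ℝ => A w) h2).symm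
  rw [e1] at hpos
  have : dh (dv z₀) = 0 := by
    rw [← hw', map_neg, map_neg, neg_eq_zero] at hdhι
    exact hdhι
  exact hpos.ne' this

theorem HolDisk.boundaryLoop_notMem_singSet (hfill : IsWeakFilling Ω ι α)
    (hj : IsSmoothEmbedding (𝓡∂ (k + 2)) (𝓡 (2 * k + 3)) ∞ j) (hJ : IsTamedConvex Ω ι α J)
    (u : HolDisk J (ι ∘ j)) (t : ℝ) :
    boundaryLoop (ι ∘ j) (diskExt u.toFun) t ∉ singSet α j := fun h =>
  u.restrictForm_boundaryLoop_ne_zero hfill hj hJ t (h _)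

end Boundary

/-! ## Local inverses of parametrizations -/

section LocalInverse

variable {E : Type*} [NormedAddCommGroup E] [NormedSpace ℝ E]
  {H : Type*} [TopologicalSpace H] {I : ModelWithCorners ℝ E H}
  {X : Type*} [TopologicalSpace X] [ChartedSpace H X] [IsManifold I ∞ X]
  {V : Type*} [NormedAddCommGroup V] [NormedSpace ℝ V] [CompleteSpace V]

omit [IsManifold I ∞ X] in
-- Apply the inverse function theorem to `T` read in the chart at `T p`. Injectivity of the chart on
-- its source turns the right inverse in the model space into a right inverse of `T`.
theorem exists_local_inverse [CompleteSpace E] {T : V → X} {p : V} (hT : ContMDiffAt 𝓘(ℝ, V) I ∞ T p)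
    (hb : Function.Bijective (mfderiv 𝓘(ℝ, V) I T p)) :
    ∃ S : X → V, ContMDiffAt I 𝓘(ℝ, V) ∞ S (T p) ∧ S (T p) = p ∧ ∀ᶠ x in 𝓝 (T p), T (S x) = x := by
  set φ := extChartAt I (T p) with hφ
  have hg : ContDiffAt ℝ ∞ (fun y => φ (T y)) p :=
    ((contMDiffAt_extChartAt (I := I) (x := T p)).comp p hT).contDiffAt
  have hd : fderiv ℝ (fun y => φ (T y)) p = (mfderiv 𝓘(ℝ, V) I T p : V →L[ℝ] E) := by
    refine Eq.symm ((hT.mdifferentiableAt (by simp)).mfderiv.trans ?_)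
    change fderivWithin ℝ (fun y => φ (T y)) (range id) p = _
    rw [range_id, fderivWithin_univ]
  set A : V ≃L[ℝ] E := ContinuousLinearEquiv.ofBijective (mfderiv 𝓘(ℝ, V) I T p : V →L[ℝ] E)
    (LinearMap.ker_eq_bot.2 hb.1) (LinearMap.range_eq_top.2 hb.2) with hA
  have hAd : HasFDerivAt (fun y => φ (T y)) (A : V →L[ℝ] E) p := by
    have h1 := (hg.differentiableAt (by simp)).hasFDerivAt
    rw [hd] at h1
    exact h1
  set G := hg.localInverse hAd (by simp) with hG
  have hGs : ContDiffAt ℝ ∞ G (φ (T p)) := hg.to_localInverse hAd (by simp)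
  have hGp : G (φ (T p)) = p := hg.localInverse_apply_image hAd (by simp)
  have hGi : ∀ᶠ y in 𝓝 (φ (T p)), φ (T (G y)) = y :=
    (hg.hasStrictFDerivAt' hAd (by simp)).eventually_right_inverse
  have hc : ContMDiffAt I 𝓘(ℝ, E) ∞ φ (T p) := contMDiffAt_extChartAt
  have hS : ContMDiffAt I 𝓘(ℝ, V) ∞ (fun x => G (φ x)) (T p) := hGs.contMDiffAt.comp (T p) hc
  refine ⟨fun x => G (φ x), hS, hGp, ?_⟩
  have h1 : Tendsto (fun x => T (G (φ x))) (𝓝 (T p)) (𝓝 (T p)) := by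
    have h2 : Tendsto (fun x => G (φ x)) (𝓝 (T p)) (𝓝 p) := by
      have := hS.continuousAt.tendsto
      rwa [hGp] at this
    exact hT.continuousAt.tendsto.comp h2
  filter_upwards [hc.continuousAt.eventually hGi, h1.eventually (extChartAt_source_mem_nhds (I := I) (T p)),
    extChartAt_source_mem_nhds (I := I) (T p)] with x h3 h4 h5
  exact φ.injOn h4 h5 h3

end LocalInverse

/-! ## The tubular neighborhood of the binding -/

section Tube

variable {k : ℕ}
  {N : Type*} [TopologicalSpace N] [ChartedSpace (EuclideanHalfSpace (k + 2)) N]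
  {L : Type*} [TopologicalSpace L] [ChartedSpace (Eu k) L] [IsManifold (𝓡 k) ∞ L]

/-- The tube map of an open book, in a chart of the binding. -/
def tubeChart (ob : OpenBook k N L) (q : L) (p : Eu k × ℂ) : N :=
  ob.tube ((extChartAt (𝓡 k) q).symm p.1, p.2)

/-- The domain of `tubeChart`. -/
def tubeDomain (q : L) : Set (Eu k × ℂ) := (extChartAt (𝓡 k) q).target ×ˢ Metric.ball 0 1

omit [IsManifold (𝓡 k) ∞ L] in
theorem isOpen_tubeDomain (q : L) : IsOpen (tubeDomain (k := k) q) :=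
  (isOpen_extChartAt_target q).prod Metric.isOpen_ball

omit [IsManifold (𝓡 k) ∞ L] in
theorem mem_tubeDomain (q : L) : (extChartAt (𝓡 k) q q, (0 : ℂ)) ∈ tubeDomain q :=
  ⟨mem_extChartAt_target q, Metric.mem_ball_self one_pos⟩

theorem contMDiffOn_tubeChart (ob : OpenBook k N L) (q : L) :
    ContMDiffOn 𝓘(ℝ, Eu k × ℂ) (𝓡∂ (k + 2)) ∞ (tubeChart ob q) (tubeDomain q) := by
  have h1 : ContMDiffOn 𝓘(ℝ, Eu k × ℂ) ((𝓡 k).prod 𝓘(ℝ, ℂ)) ∞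
      (fun p : Eu k × ℂ => ((extChartAt (𝓡 k) q).symm p.1, p.2)) (tubeDomain q) := by
    refine ContMDiffOn.prodMk ?_ contDiff_snd.contMDiff.contMDiffOn
    exact (contMDiffOn_extChartAt_symm q).comp contDiff_fst.contMDiff.contMDiffOn fun p hp => hp.1
  exact ob.tube_smooth.comp h1 fun p hp => ⟨mem_univ _, hp.2⟩

theorem bijective_mfderiv_tubeChart (ob : OpenBook k N L) (q : L) :
    Function.Bijective (mfderiv 𝓘(ℝ, Eu k × ℂ) (𝓡∂ (k + 2)) (tubeChart ob q)
      (extChartAt (𝓡 k) q q, (0 : ℂ))) := by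
  set p₀ : Eu k × ℂ := (extChartAt (𝓡 k) q q, (0 : ℂ)) with hp₀
  set Φ := extChartAt ((𝓡 k).prod 𝓘(ℝ, ℂ)) (q, (0 : ℂ)) with hΦ
  have hΦs : tubeChart ob q = ob.tube ∘ Φ.symm := rfl
  have hp : p₀ = Φ (q, 0) := rfl
  have hpt : p₀ ∈ Φ.target := hp ▸ mem_extChartAt_target _
  have hinv : Φ.symm p₀ = (q, 0) := by rw [hp]; exact extChartAt_to_inv _
  have hr : range ((𝓡 k).prod 𝓘(ℝ, ℂ)) = univ := by simp
  have h1 := isInvertible_mfderivWithin_extChartAt_symm (I := (𝓡 k).prod 𝓘(ℝ, ℂ)) hpt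
  rw [hr, mfderivWithin_univ] at h1
  have hmem : Φ.symm p₀ ∈ (univ ×ˢ Metric.ball 0 1 : Set (L × ℂ)) := by
    rw [hinv]; exact ⟨mem_univ _, Metric.mem_ball_self one_pos⟩
  have h2 := ob.tube_bijective _ hmem
  have h3 : MDifferentiableAt ((𝓡 k).prod 𝓘(ℝ, ℂ)) (𝓡∂ (k + 2)) ob.tube (Φ.symm p₀) :=
    (ob.tube_smooth.contMDiffAt ((isOpen_univ.prod Metric.isOpen_ball).mem_nhds hmem)).mdifferentiableAt
      (by simp)
  have h4 : MDifferentiableAt 𝓘(ℝ, Eu k × ℂ) ((𝓡 k).prod 𝓘(ℝ, ℂ)) Φ.symm p₀ := by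
    have := mdifferentiableWithinAt_extChartAt_symm (I := (𝓡 k).prod 𝓘(ℝ, ℂ)) hpt
    rwa [hr, mdifferentiableWithinAt_univ] at this
  rw [hΦs, mfderiv_comp p₀ h3 h4]
  exact h2.comp h1.bijective

end Tube

/-! ## The function relating the contact form to the angular form of the open book -/

section ContactFunction

variable {k : ℕ}
  {M : Type*} [TopologicalSpace M] [ChartedSpace (Eu (2 * k + 3)) M]
  {N : Type*} [TopologicalSpace N] [ChartedSpace (EuclideanHalfSpace (k + 2)) N]
  {L : Type*} [TopologicalSpace L] [ChartedSpace (Eu k) L]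
  {α : ∀ p : M, TangentSpace (𝓡 (2 * k + 3)) p →L[ℝ] ℝ} {j : N → M} {ob : OpenBook k N L}

/-- The kernel of `dϑ` lies in the kernel of `α`, on the singular set trivially, so the two
covectors are proportional. Consequently the ratio defining `contactFun` does not depend on the
chosen vector. -/
theorem restrictForm_mul_dAngle (hleaves : LeavesInPages α j ob) (x : N)
    (v w : TangentSpace (𝓡∂ (k + 2)) x) :
    restrictForm α j x v * dAngle ob.ϑ x w = restrictForm α j x w * dAngle ob.ϑ x v := by
  have h0 : ∀ y : TangentSpace (𝓡∂ (k + 2)) x, dAngle ob.ϑ x y = 0 → restrictForm α j x y = 0 :=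
    fun y hy => by
      by_cases hx : x ∈ singSet α j
      · exact hx y
      · exact (hleaves x hx y).2 hy
  set a : Eu (k + 2) →L[ℝ] ℝ := (show Eu (2 * k + 3) →L[ℝ] ℝ from α (j x)).comp
    (mfderiv (𝓡∂ (k + 2)) (𝓡 (2 * k + 3)) j x : Eu (k + 2) →L[ℝ] Eu (2 * k + 3)) with ha
  set b : Eu (k + 2) →L[ℝ] ℝ := Complex.imCLM.comp ((ContinuousLinearMap.mul ℝ ℂ (star (ob.ϑ x))).comp
    (mfderiv (𝓡∂ (k + 2)) 𝓘(ℝ, ℂ) ob.ϑ x : Eu (k + 2) →L[ℝ] ℂ)) with hb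
  have h0' : ∀ y, b y = 0 → a y = 0 := h0
  have key : ∀ v w : Eu (k + 2), a v * b w = a w * b v := fun v w => by
    have := h0' (b w • v - b v • w) (by
      rw [map_sub, map_smul, map_smul, smul_eq_mul, smul_eq_mul, mul_comm, sub_self])
    rw [map_sub, map_smul, map_smul, smul_eq_mul, smul_eq_mul, sub_eq_zero] at this
    linarith
  exact key v w

open Classical in
/-- The function `f` with `α|_{TN} = f dϑ` away from the binding. -/
def contactFun (α : ∀ p : M, TangentSpace (𝓡 (2 * k + 3)) p →L[ℝ] ℝ) (j : N → M)
    (ob : OpenBook k N L) (x : N) : ℝ :=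
  if h : x ∈ ob.binding then 0 else
    restrictForm α j x (ob.ϑ_submersion x h).choose / dAngle ob.ϑ x (ob.ϑ_submersion x h).choose

theorem restrictForm_eq_contactFun_mul (hleaves : LeavesInPages α j ob) {x : N}
    (hx : x ∉ ob.binding) (v : TangentSpace (𝓡∂ (k + 2)) x) :
    restrictForm α j x v = contactFun α j ob x * dAngle ob.ϑ x v := by
  have h1 := (ob.ϑ_submersion x hx).choose_spec
  rw [contactFun, dif_neg hx, div_mul_eq_mul_div, eq_div_iff h1]
  exact restrictForm_mul_dAngle hleaves x _ _

theorem contactFun_of_mem_binding {x : N} (hx : x ∈ ob.binding) : contactFun α j ob x = 0 :=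
  dif_pos hx

theorem contactFun_eq_zero_iff (hleaves : LeavesInPages α j ob)
    (hsing : singSet α j = (𝓡∂ (k + 2)).boundary N ∪ ob.binding) (x : N) :
    contactFun α j ob x = 0 ↔ x ∈ ob.binding ∪ (𝓡∂ (k + 2)).boundary N := by
  by_cases hx : x ∈ ob.binding
  · exact iff_of_true (contactFun_of_mem_binding hx) (Or.inl hx)
  rw [union_comm, ← hsing]
  constructor
  · intro h v
    rw [restrictForm_eq_contactFun_mul hleaves hx, h, zero_mul]
  · intro h
    obtain ⟨v, hv⟩ := ob.ϑ_submersion x hx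
    have := restrictForm_eq_contactFun_mul hleaves hx v
    rw [h v] at this
    exact (mul_eq_zero.1 this.symm).resolve_right hv

variable [IsManifold (𝓡 (2 * k + 3)) ∞ M] [IsManifold (𝓡∂ (k + 2)) ∞ N]

/-- The vectors chosen pointwise in `contactFun` may be replaced by a field that is constant in a
chart and satisfies `dϑ ≠ 0` at `x₀`. Then `f` is a quotient of smooth functions near `x₀`, also at
boundary points of `N`. -/
theorem contMDiffAt_contactFun_of_notMem (hα : IsSmoothForm (𝓡 (2 * k + 3)) (oneForm (𝓡 (2 * k + 3)) α))
    (hj : ContMDiff (𝓡∂ (k + 2)) (𝓡 (2 * k + 3)) ∞ j) (hleaves : LeavesInPages α j ob)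
    (hB : IsClosed ob.binding) {x₀ : N} (hx₀ : x₀ ∉ ob.binding) :
    ContMDiffAt (𝓡∂ (k + 2)) 𝓘(ℝ, ℝ) ∞ (contactFun α j ob) x₀ := by
  set φ := extChartAt (𝓡∂ (k + 2)) x₀ with hφ
  set s := φ.target with hs
  have hsu : UniqueDiffOn ℝ s := uniqueDiffOn_extChartAt_target x₀
  set y₀ := φ x₀ with hy₀
  have hy₀s : y₀ ∈ s := mem_extChartAt_target x₀
  have hinv₀ : φ.symm y₀ = x₀ := extChartAt_to_inv x₀
  have hsym : ContMDiffOn 𝓘(ℝ, Eu (k + 2)) (𝓡∂ (k + 2)) ∞ φ.symm s := contMDiffOn_extChartAt_symm x₀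
  have hϑ : ∀ x ∉ ob.binding, ContMDiffAt (𝓡∂ (k + 2)) 𝓘(ℝ, ℂ) ∞ ob.ϑ x := fun x hx =>
    ob.ϑ_smooth.contMDiffAt (hB.isOpen_compl.mem_nhds hx)
  obtain ⟨v₁, hv₁⟩ := ob.ϑ_submersion x₀ hx₀
  obtain ⟨v₀, hv₀⟩ : ∃ v₀ : Eu (k + 2),
      (mfderivWithin 𝓘(ℝ, Eu (k + 2)) (𝓡∂ (k + 2)) φ.symm s y₀ : Eu (k + 2) →L[ℝ] Eu (k + 2)) v₀ = v₁ := by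
    have h1 := isInvertible_mfderivWithin_extChartAt_symm (I := 𝓡∂ (k + 2)) hy₀s
    rw [← mfderivWithin_congr_set (extChartAt_target_eventuallyEq (I := 𝓡∂ (k + 2)) (x := x₀))] at h1
    exact h1.bijective.2 v₁
  set P : Eu (k + 2) → ℝ := fun y =>
    pullForm (𝓡 (2 * k + 3)) (oneForm (𝓡 (2 * k + 3)) α) (j ∘ φ.symm) s y (fun _ => v₀) with hP
  have hPs : ContDiffOn ℝ ∞ P s := contDiffOn_pullForm hα (hj.comp_contMDiffOn hsym) hsu _
  set D : Eu (k + 2) → ℝ := fun y =>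
    (star (ob.ϑ (φ.symm y)) * fderivWithin ℝ (ob.ϑ ∘ φ.symm) s y v₀).im with hD
  have hϑs : ContDiffWithinAt ℝ ∞ (ob.ϑ ∘ φ.symm) s y₀ :=
    ((hϑ x₀ hx₀).comp_contMDiffWithinAt_of_eq (hsym y₀ hy₀s) hinv₀).contDiffWithinAt
  have hDs : ContDiffWithinAt ℝ ∞ D s y₀ := by
    have h1 : ContDiffWithinAt ℝ ∞ (fun y => fderivWithin ℝ (ob.ϑ ∘ φ.symm) s y v₀) s y₀ :=
      (hϑs.fderivWithin_right hsu (by simp) hy₀s).clm_apply contDiffWithinAt_const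
    have h2 : ContDiffWithinAt ℝ ∞ (fun y => star (ob.ϑ (φ.symm y))) s y₀ :=
      Complex.conjCLE.contDiff.contDiffAt.comp_contDiffWithinAt y₀ hϑs
    exact Complex.imCLM.contDiff.contDiffAt.comp_contDiffWithinAt y₀ (h2.mul h1)
  have hPeq : ∀ y ∈ s, P y = restrictForm α j (φ.symm y)
      (mfderivWithin 𝓘(ℝ, Eu (k + 2)) (𝓡∂ (k + 2)) φ.symm s y v₀) := fun y hy => by
    have h1 := mfderiv_comp_mfderivWithin y (hj.mdifferentiable (by simp) (φ.symm y))
      ((hsym y hy).mdifferentiableWithinAt (by simp)) (hsu y hy).uniqueMDiffWithinAt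
    exact congrArg (fun A : Eu (k + 2) →L[ℝ] Eu (2 * k + 3) =>
      (show Eu (2 * k + 3) →L[ℝ] ℝ from α (j (φ.symm y))) (A v₀)) h1
  have hDeq : ∀ y ∈ s, φ.symm y ∉ ob.binding → D y = dAngle ob.ϑ (φ.symm y)
      (mfderivWithin 𝓘(ℝ, Eu (k + 2)) (𝓡∂ (k + 2)) φ.symm s y v₀) := fun y hy hyB => by
    have h1 := mfderiv_comp_mfderivWithin y ((hϑ _ hyB).mdifferentiableAt (by simp))
      ((hsym y hy).mdifferentiableWithinAt (by simp)) (hsu y hy).uniqueMDiffWithinAt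
    rw [mfderivWithin_eq_fderivWithin] at h1
    exact congrArg (fun A : Eu (k + 2) →L[ℝ] ℂ => (star (ob.ϑ (φ.symm y)) * A v₀).im) h1
  have hD₀ : D y₀ ≠ 0 := by
    rw [hDeq y₀ hy₀s (by rwa [hinv₀])]
    have h1 : dAngle ob.ϑ (φ.symm y₀) (mfderivWithin 𝓘(ℝ, Eu (k + 2)) (𝓡∂ (k + 2)) φ.symm s y₀ v₀) =
        dAngle ob.ϑ x₀ v₁ := by
      have e1 : ∀ x, x = x₀ → ∀ w : Eu (k + 2), w = v₁ → dAngle ob.ϑ x w = dAngle ob.ϑ x₀ v₁ := by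
        rintro _ rfl _ rfl; rfl
      exact e1 _ hinv₀ _ hv₀
    rw [h1]
    exact hv₁
  have hq : ContDiffWithinAt ℝ ∞ (fun y => P y / D y) s y₀ := (hPs y₀ hy₀s).div hDs hD₀
  have hx₀s : φ.source ∈ 𝓝 x₀ := extChartAt_source_mem_nhds x₀
  have hcφ : ContMDiffWithinAt (𝓡∂ (k + 2)) 𝓘(ℝ, Eu (k + 2)) ∞ φ φ.source x₀ :=
    contMDiffAt_extChartAt.contMDiffWithinAt
  have hfin : ContMDiffAt (𝓡∂ (k + 2)) 𝓘(ℝ, ℝ) ∞ (fun x => P (φ x) / D (φ x)) x₀ :=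
    (hq.contMDiffWithinAt.comp x₀ hcφ fun x hx => φ.map_source hx).contMDiffAt hx₀s
  refine hfin.congr_of_eventuallyEq ?_
  have hDn : ∀ᶠ x in 𝓝 x₀, D (φ x) ≠ 0 := by
    have h1 : ContinuousWithinAt (fun x => D (φ x)) φ.source x₀ :=
      ContinuousWithinAt.comp (g := D) hDs.continuousWithinAt hcφ.continuousWithinAt
        fun x hx => φ.map_source hx
    exact (h1.continuousAt hx₀s).eventually_ne hD₀
  filter_upwards [hx₀s, hDn, hB.isOpen_compl.mem_nhds hx₀] with x hx hDx hxB
  have hinv : φ.symm (φ x) = x := φ.left_inv hx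
  rw [eq_div_iff hDx, hPeq _ (φ.map_source hx)]
  rw [hDeq _ (φ.map_source hx) (by rwa [hinv])]
  rw [restrictForm_eq_contactFun_mul hleaves (by rwa [hinv]), hinv]

omit [IsManifold (𝓡 (2 * k + 3)) ∞ M] [IsManifold (𝓡∂ (k + 2)) ∞ N] in
theorem tubeChart_mem_binding_iff {q : L} {p : Eu k × ℂ} (hp : p ∈ tubeDomain q) :
    tubeChart ob q p ∈ ob.binding ↔ p.2 = 0 := by
  constructor
  · rintro ⟨q', hq'⟩
    have := ob.tube_injOn (x₁ := (q', 0)) (x₂ := ((extChartAt (𝓡 k) q).symm p.1, p.2))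
      ⟨mem_univ _, Metric.mem_ball_self one_pos⟩ ⟨mem_univ _, hp.2⟩ hq'
    exact (congrArg Prod.snd this).symm
  · intro h
    exact ⟨(extChartAt (𝓡 k) q).symm p.1, by rw [tubeChart, h]⟩

variable [IsManifold (𝓡 k) ∞ L]

omit [IsManifold (𝓡 (2 * k + 3)) ∞ M] [IsManifold (𝓡∂ (k + 2)) ∞ N] in
-- Rotating the normal coordinate by `e^{it}` multiplies `ϑ` by `e^{it}`, so `dϑ` is `1` on the
-- rotation field `i z`.
theorem dAngle_tubeChart (hB : IsClosed ob.binding) {q : L} {p : Eu k × ℂ} (hp : p ∈ tubeDomain q)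
    (hp2 : p.2 ≠ 0) : dAngle ob.ϑ (tubeChart ob q p)
      (mfderiv 𝓘(ℝ, Eu k × ℂ) (𝓡∂ (k + 2)) (tubeChart ob q) p ((0, Complex.I * p.2) : Eu k × ℂ)) = 1 := by
  set T := tubeChart ob q with hT
  have hTp : MDifferentiableAt 𝓘(ℝ, Eu k × ℂ) (𝓡∂ (k + 2)) T p :=
    ((contMDiffOn_tubeChart ob q).contMDiffAt ((isOpen_tubeDomain q).mem_nhds hp)).mdifferentiableAt
      (by simp)
  have hTB : T p ∉ ob.binding := fun h => hp2 ((tubeChart_mem_binding_iff hp).1 h)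
  have hϑ : MDifferentiableAt (𝓡∂ (k + 2)) 𝓘(ℝ, ℂ) ob.ϑ (T p) :=
    (ob.ϑ_smooth.contMDiffAt (hB.isOpen_compl.mem_nhds hTB)).mdifferentiableAt (by simp)
  set A : Eu k × ℂ →L[ℝ] ℂ := (mfderiv (𝓡∂ (k + 2)) 𝓘(ℝ, ℂ) ob.ϑ (T p) : Eu (k + 2) →L[ℝ] ℂ).comp
    (mfderiv 𝓘(ℝ, Eu k × ℂ) (𝓡∂ (k + 2)) T p : Eu k × ℂ →L[ℝ] Eu (k + 2)) with hA
  have hAd : HasFDerivAt (ob.ϑ ∘ T) A p :=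
    (HasMFDerivAt.comp p hϑ.hasMFDerivAt hTp.hasMFDerivAt).hasFDerivAt
  have hcirc : HasDerivAt circlePt Complex.I 0 := by
    have := (((Complex.ofRealCLM.hasDerivAt (x := 0)).mul_const Complex.I).cexp)
    convert! this using 1
    simp
  have hc0 : circlePt 0 = 1 := by simp [circlePt]
  have hcurve : HasDerivAt (fun t => ((p.1, circlePt t * p.2) : Eu k × ℂ)) (0, Complex.I * p.2) 0 :=
    (hasDerivAt_const (0 : ℝ) p.1).prodMk (hcirc.mul_const p.2)
  have h1 : HasDerivAt (fun t => ob.ϑ (T (p.1, circlePt t * p.2))) (A (0, Complex.I * p.2)) 0 := by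
    refine HasFDerivAt.comp_hasDerivAt (l := ob.ϑ ∘ T) (0 : ℝ) ?_ hcurve
    rw [hc0, one_mul]
    exact hAd
  have h2 : ∀ t, ob.ϑ (T (p.1, circlePt t * p.2)) = circlePt t * (p.2 / (‖p.2‖ : ℂ)) := fun t => by
    have hn : ‖circlePt t * p.2‖ = ‖p.2‖ := by rw [norm_mul, norm_circlePt, one_mul]
    have hne : circlePt t * p.2 ≠ 0 := by
      rw [← norm_pos_iff, hn]; exact norm_pos_iff.2 hp2
    rw [hT, tubeChart, ob.ϑ_tube _ _ hne (by rw [hn]; exact mem_ball_zero_iff.1 hp.2), hn, mul_div_assoc]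
  have h3 : A (0, Complex.I * p.2) = Complex.I * (p.2 / (‖p.2‖ : ℂ)) := by
    refine h1.unique ?_
    simp only [h2]
    exact hcirc.mul_const _
  have h4 : ob.ϑ (T p) = p.2 / (‖p.2‖ : ℂ) := by
    have := h2 0
    simpa [hc0] using this
  have h5 : star (ob.ϑ (T p)) * ob.ϑ (T p) = 1 := by
    have := Complex.normSq_eq_conj_mul_self (z := ob.ϑ (T p))
    rw [Complex.normSq_eq_norm_sq, ob.norm_ϑ _ hTB] at this
    simpa using this.symm
  change (star (ob.ϑ (T p)) * A (0, Complex.I * p.2)).im = 1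
  rw [h3, ← h4, mul_left_comm, h5]
  simp

omit [IsManifold (𝓡∂ (k + 2)) ∞ N] in
-- Near the binding `f` is `α` evaluated on the rotation field `x ∂_y - y ∂_x` of the normal plane.
-- This field is smooth and zero along the binding, so the formula extends `f` smoothly and with the
-- right value.
theorem contMDiffAt_contactFun_of_mem (hα : IsSmoothForm (𝓡 (2 * k + 3)) (oneForm (𝓡 (2 * k + 3)) α))
    (hj : ContMDiff (𝓡∂ (k + 2)) (𝓡 (2 * k + 3)) ∞ j) (hleaves : LeavesInPages α j ob)
    (hB : IsClosed ob.binding) (q : L) :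
    ContMDiffAt (𝓡∂ (k + 2)) 𝓘(ℝ, ℝ) ∞ (contactFun α j ob) (ob.tube (q, 0)) := by
  set T := tubeChart ob q with hT
  set s := tubeDomain (k := k) q with hs
  have hso : IsOpen s := isOpen_tubeDomain q
  set p₀ : Eu k × ℂ := (extChartAt (𝓡 k) q q, 0) with hp₀
  have hp₀s : p₀ ∈ s := mem_tubeDomain q
  have hTp₀ : T p₀ = ob.tube (q, 0) := by
    simp only [hT, tubeChart, hp₀, extChartAt_to_inv]
  have hTs : ContMDiffOn 𝓘(ℝ, Eu k × ℂ) (𝓡∂ (k + 2)) ∞ T s := contMDiffOn_tubeChart ob q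
  obtain ⟨S, hS, hSp, hSi⟩ := exists_local_inverse (hTs.contMDiffAt (hso.mem_nhds hp₀s))
    (bijective_mfderiv_tubeChart ob q)
  rw [hTp₀] at hS hSp hSi
  set P : Eu k × ℂ → Eu k × ℂ → ℝ := fun v p =>
    pullForm (𝓡 (2 * k + 3)) (oneForm (𝓡 (2 * k + 3)) α) (j ∘ T) s p (fun _ => v) with hP
  have hPs : ∀ v, ContDiffOn ℝ ∞ (P v) s := fun v =>
    contDiffOn_pullForm hα (hj.comp_contMDiffOn hTs) hso.uniqueDiffOn _
  set A : Eu k × ℂ → ℝ := fun p => p.2.re * P (0, Complex.I) p - p.2.im * P (0, 1) p with hA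
  have hAs : ContDiffAt ℝ ∞ A p₀ :=
    ((Complex.reCLM.contDiff.comp contDiff_snd).contDiffAt.mul
      ((hPs _).contDiffAt (hso.mem_nhds hp₀s))).sub
    ((Complex.imCLM.contDiff.comp contDiff_snd).contDiffAt.mul
      ((hPs _).contDiffAt (hso.mem_nhds hp₀s)))
  have hAP : ∀ p, A p = P (0, Complex.I * p.2) p := fun p => by
    have hlin : ∃ B : Eu k × ℂ →L[ℝ] ℝ, ∀ v, P v p = B v :=
      ⟨(show Eu (2 * k + 3) →L[ℝ] ℝ from α (j (T p))).comp
        (mfderivWithin 𝓘(ℝ, Eu k × ℂ) (𝓡 (2 * k + 3)) (j ∘ T) s p : Eu k × ℂ →L[ℝ] Eu (2 * k + 3)),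
        fun v => rfl⟩
    obtain ⟨B, hBv⟩ := hlin
    have hv : ((0, Complex.I * p.2) : Eu k × ℂ) = p.2.re • (0, Complex.I) - p.2.im • (0, 1) := by
      refine Prod.ext (by simp) ?_
      apply Complex.ext <;> simp
    simp only [hA, hBv]
    rw [hv, map_sub, map_smul, map_smul, smul_eq_mul, smul_eq_mul]
  have hfT : ∀ p ∈ s, contactFun α j ob (T p) = A p := fun p hp => by
    by_cases hp2 : p.2 = 0
    · rw [contactFun_of_mem_binding ((tubeChart_mem_binding_iff hp).2 hp2)]
      simp [hA, hp2]
    · have hTB : T p ∉ ob.binding := fun h => hp2 ((tubeChart_mem_binding_iff hp).1 h)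
      have h1 := restrictForm_eq_contactFun_mul hleaves hTB
        (mfderiv 𝓘(ℝ, Eu k × ℂ) (𝓡∂ (k + 2)) T p ((0, Complex.I * p.2) : Eu k × ℂ))
      rw [dAngle_tubeChart hB hp hp2, mul_one] at h1
      rw [← h1, hAP]
      have h2 := mfderiv_comp p (hj.mdifferentiable (by simp) (T p))
        ((hTs.contMDiffAt (hso.mem_nhds hp)).mdifferentiableAt (by simp))
      rw [← mfderivWithin_of_isOpen hso hp] at h2
      exact congrArg (fun B : Eu k × ℂ →L[ℝ] Eu (2 * k + 3) =>
        (show Eu (2 * k + 3) →L[ℝ] ℝ from α (j (T p))) (B (0, Complex.I * p.2))) h2.symm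
  have hAS : ContMDiffAt (𝓡∂ (k + 2)) 𝓘(ℝ, ℝ) ∞ (fun x => A (S x)) (ob.tube (q, 0)) :=
    hAs.contMDiffAt.comp_of_eq hS hSp
  refine hAS.congr_of_eventuallyEq ?_
  have hSs : ∀ᶠ x in 𝓝 (ob.tube (q, 0)), S x ∈ s :=
    hS.continuousAt.eventually_mem (hso.mem_nhds (by rw [hSp]; exact hp₀s))
  filter_upwards [hSi, hSs] with x hx hxs
  rw [← hfT _ hxs, hx]

theorem contMDiff_contactFun (hα : IsSmoothForm (𝓡 (2 * k + 3)) (oneForm (𝓡 (2 * k + 3)) α))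
    (hj : ContMDiff (𝓡∂ (k + 2)) (𝓡 (2 * k + 3)) ∞ j) (hleaves : LeavesInPages α j ob)
    (hB : IsClosed ob.binding) : ContMDiff (𝓡∂ (k + 2)) 𝓘(ℝ, ℝ) ∞ (contactFun α j ob) := fun x => by
  by_cases hx : x ∈ ob.binding
  · obtain ⟨q, rfl⟩ := hx
    exact contMDiffAt_contactFun_of_mem hα hj hleaves hB q
  · exact contMDiffAt_contactFun_of_notMem hα hj hleaves hB hx

omit [IsManifold (𝓡∂ (k + 2)) ∞ N] [IsManifold (𝓡 k) ∞ L] in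
theorem isClosed_binding [CompactSpace L] [T2Space N] (ob : OpenBook k N L) : IsClosed ob.binding := by
  have : Continuous fun q : L => ob.tube (q, 0) :=
    ob.tube_smooth.continuousOn.comp_continuous (by fun_prop)
      fun q => ⟨mem_univ _, Metric.mem_ball_self one_pos⟩
  exact (isCompact_range this).isClosed

omit [IsManifold (𝓡 (2 * k + 3)) ∞ M] [IsManifold (𝓡∂ (k + 2)) ∞ N] [IsManifold (𝓡 k) ∞ L] in
theorem exists_isMax_abs_contactFun [CompactSpace N] (hf : Continuous (contactFun α j ob))
    (hleaves : LeavesInPages α j ob)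
    (hsing : singSet α j = (𝓡∂ (k + 2)).boundary N ∪ ob.binding) :
    ∃ x₀, (∀ x, |contactFun α j ob x| ≤ |contactFun α j ob x₀|) ∧ 0 < |contactFun α j ob x₀| := by
  obtain ⟨q⟩ := ob.nonempty
  have : Nonempty N := ⟨ob.tube (q, 0)⟩
  obtain ⟨x₀, -, hx₀⟩ := isCompact_univ.exists_isMaxOn univ_nonempty hf.abs.continuousOn
  refine ⟨x₀, fun x => hx₀ (mem_univ x), ?_⟩
  -- A point of the tube at normal distance `1/2` lies neither on the binding nor on the boundary,
  -- so the maximum is positive.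
  have hz : ((q, 1 / 2) : L × ℂ) ∈ (univ ×ˢ Metric.ball 0 1 : Set (L × ℂ)) :=
    ⟨mem_univ _, by rw [mem_ball_zero_iff]; norm_num⟩
  refine (abs_pos.2 fun h => ?_).trans_le (hx₀ (mem_univ (ob.tube (q, 1 / 2))))
  rcases (contactFun_eq_zero_iff hleaves hsing _).1 h with ⟨q', hq'⟩ | hb
  · have := congrArg Prod.snd
      (ob.tube_injOn (x₁ := (q', 0)) ⟨mem_univ _, Metric.mem_ball_self one_pos⟩ hz hq')
    norm_num at this
  · exact ob.tube_interior _ hz hb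

end ContactFunction

/-! ### Dependence of the excess on the closed disk only, and its vanishing on constant disks -/

section Excess

variable {EW : Type*} [NormedAddCommGroup EW] [NormedSpace ℝ EW]
  {HW : Type*} [TopologicalSpace HW] {IW : ModelWithCorners ℝ EW HW}
  {W : Type*} [TopologicalSpace W] [ChartedSpace HW W]
  {EM : Type*} [NormedAddCommGroup EM] [NormedSpace ℝ EM]
  {HM : Type*} [TopologicalSpace HM] {IM : ModelWithCorners ℝ EM HM}
  {M : Type*} [TopologicalSpace M] [ChartedSpace HM M]
  {N : Type*} [Nonempty N]

omit [TopologicalSpace W] in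
theorem boundaryLoop_congr {e : N → W} {a b : ℂ → W} (h : EqOn a b (Metric.closedBall 0 1)) :
    boundaryLoop e a = boundaryLoop e b :=
  funext fun t => by rw [boundaryLoop, boundaryLoop, h (circlePt_mem t)]

theorem excess_congr (Ω : ∀ x : W, TangentSpace IW x [⋀^Fin 2]→L[ℝ] ℝ)
    (β : ∀ x : M, TangentSpace IM x [⋀^Fin 1]→L[ℝ] ℝ) (ι : M → W) (j : N → M) {a b : ℂ → W}
    (h : EqOn a b (Metric.closedBall 0 1)) : excess Ω β ι j a = excess Ω β ι j b := by
  have h1 : (fun x => a (polar x)) = fun x => b (polar x) := funext fun x => h (polar_mem x)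
  rw [excess, excess, h1, boundaryLoop_congr h]

theorem pullForm_const {V : Type*} [NormedAddCommGroup V] [NormedSpace ℝ V] {m : ℕ}
    (σ : ∀ x : W, TangentSpace IW x [⋀^Fin (m + 1)]→L[ℝ] ℝ) (w : W) (s : Set V) (p : V)
    (v : Fin (m + 1) → V) : pullForm IW σ (fun _ => w) s p v = 0 := by
  have h : mfderivWithin 𝓘(ℝ, V) IW (fun _ : V => w) s p = 0 := mfderivWithin_const
  rw [pullForm, h]
  exact ContinuousAlternatingMap.map_coord_zero (σ w) 0 rfl

theorem excess_const (Ω : ∀ x : W, TangentSpace IW x [⋀^Fin 2]→L[ℝ] ℝ)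
    (β : ∀ x : M, TangentSpace IM x [⋀^Fin 1]→L[ℝ] ℝ) (ι : M → W) (j : N → M) (w : W) :
    excess Ω β ι j (fun _ => w) = 0 := by
  have h1 : rectIntegral Ω (fun _ : Fin 2 → ℝ => w) = 0 := by
    simp only [rectIntegral, pullForm_const, integral_zero]
  have h2 : pathIntegral β (fun x : Fin 1 → ℝ => j (boundaryLoop (ι ∘ j) (fun _ => w) (x 0))) = 0 := by
    simp only [boundaryLoop, pathIntegral, pullForm_const, integral_zero]
  rw [excess, h1, h2, sub_zero]

end Excess

/-! ## The Bishop family -/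

section Bishop

variable {k : ℕ}
  {W : Type*} [TopologicalSpace W] [ChartedSpace (EuclideanHalfSpace (2 * k + 4)) W]
  {N : Type*} [TopologicalSpace N] [ChartedSpace (EuclideanHalfSpace (k + 2)) N]
  {L : Type*} [TopologicalSpace L] [ChartedSpace (Eu k) L] [IsManifold (𝓡 k) ∞ L]
  {J : ∀ x : W, TangentSpace (𝓡∂ (2 * k + 4)) x →L[ℝ] TangentSpace (𝓡∂ (2 * k + 4)) x}
  {e : N → W} {ob : OpenBook k N L}

/-- The point of the model with coordinates `z` over a point `q` of the binding. -/
def modelPt (q : L) (z : ℂ × ℂ) : (ℂ × ℂ) × Cotangent k L := (z, zeroCovector q)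

theorem contMDiff_modelPt (q : L) : ContMDiff 𝓘(ℝ, ℂ × ℂ) (IC k) ∞ (modelPt (k := k) q) :=
  contMDiff_id.prodMk contMDiff_const

theorem BindingModel.modelPt_mem (c : BindingModel J e ob) (q : L) {z : ℂ × ℂ}
    (hz : ‖z.1‖ ^ 2 + ‖z.2‖ ^ 2 ≤ 1) (hz2 : 1 - c.δ < z.2.re) :
    modelPt q z ∈ modelDomain (fun z => (‖z.1‖ ^ 2 + ‖z.2‖ ^ 2) / 2) {z | 1 - c.δ < z.2.re} c.f := by
  refine ⟨hz2, ?_⟩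
  have : c.f (zeroCovector q) = 0 := (c.f_eq_zero _).2 (mem_range_self q)
  simp only [modelPt, this]
  linarith

theorem BindingModel.toModel_ofModel (c : BindingModel J e ob) (q : L) {z : ℂ × ℂ}
    (hz : ‖z.1‖ ^ 2 + ‖z.2‖ ^ 2 ≤ 1) (hz2 : 1 - c.δ < z.2.re) :
    c.toModel (c.ofModel (modelPt q z)) = modelPt q z :=
  c.invOn.2 (c.modelPt_mem q hz hz2)

theorem BindingModel.ofModel_mem_range (c : BindingModel J e ob) (q : L) {z : ℂ × ℂ}
    (hz : ‖z.1‖ ^ 2 + ‖z.2‖ ^ 2 = 1) (hz2 : 1 - c.δ < z.2.re) (him : z.2.im = 0) :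
    c.ofModel (modelPt q z) ∈ range e := by
  refine (c.submanifold _ (c.ofModel_mapsTo (c.modelPt_mem q hz.le hz2))).2 ?_
  rw [c.toModel_ofModel q hz.le hz2]
  exact ⟨⟨him, hz⟩, mem_range_self q⟩

/-- The first complex coordinate of a point of `N` near the binding. -/
def BindingModel.coord (c : BindingModel J e ob) (x : N) : ℂ := (c.toModel (e x)).1.1

theorem BindingModel.coord_binding (c : BindingModel J e ob) {x : N} (hx : x ∈ ob.binding) :
    c.coord x = 0 := by
  obtain ⟨q, rfl⟩ := hx
  rw [coord, c.binding_eq]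

/-- The Bishop disk of radius `sin τ` over a point `q` of the binding. -/
def BindingModel.disk (c : BindingModel J e ob) (q : L) (τ : ℝ) (z : ℂ) : W :=
  c.ofModel (modelPt q ((Real.sin τ : ℂ) * z, (Real.cos τ : ℂ)))

theorem norm_sq_disk_le {τ : ℝ} {z : ℂ} (hz : ‖z‖ ≤ 1) :
    ‖(Real.sin τ : ℂ) * z‖ ^ 2 + ‖(Real.cos τ : ℂ)‖ ^ 2 ≤ 1 := by
  rw [norm_mul, Complex.norm_real, Complex.norm_real, mul_pow, Real.norm_eq_abs, Real.norm_eq_abs,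
    sq_abs, sq_abs]
  have : ‖z‖ ^ 2 ≤ 1 := pow_le_one₀ (norm_nonneg _) hz
  nlinarith [Real.sin_sq_add_cos_sq τ, sq_nonneg (Real.sin τ)]

theorem norm_sq_disk_eq {τ : ℝ} {z : ℂ} (hz : ‖z‖ = 1) :
    ‖(Real.sin τ : ℂ) * z‖ ^ 2 + ‖(Real.cos τ : ℂ)‖ ^ 2 = 1 := by
  rw [norm_mul, Complex.norm_real, Complex.norm_real, hz, mul_one, Real.norm_eq_abs,
    Real.norm_eq_abs, sq_abs, sq_abs, Real.sin_sq_add_cos_sq]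

/-- With `s = cos τ` the radius `√(1 - s²)` becomes `sin τ`, and the family is smooth through the
degenerate disk at `τ = 0`, where the square root is not. -/
theorem BindingModel.contMDiffOn_disk (c : BindingModel J e ob) (q : L) :
    ContMDiffOn 𝓘(ℝ, ℝ × ℂ) (𝓡∂ (2 * k + 4)) ∞ (fun x : ℝ × ℂ => c.disk q x.1 x.2)
      ({τ | 1 - c.δ < Real.cos τ} ×ˢ Metric.closedBall 0 1) := by
  have h1 : ContDiff ℝ ∞ fun x : ℝ × ℂ => ((Real.sin x.1 : ℂ) * x.2, (Real.cos x.1 : ℂ)) :=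
    ((Complex.ofRealCLM.contDiff.comp (Real.contDiff_sin.comp contDiff_fst)).mul contDiff_snd).prodMk
      (Complex.ofRealCLM.contDiff.comp (Real.contDiff_cos.comp contDiff_fst))
  refine c.ofModel_smooth.comp ((contMDiff_modelPt q).comp h1.contMDiff).contMDiffOn fun x hx =>
    c.modelPt_mem q (norm_sq_disk_le (mem_closedBall_zero_iff.1 hx.2)) ?_
  rw [Complex.ofReal_re]
  exact hx.1

theorem BindingModel.disk_mem_range (c : BindingModel J e ob) (q : L) {τ : ℝ}
    (hτ : 1 - c.δ < Real.cos τ) {z : ℂ} (hz : ‖z‖ = 1) : c.disk q τ z ∈ range e :=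
  c.ofModel_mem_range q (norm_sq_disk_eq hz) (by rwa [Complex.ofReal_re]) (Complex.ofReal_im _)

theorem BindingModel.contMDiffOn_disk_comp (c : BindingModel J e ob) (q : L) {V : Type*}
    [NormedAddCommGroup V] [NormedSpace ℝ V] {f : V → ℝ × ℂ} (hf : ContDiff ℝ ∞ f) {s : Set V}
    (hs : ∀ x ∈ s, 1 - c.δ < Real.cos (f x).1 ∧ (f x).2 ∈ Metric.closedBall 0 1) :
    ContMDiffOn 𝓘(ℝ, V) (𝓡∂ (2 * k + 4)) ∞ (fun x => c.disk q (f x).1 (f x).2) s :=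
  ContMDiffOn.comp (g := fun x : ℝ × ℂ => c.disk q x.1 x.2) (f := f) (c.contMDiffOn_disk q)
    hf.contMDiff.contMDiffOn hs

theorem BindingModel.isDiskMap_disk (c : BindingModel J e ob) (q : L) {τ : ℝ}
    (hτ : 1 - c.δ < Real.cos τ) : IsDiskMap (𝓡∂ (2 * k + 4)) e (c.disk q τ) :=
  ⟨c.contMDiffOn_disk_comp q (contDiff_prodMk_right τ) fun _ hz => ⟨hτ, hz⟩,
    fun _ hz => c.disk_mem_range q hτ hz⟩

theorem BindingModel.coord_boundaryLoop_disk [Nonempty N] (c : BindingModel J e ob) (q : L) {τ : ℝ}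
    (hτ : 1 - c.δ < Real.cos τ) (t : ℝ) :
    c.coord (boundaryLoop e (c.disk q τ) t) = (Real.sin τ : ℂ) * circlePt t := by
  rw [coord, apply_boundaryLoop fun z hz => c.disk_mem_range q hτ hz, disk, c.toModel_ofModel]
  · rfl
  · exact norm_sq_disk_le (norm_circlePt t).le
  · rwa [Complex.ofReal_re]

theorem BindingModel.boundaryLoop_disk_notMem_binding [Nonempty N] (c : BindingModel J e ob) (q : L)
    {τ : ℝ} (hτ : 1 - c.δ < Real.cos τ) (hs : Real.sin τ ≠ 0) (t : ℝ) :
    boundaryLoop e (c.disk q τ) t ∉ ob.binding := by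
  intro h
  have h1 := c.coord_boundaryLoop_disk q hτ t
  rw [c.coord_binding h] at h1
  rcases mul_eq_zero.1 h1.symm with h2 | h2
  · exact hs (Complex.ofReal_eq_zero.1 h2)
  · have := norm_circlePt t
    rw [h2, norm_zero] at this
    exact zero_ne_one this

/-- The members of the Bishop family are Bishop disks. -/
theorem exists_eqOn_disk {c : BindingModel J e ob} {B₀ : Set L} {v : HolDisk J e}
    (hv : v ∈ bishopFamily c B₀) : ∃ (q : L) (θ : ℝ), θ ∈ Ioo 0 Real.pi ∧ 1 - c.δ < Real.cos θ ∧
      EqOn (diskExt v.toFun) (c.disk q θ) (Metric.closedBall 0 1) := by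
  obtain ⟨q, -, s, hs, hv⟩ := hv
  have hδ := c.δ_lt_one
  have h0 : 0 < s := by linarith [hs.1]
  have hcos : Real.cos (Real.arccos s) = s := Real.cos_arccos (by linarith) hs.2.le
  refine ⟨q, Real.arccos s, ⟨Real.arccos_pos.2 hs.2, ?_⟩, by rw [hcos]; exact hs.1, fun z hz => ?_⟩
  · exact (Real.arccos_lt_pi_div_two.2 h0).trans (by linarith [Real.pi_pos])
  · obtain ⟨h1, h2⟩ := hv ⟨z, hz⟩
    have h3 := diskExt_apply v.toFun ⟨z, hz⟩
    rw [← h3] at h1 h2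
    rw [BindingModel.disk, Real.sin_arccos, hcos]
    exact (c.invOn.1 h1).symm.trans (congrArg c.ofModel h2)

theorem cos_le_cos_mul {θ r : ℝ} (hθ : θ ∈ Ioo 0 Real.pi) (hr : r ∈ Icc (0 : ℝ) 1) :
    Real.cos θ ≤ Real.cos (θ * r) :=
  Real.cos_le_cos_of_nonneg_of_le_pi (mul_nonneg hθ.1.le hr.1) hθ.2.le
    (mul_le_of_le_one_right hθ.1.le hr.2)

variable {M : Type*} [TopologicalSpace M] [ChartedSpace (Eu (2 * k + 3)) M]

/-- Shrinking the angle from `θ` to `0` contracts the disk to a constant through disks with boundary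
on `N`. The angle `θ * smoothTransition τ` is admissible for every real `τ`, as invariance under
homotopy demands. -/
theorem excess_bishop_eq_zero [Nonempty N] {Ω : ∀ x : W, TangentSpace (𝓡∂ (2 * k + 4)) x [⋀^Fin 2]→L[ℝ] ℝ}
    {β : ∀ x : M, TangentSpace (𝓡 (2 * k + 3)) x [⋀^Fin 1]→L[ℝ] ℝ} {ι : M → W} {j : N → M}
    (hG : ∀ h : ℝ × ℂ → W, ContMDiffOn 𝓘(ℝ, ℝ × ℂ) (𝓡∂ (2 * k + 4)) ∞ h
        (univ ×ˢ Metric.closedBall 0 1) → (∀ τ z, ‖z‖ = 1 → h (τ, z) ∈ range (ι ∘ j)) →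
      excess Ω β ι j (fun z => h (1, z)) = excess Ω β ι j (fun z => h (0, z)))
    {c : BindingModel J (ι ∘ j) ob} {B₀ : Set L} {v : HolDisk J (ι ∘ j)}
    (hv : v ∈ bishopFamily c B₀) : excess Ω β ι j (diskExt v.toFun) = 0 := by
  obtain ⟨q, θ, hθ, hcos, hvd⟩ := exists_eqOn_disk hv
  rw [excess_congr Ω β ι j hvd]
  have hdom : ∀ τ, 1 - c.δ < Real.cos (θ * Real.smoothTransition τ) := fun τ =>
    hcos.trans_le (cos_le_cos_mul hθ ⟨Real.smoothTransition.nonneg τ, Real.smoothTransition.le_one τ⟩)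
  have h1 : ContDiff ℝ ∞ fun x : ℝ × ℂ => (θ * Real.smoothTransition x.1, x.2) :=
    (contDiff_const.mul (Real.smoothTransition.contDiff.comp contDiff_fst)).prodMk contDiff_snd
  have := hG (fun x => c.disk q (θ * Real.smoothTransition x.1) x.2)
    (c.contMDiffOn_disk_comp q h1 fun x hx => ⟨hdom _, hx.2⟩)
    fun τ z hz => c.disk_mem_range q (hdom τ) hz
  simp only [Real.smoothTransition.one, mul_one, Real.smoothTransition.zero, mul_zero] at this
  rw [this]
  have h0 : c.disk q 0 = fun _ => c.ofModel (modelPt q (0, 1)) := by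
    funext z
    simp [BindingModel.disk]
  rw [h0]
  exact excess_const _ _ _ _ _

end Bishop

/-! ## The winding number of Bishop disks -/

/-- The quotient `a / b` is within distance less than `1` of `1`, so it has positive real part;
division by `r > 0` preserves this. -/
theorem div_mem_slitPlane {a b : ℂ} {r : ℝ} (hr : 0 < r) (h : ‖a - b‖ < ‖b‖) :
    a / (r : ℂ) / b ∈ Complex.slitPlane := by
  have hb : b ≠ 0 := norm_pos_iff.1 ((norm_nonneg _).trans_lt h)
  have h1 : a / (r : ℂ) / b = (r⁻¹ : ℝ) * (1 + (a - b) / b) := by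
    have hr' : (r : ℂ) ≠ 0 := Complex.ofReal_ne_zero.2 hr.ne'
    push_cast
    field_simp
    ring
  have h2 : ‖(a - b) / b‖ < 1 := by rwa [norm_div, div_lt_one (norm_pos_iff.2 hb)]
  have h3 : -1 < ((a - b) / b).re := by
    have := (abs_le.1 (Complex.abs_re_le_norm ((a - b) / b))).1
    linarith
  refine Or.inl ?_
  rw [h1, Complex.re_ofReal_mul]
  refine mul_pos (inv_pos.2 hr) ?_
  rw [Complex.add_re, Complex.one_re]
  linarith

/-- The winding number of the image of a small circle under a local diffeomorphism of the plane. -/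
theorem eventually_abs_sweptAngle_eq {Φ : ℂ → ℂ} {A : ℂ →L[ℝ] ℂ} (hΦ : HasFDerivAt Φ A 0)
    (hΦ0 : Φ 0 = 0) (hA : ∀ w, A w = 0 → w = 0) : ∀ᶠ ρ : ℝ in 𝓝[>] 0, ∀ c : ℝ → ℂ, ContDiff ℝ 1 c →
      (∀ t, Φ (ρ * circlePt t) ≠ 0 → c t = Φ (ρ * circlePt t) / ‖Φ (ρ * circlePt t)‖) →
      |sweptAngle c| = 2 * Real.pi := by
  -- Injectivity gives `‖A z‖ ≥ ‖z‖ / κ`, which beats the remainder `‖z‖ / (2 κ)` on small circles.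
  obtain ⟨κ, hκ, hanti⟩ := A.toLinearMap.exists_antilipschitzWith (LinearMap.ker_eq_bot'.2 hA)
  have hlow : ∀ z, ‖z‖ ≤ κ * ‖A z‖ := fun z => by
    have := hanti.le_mul_dist z 0
    simpa using this
  have hκ' : (0 : ℝ) < κ := hκ
  have hlo := (hasFDerivAt_iff_isLittleO_nhds_zero.1 hΦ).def (show (0 : ℝ) < 1 / (2 * κ) by positivity)
  obtain ⟨ε, hε, hball⟩ := Metric.eventually_nhds_iff_ball.1 hlo
  filter_upwards [Ioo_mem_nhdsGT hε] with ρ hρ c hc hcΦ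
  have hnorm : ∀ t, ‖(ρ : ℂ) * circlePt t‖ = ρ := fun t => by
    rw [norm_mul, norm_circlePt, mul_one, Complex.norm_real, Real.norm_of_nonneg hρ.1.le]
  have hlt : ∀ t, ‖Φ (ρ * circlePt t) - A (ρ * circlePt t)‖ < ‖A (ρ * circlePt t)‖ := fun t => by
    have h1 := hball (ρ * circlePt t) (by rw [mem_ball_zero_iff, hnorm]; exact hρ.2)
    rw [zero_add, hΦ0, sub_zero, hnorm] at h1
    have h2 := hlow (ρ * circlePt t)
    rw [hnorm] at h2
    refine h1.trans_lt ?_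
    have h3 : ρ / κ ≤ ‖A (ρ * circlePt t)‖ := by rwa [div_le_iff₀' hκ']
    refine lt_of_lt_of_le ?_ h3
    rw [one_div, inv_mul_eq_div, div_lt_div_iff₀ (by positivity) hκ']
    nlinarith [mul_pos hρ.1 hκ']
  have hA0 : ∀ t, A (ρ * circlePt t) ≠ 0 := fun t =>
    norm_pos_iff.1 ((norm_nonneg _).trans_lt (hlt t))
  have hΦn : ∀ t, Φ (ρ * circlePt t) ≠ 0 := fun t h => by
    have := hlt t
    rw [h, zero_sub, norm_neg] at this
    exact lt_irrefl _ this
  set A' : ℂ →L[ℝ] ℂ := A.comp ((ρ : ℂ) • ContinuousLinearMap.id ℝ ℂ) with hA'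
  have hA'z : ∀ z, A' z = A (ρ * z) := fun z => rfl
  rw [← abs_sweptAngle_linear (A := A') fun z hz => by
    have := hA _ hz
    rcases mul_eq_zero.1 this with h | h
    · exact absurd (Complex.ofReal_eq_zero.1 h) hρ.1.ne'
    · exact h]
  congr 1
  refine sweptAngle_eq_of_div_mem_slitPlane hc (A'.contDiff.comp contDiff_circlePt) (fun t => ?_)
    hA0 ?_ ?_ fun t _ => ?_
  · rw [hcΦ t (hΦn t)]
    exact div_ne_zero (hΦn t) (Complex.ofReal_ne_zero.2 (norm_ne_zero_iff.2 (hΦn t)))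
  · rw [hcΦ _ (hΦn _), hcΦ _ (hΦn _), circlePt_neg_pi]
  · exact congrArg A' circlePt_neg_pi
  · rw [hcΦ t (hΦn t)]
    exact div_mem_slitPlane (norm_pos_iff.2 (hΦn t)) (hlt t)

section Bishop

variable {k : ℕ}
  {W : Type*} [TopologicalSpace W] [ChartedSpace (EuclideanHalfSpace (2 * k + 4)) W]
  {M : Type*} [TopologicalSpace M] [ChartedSpace (Eu (2 * k + 3)) M]
  {N : Type*} [TopologicalSpace N] [ChartedSpace (EuclideanHalfSpace (k + 2)) N] [Nonempty N]
  {L : Type*} [TopologicalSpace L] [ChartedSpace (Eu k) L] [IsManifold (𝓡 k) ∞ L]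
  {J : ∀ x : W, TangentSpace (𝓡∂ (2 * k + 4)) x →L[ℝ] TangentSpace (𝓡∂ (2 * k + 4)) x}
  {ι : M → W} {j : N → M} {ob : OpenBook k N L}

/-- Near a point of the binding, the normal coordinate of the tubular neighborhood is a coordinate
on the fibers of the model. -/
theorem exists_normal_coord (hι : IsSmoothEmbedding (𝓡 (2 * k + 3)) (𝓡∂ (2 * k + 4)) ∞ ι)
    (hj : IsSmoothEmbedding (𝓡∂ (k + 2)) (𝓡 (2 * k + 3)) ∞ j)
    (c : BindingModel J (ι ∘ j) ob) (q : L) : ∃ (Φ : ℂ → ℂ) (A : ℂ →L[ℝ] ℂ),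
      HasFDerivAt Φ A 0 ∧ Φ 0 = 0 ∧ (∀ w, A w = 0 → w = 0) ∧
      ∀ᶠ z in 𝓝 0, ∀ x : N, ι (j x) = c.ofModel (modelPt q (z, (Real.sqrt (1 - ‖z‖ ^ 2) : ℂ))) →
        Φ z ≠ 0 → ob.ϑ x = Φ z / ‖Φ z‖ := by
  have hinj : Function.Injective (ι ∘ j) := (hι.isEmbedding.comp hj.isEmbedding).injective
  have hδ := c.δ_pos
  -- This parametrizes the slice of `N` over `q` by the first complex coordinate; small boundary
  -- circles of Bishop disks are images of circles around `0`.
  set P : ℂ → ℂ × ℂ := fun z => (z, (Real.sqrt (1 - ‖z‖ ^ 2) : ℂ)) with hP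
  have hP0 : P 0 = (0, 1) := by simp [hP]
  -- the domain where the points of the model are defined
  set U : Set ℂ := {z | 0 < 1 - ‖z‖ ^ 2 ∧ 1 - c.δ < Real.sqrt (1 - ‖z‖ ^ 2)} with hU
  have hUo₁ : IsOpen {z : ℂ | 0 < 1 - ‖z‖ ^ 2} := isOpen_lt continuous_const (by fun_prop)
  have hUo₂ : IsOpen {z : ℂ | 1 - c.δ < Real.sqrt (1 - ‖z‖ ^ 2)} :=
    isOpen_lt continuous_const (by fun_prop)
  have hUo : IsOpen U := hUo₁.inter hUo₂
  have h0U : (0 : ℂ) ∈ U := ⟨by simp, by simp [hδ]⟩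
  have hPn : ∀ z ∈ U, ‖(P z).1‖ ^ 2 + ‖(P z).2‖ ^ 2 = 1 := fun z hz => by
    simp only [hP, Complex.norm_real, Real.norm_eq_abs, sq_abs]
    rw [Real.sq_sqrt hz.1.le]; ring
  have hPre : ∀ z ∈ U, 1 - c.δ < (P z).2.re := fun z hz => by
    simp only [hP, Complex.ofReal_re]; exact hz.2
  have hPim : ∀ z, (P z).2.im = 0 := fun z => Complex.ofReal_im _
  have hPs : ContDiffOn ℝ ∞ P U := by
    refine contDiffOn_id.prodMk (Complex.ofRealCLM.contDiff.comp_contDiffOn ?_)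
    exact (contDiff_const.sub (contDiff_norm_sq ℝ)).contDiffOn.sqrt fun z hz => hz.1.ne'
  set E₁ : ℂ → W := fun z => c.ofModel (modelPt q (P z)) with hE₁
  have hE₁s : ContMDiffOn 𝓘(ℝ, ℂ) (𝓡∂ (2 * k + 4)) ∞ E₁ U :=
    ContMDiffOn.comp (f := fun z => modelPt q (P z)) c.ofModel_smooth
      ((contMDiff_modelPt q).comp_contMDiffOn hPs.contMDiffOn)
      fun z hz => c.modelPt_mem q (hPn z hz).le (hPre z hz)
  set K : ℂ → N := fun z => Function.invFun (ι ∘ j) (E₁ z) with hK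
  have hKe : ∀ z ∈ U, ι (j (K z)) = E₁ z := fun z hz =>
    Function.invFun_eq (c.ofModel_mem_range q (hPn z hz) (hPre z hz) (hPim z))
  have hUn : U ∈ 𝓝 (0 : ℂ) := hUo.mem_nhds h0U
  have hKs : ContMDiffAt 𝓘(ℝ, ℂ) (𝓡∂ (k + 2)) ∞ K 0 :=
    contMDiffAt_of_comp_embedding hj (contMDiffAt_of_comp_embedding hι
      ((hE₁s.contMDiffAt hUn).congr_of_eventuallyEq (by filter_upwards [hUn] with z hz using hKe z hz)))
  set x₀ : N := ob.tube (q, 0) with hx₀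
  have hK0 : K 0 = x₀ := hinj ((hKe 0 h0U).trans (by
    simp only [hE₁, hP0]
    have h1 := c.invOn.1 (c.binding_mem q)
    rw [c.binding_eq q] at h1
    exact h1))
  -- the tube chart and its inverse
  set T := tubeChart ob q with hT
  set p₀ : Eu k × ℂ := (extChartAt (𝓡 k) q q, 0) with hp₀
  have hp₀s : p₀ ∈ tubeDomain q := mem_tubeDomain q
  have hTp₀ : T p₀ = x₀ := by simp only [hT, tubeChart, hp₀, extChartAt_to_inv, hx₀]
  have hTs : ContMDiffAt 𝓘(ℝ, Eu k × ℂ) (𝓡∂ (k + 2)) ∞ T p₀ :=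
    (contMDiffOn_tubeChart ob q).contMDiffAt ((isOpen_tubeDomain q).mem_nhds hp₀s)
  obtain ⟨S, hS, hSp, hSi⟩ := exists_local_inverse hTs (bijective_mfderiv_tubeChart ob q)
  rw [hTp₀] at hS hSp hSi
  set Ψ : ℂ → Eu k × ℂ := fun z => S (K z) with hΨ
  have hΨs : ContDiffAt ℝ ∞ Ψ 0 := (hS.comp_of_eq hKs hK0).contDiffAt
  have hΨ0 : Ψ 0 = p₀ := by simp only [hΨ, hK0, hSp]
  have hΨi : ∀ᶠ z in 𝓝 0, T (Ψ z) = K z := by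
    have := hKs.continuousAt.eventually (p := fun x => T (S x) = x) (by rw [hK0]; exact hSi)
    exact this
  set m : Eu k × ℂ → ℂ := fun p => c.coord (T p) with hm
  have hms : ContDiffAt ℝ ∞ m p₀ := by
    have h1 : ContMDiffAt 𝓘(ℝ, Eu k × ℂ) (𝓡∂ (2 * k + 4)) ∞ (fun p => ι (j (T p))) p₀ :=
      (hι.contMDiff.comp hj.contMDiff).contMDiffAt.comp p₀ hTs
    have h2 : ContMDiffAt (𝓡∂ (2 * k + 4)) (IC k) ∞ c.toModel (ι (j (T p₀))) :=
      c.toModel_smooth.contMDiffAt (c.isOpen_O.mem_nhds (by rw [hTp₀]; exact c.binding_mem q))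
    have h3 : ContMDiffAt 𝓘(ℝ, Eu k × ℂ) (IC k) ∞ (fun p => c.toModel (ι (j (T p)))) p₀ :=
      ContMDiffAt.comp (f := fun p => ι (j (T p))) p₀ h2 h1
    have h4 : ContMDiffAt 𝓘(ℝ, Eu k × ℂ) 𝓘(ℝ, ℂ × ℂ) ∞ (fun p => (c.toModel (ι (j (T p)))).1) p₀ :=
      contMDiff_fst.contMDiffAt.comp p₀ h3
    exact contDiff_fst.contDiffAt.comp p₀ h4.contDiffAt
  have hmΨ : ∀ᶠ z in 𝓝 0, m (Ψ z) = z := by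
    filter_upwards [hΨi, hUn] with z hz hzU
    simp only [hm, hz, BindingModel.coord]
    rw [Function.comp_apply, hKe z hzU, hE₁, c.toModel_ofModel q (hPn z hzU).le (hPre z hzU)]
    rfl
  have hm0 : ∀ y, m (y, 0) = 0 := fun y =>
    c.coord_binding ⟨(extChartAt (𝓡 k) q).symm y, rfl⟩
  set B := fderiv ℝ Ψ 0 with hB
  have hBd : HasFDerivAt Ψ B 0 := (hΨs.differentiableAt (by simp)).hasFDerivAt
  have hmd : HasFDerivAt m (fderiv ℝ m p₀) p₀ := (hms.differentiableAt (by simp)).hasFDerivAt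
  refine ⟨fun z => (Ψ z).2, (ContinuousLinearMap.snd ℝ (Eu k) ℂ).comp B, hBd.snd, congrArg Prod.snd hΨ0,
    fun w hw => ?_, ?_⟩
  -- The model coordinate `m`, as a function of tube coordinates, is a left inverse of `Ψ` and
  -- vanishes along the binding. If the normal part of `B w` is zero, then `dm (B w)` is both `w`
  -- and `0`.
  · have h1 : HasFDerivAt (fun z => m (Ψ z)) ((fderiv ℝ m p₀).comp B) 0 :=
      HasFDerivAt.comp (g := m) 0 (by rw [hΨ0]; exact hmd) hBd
    have h2 : (fderiv ℝ m p₀).comp B = ContinuousLinearMap.id ℝ ℂ :=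
      (h1.congr_of_eventuallyEq (hmΨ.mono fun z hz => hz.symm)).unique (hasFDerivAt_id 0)
    have h3 : B w = ((B w).1, 0) := Prod.ext rfl hw
    have h4 : HasFDerivAt (fun y : Eu k => m (y, 0))
        ((fderiv ℝ m p₀).comp (ContinuousLinearMap.inl ℝ (Eu k) ℂ)) p₀.1 :=
      HasFDerivAt.comp (g := m) p₀.1 hmd (hasFDerivAt_prodMk_left p₀.1 (0 : ℂ))
    have h5 : (fderiv ℝ m p₀).comp (ContinuousLinearMap.inl ℝ (Eu k) ℂ) = 0 := by
      simp only [hm0] at h4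
      exact h4.unique (hasFDerivAt_const _ _)
    have h6 : fderiv ℝ m p₀ (B w) = w := congrArg (fun A : ℂ →L[ℝ] ℂ => A w) h2
    have h7 : fderiv ℝ m p₀ ((B w).1, 0) = 0 := congrArg (fun A : Eu k →L[ℝ] ℂ => A (B w).1) h5
    rw [← h6, h3, h7]
  · have hdom : ∀ᶠ z in 𝓝 0, Ψ z ∈ tubeDomain q :=
      hΨs.continuousAt.eventually_mem ((isOpen_tubeDomain q).mem_nhds (by rw [hΨ0]; exact hp₀s))
    filter_upwards [hΨi, hUn, hdom] with z hz hzU hzd x hx hne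
    have : x = K z := hinj (hx.trans (hKe z hzU).symm)
    rw [this, ← hz, hT, tubeChart]
    exact ob.ϑ_tube _ _ hne (mem_ball_zero_iff.1 hzd.2)

omit [TopologicalSpace M] [ChartedSpace (Eu (2 * k + 3)) M] [Nonempty N] in
theorem tendstoOnDisk_disk (c : BindingModel J (ι ∘ j) ob) (q : L) {s : Set ℝ}
    (hs : ∀ τ ∈ s, 1 - c.δ < Real.cos τ) (τ : s) :
    TendstoOnDisk (𝓝 τ) (fun τ : s => c.disk q τ) (c.disk q τ) := by
  intro z hz
  have h1 := (c.contMDiffOn_disk q).continuousOn (τ, z) ⟨hs τ τ.2, hz⟩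
  refine h1.tendsto.comp (f := fun x : s × ℂ => ((x.1 : ℝ), x.2)) (tendsto_nhdsWithin_iff.2 ⟨?_, ?_⟩)
  · exact ((continuous_subtype_val.tendsto τ).comp tendsto_fst).prodMk_nhds
      (tendsto_snd.mono_right nhdsWithin_le_nhds)
  · filter_upwards [tendsto_snd.eventually self_mem_nhdsWithin] with x hx
    exact ⟨hs _ x.1.2, hx⟩

/-- The boundary of a Bishop disk winds once around the binding. -/
theorem abs_sweptAngle_disk (hι : IsSmoothEmbedding (𝓡 (2 * k + 3)) (𝓡∂ (2 * k + 4)) ∞ ι)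
    (hj : IsSmoothEmbedding (𝓡∂ (k + 2)) (𝓡 (2 * k + 3)) ∞ j)
    (c : BindingModel J (ι ∘ j) ob) (q : L) {θ : ℝ} (hθ : θ ∈ Ioo 0 Real.pi)
    (hcos : 1 - c.δ < Real.cos θ) :
    |sweptAngle fun t => ob.ϑ (boundaryLoop (ι ∘ j) (c.disk q θ) t)| = 2 * Real.pi := by
  have hdom : ∀ τ ∈ Ioc 0 θ, 1 - c.δ < Real.cos τ := fun τ hτ =>
    hcos.trans_le (Real.cos_le_cos_of_nonneg_of_le_pi hτ.1.le hθ.2.le hτ.2)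
  have hsin : ∀ τ ∈ Ioc 0 θ, Real.sin τ ≠ 0 := fun τ hτ =>
    (Real.sin_pos_of_pos_of_lt_pi hτ.1 (hτ.2.trans_lt hθ.2)).ne'
  -- The angle `τ = 0` is excluded because the loop there is a point of the binding; constancy on
  -- `(0, θ]` still permits arbitrarily small disks.
  have hloc : IsLocallyConstant fun τ : Ioc 0 θ =>
      sweptAngle fun t => ob.ϑ (boundaryLoop (ι ∘ j) (c.disk q τ) t) := by
    rw [IsLocallyConstant.iff_eventually_eq]
    intro τ
    exact eventually_sweptAngle_eq hι hj (tendstoOnDisk_disk c q hdom τ)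
      (fun τ => c.isDiskMap_disk q (hdom τ τ.2)) (c.isDiskMap_disk q (hdom τ τ.2)) ob.ϑ_smooth
      ob.norm_ϑ (fun τ t => c.boundaryLoop_disk_notMem_binding q (hdom τ τ.2) (hsin τ τ.2) t)
      fun t => c.boundaryLoop_disk_notMem_binding q (hdom τ τ.2) (hsin τ τ.2) t
  have : PreconnectedSpace (Ioc 0 θ) := Subtype.preconnectedSpace isPreconnected_Ioc
  have hconst : ∀ τ (hτ : τ ∈ Ioc 0 θ),
      (sweptAngle fun t => ob.ϑ (boundaryLoop (ι ∘ j) (c.disk q θ) t)) =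
      sweptAngle fun t => ob.ϑ (boundaryLoop (ι ∘ j) (c.disk q τ) t) := fun τ hτ =>
    hloc.apply_eq_of_preconnectedSpace ⟨θ, hθ.1, le_rfl⟩ ⟨τ, hτ⟩
  obtain ⟨Φ, A, hΦ, hΦ0, hA, hev⟩ := exists_normal_coord hι hj c q
  have h1 : Tendsto Real.sin (𝓝[>] 0) (𝓝[>] 0) := by
    refine tendsto_nhdsWithin_iff.2 ⟨?_, ?_⟩
    · have := Real.continuous_sin.tendsto 0
      rw [Real.sin_zero] at this
      exact this.mono_left nhdsWithin_le_nhds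
    · filter_upwards [Ioo_mem_nhdsGT Real.pi_pos] with τ hτ using Real.sin_pos_of_mem_Ioo hτ
  obtain ⟨ε, hε, hball⟩ := Metric.eventually_nhds_iff_ball.1 hev
  have h2 : ∀ᶠ τ in 𝓝[>] (0 : ℝ), Real.sin τ < ε :=
    (h1.mono_right nhdsWithin_le_nhds).eventually (gt_mem_nhds hε)
  have h3 : ∀ᶠ τ in 𝓝[>] (0 : ℝ), τ ∈ Ioc 0 θ := Ioc_mem_nhdsGT hθ.1
  have h4 : ∀ᶠ τ in 𝓝[>] (0 : ℝ), τ ∈ Ioo 0 (Real.pi / 2) := Ioo_mem_nhdsGT Real.pi_div_two_pos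
  -- Choose `τ` so small that the circle of radius `sin τ` lies where the normal coordinate is
  -- nearly linear; `τ < π/2` gives `cos τ = √(1 - sin² τ)`, the form used in the slice.
  obtain ⟨τ, hτΦ, hτε, hτ, hτ2⟩ := ((h1.eventually
    (eventually_abs_sweptAngle_eq hΦ hΦ0 hA)).and (h2.and (h3.and h4))).exists
  rw [hconst τ hτ]
  have hdisk := c.isDiskMap_disk q (hdom τ hτ)
  have hs0 : 0 < Real.sin τ := Real.sin_pos_of_pos_of_lt_pi hτ.1 (hτ.2.trans_lt hθ.2)
  refine hτΦ _ ((hdisk.contDiff_comp_boundaryLoop hι hj ob.ϑ_smooth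
    fun t => c.boundaryLoop_disk_notMem_binding q (hdom τ hτ) (hsin τ hτ) t).of_le (by simp)) fun t ht => ?_
  have hn : ‖(Real.sin τ : ℂ) * circlePt t‖ = Real.sin τ := by
    rw [norm_mul, norm_circlePt, mul_one, Complex.norm_real, Real.norm_of_nonneg hs0.le]
  refine hball _ (by rw [mem_ball_zero_iff, hn]; exact hτε) _ ?_ ht
  refine (apply_boundaryLoop hdisk.boundary t).trans ?_
  rw [BindingModel.disk, hn, ← Real.cos_eq_sqrt_one_sub_sin_sq (by linarith [hτ2.1, Real.pi_pos]) hτ2.2.le]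

end Bishop

/-! ## The energy of a disk -/

/-- A form of top degree on the plane is a multiple of the determinant. -/
theorem alternating_complex_apply (τ : ℂ [⋀^Fin 2]→L[ℝ] ℝ) (v : Fin 2 → ℂ) :
    τ v = ((v 0).re * (v 1).im - (v 1).re * (v 0).im) * τ ![1, Complex.I] := by
  have h := congrArg (fun f : ℂ [⋀^Fin 2]→ₗ[ℝ] ℝ => f v)
    (AlternatingMap.eq_smul_basis_det Complex.basisOneI τ.toAlternatingMap)
  have h' : τ v = τ ⇑Complex.basisOneI * Complex.basisOneI.det v := h
  rw [h', Complex.coe_basisOneI, Module.Basis.det_apply, Matrix.det_fin_two]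
  simp only [Module.Basis.toMatrix_apply, Complex.coe_basisOneI_repr]
  simp
  ring

theorem hasFDerivAt_polar (x : Fin 2 → ℝ) : ∃ L : (Fin 2 → ℝ) →L[ℝ] ℂ, HasFDerivAt polar L x ∧
    L (stdVec 0) = Real.cos (x 0) * circlePt (x 1) ∧
    L (stdVec 1) = Real.sin (x 0) * (circlePt (x 1) * Complex.I) := by
  have h0 : HasFDerivAt (fun x : Fin 2 → ℝ => x 0) (ContinuousLinearMap.proj (R := ℝ) (φ := fun _ : Fin 2 => ℝ) 0) x :=
    (ContinuousLinearMap.proj (R := ℝ) (φ := fun _ : Fin 2 => ℝ) 0).hasFDerivAt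
  have h1 : HasFDerivAt (fun x : Fin 2 → ℝ => x 1) (ContinuousLinearMap.proj (R := ℝ) (φ := fun _ : Fin 2 => ℝ) 1) x :=
    (ContinuousLinearMap.proj (R := ℝ) (φ := fun _ : Fin 2 => ℝ) 1).hasFDerivAt
  have hs : HasDerivAt (fun t : ℝ => (Real.sin t : ℂ)) (Real.cos (x 0)) (x 0) :=
    (Real.hasDerivAt_sin (x 0)).ofReal_comp
  have hc : HasDerivAt circlePt (circlePt (x 1) * Complex.I) (x 1) := by
    have := ((Complex.ofRealCLM.hasDerivAt (x := x 1)).mul_const Complex.I).cexp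
    convert! this using 1
    simp [circlePt]
  have h2 : HasFDerivAt (fun x : Fin 2 → ℝ => (Real.sin (x 0) : ℂ)) _ x :=
    HasFDerivAt.comp x hs.hasFDerivAt h0
  have h3 : HasFDerivAt (fun x : Fin 2 → ℝ => circlePt (x 1)) _ x :=
    HasFDerivAt.comp (g := circlePt) x hc.hasFDerivAt h1
  refine ⟨_, h2.mul h3, ?_, ?_⟩
  · simp [stdVec]
    exact mul_comm _ _
  · simp [stdVec]

section Energy

variable {EW : Type*} [NormedAddCommGroup EW] [NormedSpace ℝ EW]
  {HW : Type*} [TopologicalSpace HW] {IW : ModelWithCorners ℝ EW HW}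
  {W : Type*} [TopologicalSpace W] [ChartedSpace HW W] [IsManifold IW ∞ W]

/-- The determinant of the derivative of `polar` is `sin · cos`, the weight in the polar formula. -/
theorem setIntegral_disk_pullForm {Ω : ∀ x : W, TangentSpace IW x [⋀^Fin 2]→L[ℝ] ℝ}
    (hΩ : IsSmoothForm IW Ω) {a : ℂ → W}
    (ha : ContMDiffOn 𝓘(ℝ, ℂ) IW ∞ a (Metric.closedBall 0 1)) :
    ∫ z in Metric.closedBall (0 : ℂ) 1,
      pullForm IW Ω a (Metric.closedBall 0 1) z ![1, Complex.I] =
      rectIntegral Ω fun x => a (polar x) := by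
  rw [setIntegral_disk_eq (contDiffOn_pullForm hΩ ha uniqueDiffOn_unitDisk _).continuousOn,
    rectIntegral]
  refine setIntegral_congr_fun measurableSet_Icc fun x _ => ?_
  obtain ⟨L, hL, hL0, hL1⟩ := hasFDerivAt_polar x
  have h := pullForm_comp Ω (f := a) uniqueDiffWithinAt_univ hL.hasFDerivWithinAt
    ((ha _ (polar_mem x)).mdifferentiableWithinAt (by simp)) (fun y _ => polar_mem y) stdVec
  refine Eq.trans ?_ h.symm
  rw [alternating_complex_apply _ fun i => L (stdVec i), hL0, hL1]
  congr 1
  have hc : (circlePt (x 1)).re ^ 2 + (circlePt (x 1)).im ^ 2 = 1 := by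
    have := Complex.normSq_eq_norm_sq (circlePt (x 1))
    rw [norm_circlePt, Complex.normSq_apply] at this
    nlinarith
  simp only [Complex.re_ofReal_mul, Complex.im_ofReal_mul, Complex.mul_I_re, Complex.mul_I_im]
  linear_combination (-Real.sin (x 0) * Real.cos (x 0)) * hc

end Energy

section DiskEnergy

variable {k : ℕ}
  {W : Type*} [TopologicalSpace W] [ChartedSpace (EuclideanHalfSpace (2 * k + 4)) W]
  [IsManifold (𝓡∂ (2 * k + 4)) ∞ W]
  {Ω : ∀ x : W, TangentSpace (𝓡∂ (2 * k + 4)) x [⋀^Fin 2]→L[ℝ] ℝ} {u : Disk → W}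

omit [IsManifold (𝓡∂ (2 * k + 4)) ∞ W] in
theorem energyDensity_eq_pullForm (Ω : ∀ x : W, TangentSpace (𝓡∂ (2 * k + 4)) x [⋀^Fin 2]→L[ℝ] ℝ)
    (u : Disk → W) : energyDensity Ω u = fun z =>
      pullForm (𝓡∂ (2 * k + 4)) Ω (diskExt u) (Metric.closedBall 0 1) z ![1, Complex.I] := by
  funext z
  refine congrArg (Ω (diskExt u z)) ?_
  ext i
  fin_cases i <;> rfl

theorem integrableOn_energyDensity (hΩ : IsSmoothForm (𝓡∂ (2 * k + 4)) Ω)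
    (hu : ContMDiffOn 𝓘(ℝ, ℂ) (𝓡∂ (2 * k + 4)) ∞ (diskExt u) (Metric.closedBall 0 1)) :
    IntegrableOn (energyDensity Ω u) (Metric.closedBall 0 1) := by
  rw [energyDensity_eq_pullForm]
  exact (contDiffOn_pullForm hΩ hu uniqueDiffOn_unitDisk _).continuousOn.integrableOn_compact
    (isCompact_closedBall 0 1)

theorem energy_eq_rectIntegral (hΩ : IsSmoothForm (𝓡∂ (2 * k + 4)) Ω)
    (hu : ContMDiffOn 𝓘(ℝ, ℂ) (𝓡∂ (2 * k + 4)) ∞ (diskExt u) (Metric.closedBall 0 1)) :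
    energy Ω u = rectIntegral Ω fun x => diskExt u (polar x) := by
  rw [energy, energyDensity_eq_pullForm, setIntegral_disk_pullForm hΩ hu]

end DiskEnergy

/-! ## The integral of the contact form along a transverse loop -/

/-- A continuous function without zeros has constant sign, so `∫ |g| = |∫ g|`. -/
theorem abs_intervalIntegral_mul_le {F g : ℝ → ℝ} (hF : Continuous F) (hg : Continuous g) {a b C : ℝ}
    (hab : a ≤ b) (hFC : ∀ t, |F t| ≤ C) (hg0 : ∀ t, g t ≠ 0) :
    |∫ t in a..b, F t * g t| ≤ C * |∫ t in a..b, g t| := by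
  have hsign : |∫ t in a..b, g t| = ∫ t in a..b, |g t| := by
    rcases lt_or_gt_of_ne (hg0 0) with h | h
    · have hneg : ∀ t, g t < 0 := fun t => by
        by_contra! ht
        obtain ⟨s, hs⟩ := mem_range_of_exists_le_of_exists_ge hg ⟨0, h.le⟩ ⟨t, ht⟩
        exact hg0 s hs
      simp only [abs_of_neg (hneg _), intervalIntegral.integral_neg]
      refine abs_of_nonpos ?_
      rw [← neg_nonneg, ← intervalIntegral.integral_neg]
      exact intervalIntegral.integral_nonneg hab fun t _ => neg_nonneg.2 (hneg t).le
    · have hpos : ∀ t, 0 < g t := fun t => by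
        by_contra! ht
        obtain ⟨s, hs⟩ := mem_range_of_exists_le_of_exists_ge hg ⟨t, ht⟩ ⟨0, h.le⟩
        exact hg0 s hs
      simp only [abs_of_pos (hpos _)]
      exact abs_of_nonneg (intervalIntegral.integral_nonneg hab fun t _ => (hpos t).le)
  rw [hsign, ← intervalIntegral.integral_const_mul]
  refine (intervalIntegral.abs_integral_le_integral_abs hab).trans
    (intervalIntegral.integral_mono_on hab ((hF.mul hg).abs.intervalIntegrable _ _)
      ((continuous_const.mul hg.abs).intervalIntegrable _ _) fun t _ => ?_)
  rw [abs_mul]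
  exact mul_le_mul_of_nonneg_right (hFC t) (abs_nonneg _)

section Path

variable {k : ℕ}
  {M : Type*} [TopologicalSpace M] [ChartedSpace (Eu (2 * k + 3)) M]
  {N : Type*} [TopologicalSpace N] [ChartedSpace (EuclideanHalfSpace (k + 2)) N]
  {L : Type*} [TopologicalSpace L] [ChartedSpace (Eu k) L]
  {α : ∀ p : M, TangentSpace (𝓡 (2 * k + 3)) p →L[ℝ] ℝ} {j : N → M} {ob : OpenBook k N L}

theorem pathIntegral_oneForm (α : ∀ p : M, TangentSpace (𝓡 (2 * k + 3)) p →L[ℝ] ℝ)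
    (hj : ContMDiff (𝓡∂ (k + 2)) (𝓡 (2 * k + 3)) ∞ j) {γ : ℝ → N}
    (hγ : ContMDiff 𝓘(ℝ, ℝ) (𝓡∂ (k + 2)) ∞ γ) :
    pathIntegral (oneForm (𝓡 (2 * k + 3)) α) (fun x => j (γ (x 0))) =
      ∫ t in -Real.pi..Real.pi,
        restrictForm α j (γ t) (mfderiv 𝓘(ℝ, ℝ) (𝓡∂ (k + 2)) γ t (1 : ℝ)) := by
  rw [pathIntegral, setIntegral_Icc_fin_one _ _ (by linarith [Real.pi_pos])]
  refine intervalIntegral.integral_congr fun t _ => ?_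
  have hp : HasMFDerivAt 𝓘(ℝ, Fin 1 → ℝ) 𝓘(ℝ, ℝ) (fun x : Fin 1 → ℝ => x 0) (fun _ => t)
      (ContinuousLinearMap.proj 0 : (Fin 1 → ℝ) →L[ℝ] ℝ) :=
    (hasFDerivAt_apply (0 : Fin 1) fun _ => t).hasMFDerivAt
  have h1 := (hγ.mdifferentiable (by simp) t).hasMFDerivAt
  have h2 := (hj.mdifferentiable (by simp) (γ t)).hasMFDerivAt
  have h3 := HasMFDerivAt.comp (g := γ) (f := fun x : Fin 1 → ℝ => x 0) (fun _ => t) h1 hp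
  have h4 := (HasMFDerivAt.comp (g := j) (f := γ ∘ fun x : Fin 1 → ℝ => x 0) (fun _ => t) h2 h3).mfderiv
  have h5 : (ContinuousLinearMap.proj 0 : (Fin 1 → ℝ) →L[ℝ] ℝ) (stdVec 0) = 1 := by simp [stdVec]
  have h6 := congrArg (fun A : (Fin 1 → ℝ) →L[ℝ] Eu (2 * k + 3) =>
    (show Eu (2 * k + 3) →L[ℝ] ℝ from α (j (γ t))) (A (stdVec 0))) h4
  have h7 := congrArg (fun s : ℝ => (show Eu (2 * k + 3) →L[ℝ] ℝ from α (j (γ t)))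
    ((mfderiv (𝓡∂ (k + 2)) (𝓡 (2 * k + 3)) j (γ t) : Eu (k + 2) →L[ℝ] Eu (2 * k + 3))
      ((mfderiv 𝓘(ℝ, ℝ) (𝓡∂ (k + 2)) γ t : ℝ →L[ℝ] Eu (k + 2)) s))) h5
  unfold pullForm
  rw [mfderivWithin_univ]
  exact h6.trans h7

/-- As `|ϑ| = 1`, the conjugate is the inverse. This identifies `dϑ(γ')` with the integrand of
`sweptAngle`. -/
theorem dAngle_mfderiv_eq (hB : IsClosed ob.binding) {γ : ℝ → N}
    (hγ : ContMDiff 𝓘(ℝ, ℝ) (𝓡∂ (k + 2)) ∞ γ) (hγB : ∀ t, γ t ∉ ob.binding) (t : ℝ) :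
    dAngle ob.ϑ (γ t) (mfderiv 𝓘(ℝ, ℝ) (𝓡∂ (k + 2)) γ t (1 : ℝ)) =
      (deriv (fun t => ob.ϑ (γ t)) t / ob.ϑ (γ t)).im := by
  have hϑ : MDifferentiableAt (𝓡∂ (k + 2)) 𝓘(ℝ, ℂ) ob.ϑ (γ t) :=
    (ob.ϑ_smooth.contMDiffAt (hB.isOpen_compl.mem_nhds (hγB t))).mdifferentiableAt (by simp)
  set A : ℝ →L[ℝ] ℂ := (mfderiv (𝓡∂ (k + 2)) 𝓘(ℝ, ℂ) ob.ϑ (γ t) : Eu (k + 2) →L[ℝ] ℂ).comp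
    (mfderiv 𝓘(ℝ, ℝ) (𝓡∂ (k + 2)) γ t : ℝ →L[ℝ] Eu (k + 2)) with hA
  have h0 : HasFDerivAt (fun t => ob.ϑ (γ t)) A t :=
    (HasMFDerivAt.comp (g := ob.ϑ) (f := γ) t hϑ.hasMFDerivAt
      (hγ.mdifferentiable (by simp) t).hasMFDerivAt).hasFDerivAt
  have h1 := h0.hasDerivAt.deriv
  have h2 : (ob.ϑ (γ t))⁻¹ = star (ob.ϑ (γ t)) := by
    rw [Complex.inv_def, Complex.normSq_eq_norm_sq, ob.norm_ϑ _ (hγB t)]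
    simp
  have h3 := congrArg (fun w : ℂ => (star (ob.ϑ (γ t)) * w).im) h1
  rw [div_eq_mul_inv, h2, mul_comm]
  exact h3.symm

/-- A loop transverse to the contact structure that winds once around the binding has action at most
`2 π max |f|`. -/
theorem abs_pathIntegral_le (hj : ContMDiff (𝓡∂ (k + 2)) (𝓡 (2 * k + 3)) ∞ j)
    (hB : IsClosed ob.binding) (hleaves : LeavesInPages α j ob)
    (hf : Continuous (contactFun α j ob)) {C : ℝ} (hC : ∀ x, |contactFun α j ob x| ≤ C)
    {γ : ℝ → N} (hγ : ContMDiff 𝓘(ℝ, ℝ) (𝓡∂ (k + 2)) ∞ γ) (hγB : ∀ t, γ t ∉ ob.binding)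
    (htrans : ∀ t, restrictForm α j (γ t) (mfderiv 𝓘(ℝ, ℝ) (𝓡∂ (k + 2)) γ t (1 : ℝ)) ≠ 0) :
    |pathIntegral (oneForm (𝓡 (2 * k + 3)) α) (fun x => j (γ (x 0)))| ≤
      C * |sweptAngle fun t => ob.ϑ (γ t)| := by
  have hr : ∀ t, restrictForm α j (γ t) (mfderiv 𝓘(ℝ, ℝ) (𝓡∂ (k + 2)) γ t (1 : ℝ)) =
      contactFun α j ob (γ t) * (deriv (fun t => ob.ϑ (γ t)) t / ob.ϑ (γ t)).im := fun t => by
    rw [restrictForm_eq_contactFun_mul hleaves (hγB t), dAngle_mfderiv_eq hB hγ hγB]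
  have hcs : ContDiff ℝ ∞ fun t => ob.ϑ (γ t) := (ob.ϑ_smooth.comp_contMDiff hγ hγB).contDiff
  have hne : ∀ t, ob.ϑ (γ t) ≠ 0 := fun t h => by
    have := ob.norm_ϑ _ (hγB t)
    rw [h, norm_zero] at this
    exact zero_ne_one this
  rw [pathIntegral_oneForm α hj hγ, sweptAngle]
  simp only [hr]
  -- Transversality makes the product `f · dϑ(γ')` nonzero, so `dϑ(γ')` has no zero and the swept
  -- angle is its total variation up to sign.
  refine abs_intervalIntegral_mul_le (hf.comp hγ.continuous) ?_ (by linarith [Real.pi_pos])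
    (fun t => hC _) fun t h => ?_
  · exact Complex.continuous_im.comp ((hcs.continuous_deriv (by simp)).div hcs.continuous hne)
  · exact htrans t ((hr t).trans (by rw [h, mul_zero]))

end Path

/-! ## The energy bound on the component of the Bishop family -/

section Bound

variable {k : ℕ}
  {W : Type*} [TopologicalSpace W] [T2Space W]
  [ChartedSpace (EuclideanHalfSpace (2 * k + 4)) W] [IsManifold (𝓡∂ (2 * k + 4)) ∞ W]
  {M : Type*} [TopologicalSpace M] [ChartedSpace (Eu (2 * k + 3)) M]
  {N : Type*} [TopologicalSpace N] [ChartedSpace (EuclideanHalfSpace (k + 2)) N] [Nonempty N]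
  {L : Type*} [TopologicalSpace L] [ChartedSpace (Eu k) L] [IsManifold (𝓡 k) ∞ L]
  {Ω : ∀ x : W, TangentSpace (𝓡∂ (2 * k + 4)) x [⋀^Fin 2]→L[ℝ] ℝ}
  {ι : M → W} {α : ∀ p : M, TangentSpace (𝓡 (2 * k + 3)) p →L[ℝ] ℝ} {j : N → M}
  {J : ∀ x : W, TangentSpace (𝓡∂ (2 * k + 4)) x →L[ℝ] TangentSpace (𝓡∂ (2 * k + 4)) x}
  {ob : OpenBook k N L}

theorem convex_range_halfSpace (n : ℕ) [NeZero n] : Convex ℝ (range (𝓡∂ n)) := by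
  rw [range_modelWithCornersEuclideanHalfSpace]
  exact convex_halfSpace_ge (EuclideanSpace.proj (𝕜 := ℝ) (0 : Fin n)).toLinearMap.isLinear 0

omit [T2Space W] [Nonempty N] in
theorem exists_isInterpolation (hι : IsSmoothEmbedding (𝓡 (2 * k + 3)) (𝓡∂ (2 * k + 4)) ∞ ι)
    (hj : IsSmoothEmbedding (𝓡∂ (k + 2)) (𝓡 (2 * k + 3)) ∞ j) (hcl : IsClosed (range (ι ∘ j)))
    (w : W) : ∃ O m, IsInterpolation (𝓡∂ (2 * k + 4)) (range (ι ∘ j)) O m ∧ w ∈ O := by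
  by_cases hw : w ∈ range (ι ∘ j)
  · obtain ⟨x, rfl⟩ := hw
    exact exists_isInterpolation_of_mem (ModelWithCorners.Boundaryless.range_eq_univ)
      (convex_range_halfSpace _) (EuclideanSpace.proj (𝕜 := ℝ) (0 : Fin (2 * k + 4)))
      (range_modelWithCornersEuclideanHalfSpace _) hι hj x
  · exact exists_isInterpolation_of_notMem hcl hw (convex_range_halfSpace _)

/-- The winding number of the boundary around the binding is constant on components. -/
theorem abs_sweptAngle_eq (hfill : IsWeakFilling Ω ι α)
    (hj : IsSmoothEmbedding (𝓡∂ (k + 2)) (𝓡 (2 * k + 3)) ∞ j) (hJ : IsTamedConvex Ω ι α J)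
    (hsing : ob.binding ⊆ singSet α j) {c : BindingModel J (ι ∘ j) ob} {B₀ : Set L}
    {u v : HolDisk J (ι ∘ j)} (hv : v ∈ bishopFamily c B₀) (huv : u ∈ connectedComponent v) :
    |sweptAngle fun t => ob.ϑ (boundaryLoop (ι ∘ j) (diskExt u.toFun) t)| = 2 * Real.pi := by
  have hoff : ∀ (u : HolDisk J (ι ∘ j)) t,
      boundaryLoop (ι ∘ j) (diskExt u.toFun) t ∉ ob.binding := fun u t h =>
    u.boundaryLoop_notMem_singSet hfill hj hJ t (hsing h)
  have hloc : IsLocallyConstant fun u : HolDisk J (ι ∘ j) =>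
      sweptAngle fun t => ob.ϑ (boundaryLoop (ι ∘ j) (diskExt u.toFun) t) := by
    rw [IsLocallyConstant.iff_eventually_eq]
    exact fun u => eventually_sweptAngle_eq hfill.embedding hj u.tendstoOnDisk_nhds
      (fun v => v.isDiskMap) u.isDiskMap ob.ϑ_smooth ob.norm_ϑ hoff (hoff u)
  have h := hloc.apply_eq_of_isPreconnected isPreconnected_connectedComponent huv
    mem_connectedComponent
  obtain ⟨q, θ, hθ, hcos, hvd⟩ := exists_eqOn_disk hv
  rw [h, boundaryLoop_congr hvd, abs_sweptAngle_disk hfill.embedding hj c q hθ hcos]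

variable [IsManifold (𝓡 (2 * k + 3)) ∞ M]

/-- Stokes' theorem for the disks in the component of the Bishop family: their energy is the action
of their boundary. -/
theorem excess_eq_zero (hfill : IsWeakFilling Ω ι α)
    (hj : IsSmoothEmbedding (𝓡∂ (k + 2)) (𝓡 (2 * k + 3)) ∞ j) (hcl : IsClosed (range (ι ∘ j)))
    (hΩα : ∀ (x : N) (v w : TangentSpace (𝓡∂ (k + 2)) x),
      Ω (ι (j x)) ![mfderiv (𝓡∂ (k + 2)) (𝓡∂ (2 * k + 4)) (ι ∘ j) x v,
        mfderiv (𝓡∂ (k + 2)) (𝓡∂ (2 * k + 4)) (ι ∘ j) x w] =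
      dForm (𝓡 (2 * k + 3)) (oneForm (𝓡 (2 * k + 3)) α) (j x)
        ![mfderiv (𝓡∂ (k + 2)) (𝓡 (2 * k + 3)) j x v,
          mfderiv (𝓡∂ (k + 2)) (𝓡 (2 * k + 3)) j x w])
    {c : BindingModel J (ι ∘ j) ob} {B₀ : Set L} {u v : HolDisk J (ι ∘ j)}
    (hv : v ∈ bishopFamily c B₀) (huv : u ∈ connectedComponent v) :
    excess Ω (oneForm (𝓡 (2 * k + 3)) α) ι j (diskExt u.toFun) = 0 := by
  have hG : ∀ h : ℝ × ℂ → W, ContMDiffOn 𝓘(ℝ, ℝ × ℂ) (𝓡∂ (2 * k + 4)) ∞ h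
      (univ ×ˢ Metric.closedBall 0 1) → (∀ τ z, ‖z‖ = 1 → h (τ, z) ∈ range (ι ∘ j)) →
      excess Ω (oneForm (𝓡 (2 * k + 3)) α) ι j (fun z => h (1, z)) =
        excess Ω (oneForm (𝓡 (2 * k + 3)) α) ι j (fun z => h (0, z)) := fun h hh hb =>
    excess_eq_of_homotopy hfill.symplectic.smooth hfill.symplectic.closed hfill.smooth
      hfill.embedding hj hΩα hh hb
  have hloc : IsLocallyConstant fun u : HolDisk J (ι ∘ j) =>
      excess Ω (oneForm (𝓡 (2 * k + 3)) α) ι j (diskExt u.toFun) := by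
    rw [IsLocallyConstant.iff_eventually_eq]
    exact fun u => eventually_eq_of_tendstoOnDisk hG (fun a b hab => excess_congr _ _ _ _ hab)
      (exists_isInterpolation hfill.embedding hj hcl) u.isDiskMap (fun v => v.isDiskMap)
      u.tendstoOnDisk_nhds
  exact (hloc.apply_eq_of_isPreconnected isPreconnected_connectedComponent huv
    mem_connectedComponent).trans (excess_bishop_eq_zero hG hv)

/-- Vanishing of the excess replaces the energy by the action, transversality bounds the action by
`C` times the swept angle, and that angle has absolute value `2π`. -/
theorem energy_le [CompactSpace N] (hfill : IsWeakFilling Ω ι α)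
    (hj : IsSmoothEmbedding (𝓡∂ (k + 2)) (𝓡 (2 * k + 3)) ∞ j)
    (hsing : ob.binding ⊆ singSet α j) (hleaves : LeavesInPages α j ob)
    (hΩα : ∀ (x : N) (v w : TangentSpace (𝓡∂ (k + 2)) x),
      Ω (ι (j x)) ![mfderiv (𝓡∂ (k + 2)) (𝓡∂ (2 * k + 4)) (ι ∘ j) x v,
        mfderiv (𝓡∂ (k + 2)) (𝓡∂ (2 * k + 4)) (ι ∘ j) x w] =
      dForm (𝓡 (2 * k + 3)) (oneForm (𝓡 (2 * k + 3)) α) (j x)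
        ![mfderiv (𝓡∂ (k + 2)) (𝓡 (2 * k + 3)) j x v,
          mfderiv (𝓡∂ (k + 2)) (𝓡 (2 * k + 3)) j x w])
    (hJ : IsTamedConvex Ω ι α J) (hB : IsClosed ob.binding)
    (hf : Continuous (contactFun α j ob)) {C : ℝ} (hC : ∀ x, |contactFun α j ob x| ≤ C)
    {c : BindingModel J (ι ∘ j) ob} {B₀ : Set L} {u v : HolDisk J (ι ∘ j)}
    (hv : v ∈ bishopFamily c B₀) (huv : u ∈ connectedComponent v) :
    energy Ω u.toFun ≤ 2 * Real.pi * C := by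
  have hcl : IsClosed (range (ι ∘ j)) :=
    (isCompact_range (hfill.embedding.isEmbedding.comp hj.isEmbedding).continuous).isClosed
  have h1 := excess_eq_zero hfill hj hcl hΩα hv huv
  have h2 := abs_pathIntegral_le hj.contMDiff hB hleaves hf hC
    (u.isDiskMap.contMDiff_boundaryLoop hfill.embedding hj)
    (fun t h => u.boundaryLoop_notMem_singSet hfill hj hJ t (hsing h))
    (u.restrictForm_boundaryLoop_ne_zero hfill hj hJ)
  rw [abs_sweptAngle_eq hfill hj hJ hsing hv huv] at h2
  rw [energy_eq_rectIntegral hfill.symplectic.smooth u.smooth, sub_eq_zero.1 h1]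
  exact (le_abs_self _).trans (h2.trans_eq (mul_comm _ _))

end Bound

end BishopDisk

end

/-! ### The contact function and the energy bound together -/

theorem mainTheorem6 {k : ℕ}
    {W : Type*} [TopologicalSpace W] [T2Space W] [CompactSpace W]
    [ChartedSpace (EuclideanHalfSpace (2 * k + 4)) W] [IsManifold (𝓡∂ (2 * k + 4)) ∞ W]
    {M : Type*} [TopologicalSpace M] [ChartedSpace (Eu (2 * k + 3)) M]
    [IsManifold (𝓡 (2 * k + 3)) ∞ M]
    {N : Type*} [TopologicalSpace N] [CompactSpace N]
    [ChartedSpace (EuclideanHalfSpace (k + 2)) N] [IsManifold (𝓡∂ (k + 2)) ∞ N]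
    {L : Type*} [TopologicalSpace L] [T2Space L] [CompactSpace L]
    [ChartedSpace (Eu k) L] [IsManifold (𝓡 k) ∞ L]
    {F : Type*} [TopologicalSpace F] [T2Space F] [CompactSpace F]
    [ChartedSpace (Eu k) F] [IsManifold (𝓡 k) ∞ F]
    (Ω : ∀ x : W, TangentSpace (𝓡∂ (2 * k + 4)) x [⋀^Fin 2]→L[ℝ] ℝ)
    (ι : M → W) (α : ∀ p : M, TangentSpace (𝓡 (2 * k + 3)) p →L[ℝ] ℝ)
    (hfill : IsWeakFilling Ω ι α)
    (j : N → M) (ob : OpenBook k N L)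
    (hN : IsLob α j ob ∨ IsBLob α j ob)
    (hΩα : ∀ (x : N) (v w : TangentSpace (𝓡∂ (k + 2)) x),
      Ω (ι (j x)) ![mfderiv (𝓡∂ (k + 2)) (𝓡∂ (2 * k + 4)) (ι ∘ j) x v,
        mfderiv (𝓡∂ (k + 2)) (𝓡∂ (2 * k + 4)) (ι ∘ j) x w] =
      dForm (𝓡 (2 * k + 3)) (oneForm (𝓡 (2 * k + 3)) α) (j x)
        ![mfderiv (𝓡∂ (k + 2)) (𝓡 (2 * k + 3)) j x v,
          mfderiv (𝓡∂ (k + 2)) (𝓡 (2 * k + 3)) j x w])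
    (J : ∀ x : W, TangentSpace (𝓡∂ (2 * k + 4)) x →L[ℝ] TangentSpace (𝓡∂ (2 * k + 4)) x)
    (hJ : IsTamedConvex Ω ι α J)
    (cB : BindingModel J (ι ∘ j) ob)
    (cF : ((𝓡∂ (k + 2)).boundary N).Nonempty → Nonempty (BoundaryModel F J (ι ∘ j))) :
    ∃ f : N → ℝ, ContMDiff (𝓡∂ (k + 2)) 𝓘(ℝ, ℝ) ∞ f ∧
      (∀ x ∉ ob.binding, ∀ v : TangentSpace (𝓡∂ (k + 2)) x,
        restrictForm α j x v = f x * dAngle ob.ϑ x v) ∧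
      (∀ x, f x = 0 ↔ x ∈ ob.binding ∪ (𝓡∂ (k + 2)).boundary N) ∧
      ∃ x₀ : N, (∀ x, |f x| ≤ |f x₀|) ∧ 0 < 2 * Real.pi * |f x₀| ∧
        ∀ q₀ : L, ∀ u ∈ bishopComponent cB q₀,
          IntegrableOn (energyDensity Ω u.toFun) (Metric.closedBall 0 1) ∧
          energy Ω u.toFun ≤ 2 * Real.pi * |f x₀| := by
  -- A Legendrian open book is treated as the bordered case with empty boundary.
  obtain ⟨hj, hsing, hleaves⟩ : IsSmoothEmbedding (𝓡∂ (k + 2)) (𝓡 (2 * k + 3)) ∞ j ∧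
      singSet α j = (𝓡∂ (k + 2)).boundary N ∪ ob.binding ∧ LeavesInPages α j ob := by
    rcases hN with h | h
    · exact ⟨h.embedding, by rw [h.sing, h.boundary, empty_union], h.leaves⟩
    · exact ⟨h.embedding, h.sing, h.leaves⟩
  -- `N` inherits the Hausdorff property from `W` through the embeddings; it makes the compact
  -- binding closed.
  have : T2Space N := (hfill.embedding.isEmbedding.comp hj.isEmbedding).t2Space
  have : Nonempty N := ob.nonempty.map fun q => ob.tube (q, 0)
  have hB := isClosed_binding ob
  have hf := contMDiff_contactFun hfill.smooth hj.contMDiff hleaves hB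
  obtain ⟨x₀, hx₀, hpos⟩ := exists_isMax_abs_contactFun hf.continuous hleaves hsing
  refine ⟨contactFun α j ob, hf, fun x hx v => restrictForm_eq_contactFun_mul hleaves hx v,
    contactFun_eq_zero_iff hleaves hsing, x₀, hx₀, mul_pos Real.two_pi_pos hpos, ?_⟩
  rintro q₀ u ⟨v, hv, huv⟩
  exact ⟨integrableOn_energyDensity hfill.symplectic.smooth u.smooth,
    energy_le hfill hj (hsing ▸ subset_union_right) hleaves hΩα hJ hB hf.continuous hx₀ hv huv⟩
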